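/- **Setting.** Let $G=SL(3,\mathbf R)$, $K=SO(3)$, $\mathfrak a_0=\{\mathrm{diag}(t_1,t_2,t_3): t_1+t_2+t_3=0\}$, $H_1=\mathrm{diag}(1,0,-1)$, $H_2=\mathrm{diag}(0,1,-1)$, $A_0=\exp\mathfrak a_0$, $N_0$ the upper triangular unipotent matrices, and $M_0=\{\mathrm{diag}(\varepsilon_1,\varepsilon_2,\varepsilon_1\varepsilon_2):\varepsilon_i=\pm1\}$. Let $\nu_0\in\mathrm{Hom}_{\mathbf R}(\mathfrak a_0,\mathbf C)$, $\nu_{0,i}=\nu_0(H_i)$, let $\rho_0$ be the half sum of the positive roots, $(\rho_{0,1},\rho_{0,2})=(2,1)$, and let $\sigma_0$ be the character $\mathrm{diag}(\varepsilon_1,\varepsilon_2,\varepsilon_1\varepsilon_2)\mapsto\varepsilon_1^{\sigma_{0,1}}\varepsilon_2^{\sigma_{0,2}}$ of $M_0$, $\sigma_{0,1},\sigma_{0,2}\in\{0,1\}$. Let $H_K$ be the space of right $K$-finite smooth functions $f:G\to\mathbf C$ with $f(namx)=e^{\nu_0+\rho_0}(a)\sigma_0(m)f(x)$ for $n\in N_0$,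 $a\in A_0$, $m\in M_0$, $x\in G$, where $e^{\nu}(\exp t)=e^{\nu(t)}$; $K$ acts by right translation and $\mathfrak g_{\mathbf C}$ by the ($\mathbf C$-linearly extended) differential $\pi$ of right translation. For an integer $n\ge0$ let $V_n$ be the space of homogeneous polynomials of degree $n$ in $x,y$ over $\mathbf C$, with standard basis $v_k^{(n)}=x^ky^{n-k}$ ($0\le k\le n$; put $v_k^{(n)}=0$ for other $k$), dual basis $v_k^{(n)*}$, and the action $\tau_n(g)f=f\circ g^{-1}$ of $SU(2)$. For $n=2l$ it descends to a representation $\tau_{2l}$ of $K$ through the double covering $\varphi:SU(2)\to SO(3)$, $$\varphi\begin{pmatrix}p+iq&r+is\\-r+is&p-iq\end{pmatrix}=\begin{pmatrix}p^2+q^2-r^2-s^2&-2(ps-qr)&2(pr+qs)\\2(ps+qr)&p^2-q^2+r^2-s^2&-2(pq-rs)\\-2(pr-qs)&2(pq+rs)&p^2-q^2-r^2+s^2\end{pmatrix}.$$ Let $\mathfrak p_{\mathbf C}$ be the space of symmetric complex $3\times3$ matrices of trace $0$, with basis $$X_0=\begin{pmatrix}0&0&0\\0&1&-i\\0&-i&-1\end{pmatrix},\quad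 X_1=-\tfrac12\begin{pmatrix}0&i&1\\i&0&0\\1&0&0\end{pmatrix},\quad X_2=-\tfrac13\begin{pmatrix}2&0&0\\0&-1&0\\0&0&-1\end{pmatrix},$$ $$X_3=-\tfrac12\begin{pmatrix}0&i&-1\\i&0&0\\-1&0&0\end{pmatrix},\quad X_4=\begin{pmatrix}0&0&0\\0&1&i\\0&i&-1\end{pmatrix}.$$ **Clebsch–Gordan coefficients.** Put $A_{[l,2m;k,i]}=a(l,2m;k,i)/d(l,2m)$ for $0\le k\le l+2m$ and $A_{[l,2m;k,i]}=0$ for other $k$, where the rows $(a(l,2m;k,0),\dots,a(l,2m;k,4))$ and the $d(l,2m)$ are * $m=2$: $\big((l+4-k)(l+3-k)(l+2-k)(l+1-k),\ 4(l+4-k)(l+3-k)(l+2-k)k,\ 6(l+4-k)(l+3-k)k(k-1),\ 4(l+4-k)k(k-1)(k-2),\ k(k-1)(k-2)(k-3)\big)$, $d=(l+4)(l+3)(l+2)(l+1)$; * $m=1$: $\big((l+2-k)(l+1-k)(l-k),\ -(l+2-k)(l+1-k)(l-4k),\ -3(l+2-k)(l-2k+2)k,\ -(3l-4k+8)k(k-1),\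 -k(k-1)(k-2)\big)$, $d=(l+2)(l+1)l$; * $m=0$: $\big((l-k)(l-1-k),\ -2(l-k)(l-2k-1),\ l^2-6kl+6k^2-l,\ 2(l-2k+1)k,\ k(k-1)\big)$, $d=l(l-1)$; * $m=-1$: $\big(l-k-2,\ -(3l-4k-6),\ 3(l-2k-2),\ -(l-4k-2),\ -k\big)$, $d=l-2$; * $m=-2$: $(1,-4,6,-4,1)$, $d=1$. (The coefficients with $d(l,2m)=0$ are put equal to $0$; below this concerns only the degenerate case $l=m=0$, in which $V_0$ does not occur in $V_0\otimes\mathfrak p_{\mathbf C}$.) Let $I^{2l}_{2m}:V_{2(l+m)}\to V_{2l}\otimes\mathfrak p_{\mathbf C}$ be the linear map $v_k^{(2(l+m))}\mapsto\sum_{i=0}^4A_{[2l,2m;k,i]}\,v^{(2l)}_{k+2-m-i}\otimes X_i$. For $\eta\in\mathrm{Hom}_K(V_{2l},H_K)$ put $\tilde\eta(v\otimes X)=\pi(X)\eta(v)$ and $\Gamma^0_{l,m}(\eta)=\tilde\eta\circ I^{2l}_{2m}$. Let $R(\iota_i^{(l,m)})$ be the $(2(l+m)+1)\times(2l+1)$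 matrix with rows and columns counted from $0$ whose $(r,q)$ entry is $A_{[2l,2m;r,i]}$ if $q=r+2-m-i$ and $0$ otherwise, and for $\mathbf v={}^t(v_0,\dots,v_{2l})$ with $v_q\in H_K$ let $\mathfrak C_{l,m}\mathbf v$ be the column of length $2(l+m)+1$ whose component $r$ is $\sum_{i=0}^4\sum_{q=0}^{2l}R(\iota_i^{(l,m)})_{r,q}\,\pi(X_i)v_q$. **Induced basis.** Let $\varepsilon(\sigma_0;l),\delta(\sigma_0;l)\in\{0,1\}$ with $\varepsilon(\sigma_0;l)\equiv l-\sigma_{0,1}-\sigma_{0,2}$ and $\delta(\sigma_0;l)\equiv l-\sigma_{0,2}\pmod 2$. Let $Z(\sigma_0;l)$ be the set of integers $k\equiv l-\sigma_{0,2}\pmod 2$ with $0\le k\le l-\varepsilon(\sigma_0;l)$, and $d(\sigma_0;l)=|Z(\sigma_0;l)|$. For $p\in Z(\sigma_0;l)$ and $0\le q\le 2l$ let $s(l;p,q)$ be the unique element of $H_K$ whose restriction to $K$ is $x\mapsto\langle v^{(2l)*}_{2l-p}+(-1)^{\varepsilon(\sigma_0;l)}v^{(2l)*}_p,\tau_{2l}(x)v^{(2l)}_q\rangle$,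 let $S(l;p)={}^t(s(l;p,0),\dots,s(l;p,2l))$, which is identified with the linear map $V_{2l}\to H_K$, $v_q^{(2l)}\mapsto s(l;p,q)$, and let $\mathbf S(\sigma_0;l)=(S(l;\delta),S(l;\delta+2),\dots,S(l;\delta+2d-2))$ for $\delta=\delta(\sigma_0;l)$, $d=d(\sigma_0;l)$. **Theorem.** Let $l\ge0$ and $-2\le m\le2$ be integers with $d(\sigma_0;l)>0$ and $d(\sigma_0;l+m)>0$. Then the elements $s(l;p,q)$ and $s(l+m;p,q)$ exist, the columns of $\mathbf S(\sigma_0;l)$ and of $\mathbf S(\sigma_0;l+m)$ form bases of $\mathrm{Hom}_K(V_{2l},H_K)$ and $\mathrm{Hom}_K(V_{2(l+m)},H_K)$ respectively, $\Gamma^0_{l,m}$ is a linear map $\mathrm{Hom}_K(V_{2l},H_K)\to\mathrm{Hom}_K(V_{2(l+m)},H_K)$ whose matrix with respect to these bases is the matrix $R(\Gamma^0_{l,m})$ of size $d(\sigma_0;l+m)\times d(\sigma_0;l)$ described below, and $$\mathfrak C_{l,m}\,\mathbf S(\sigma_0;l)=\mathbf S(\sigma_0;l+m)\cdot R(\Gamma^0_{l,m}).$$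 Put $$\gamma_{[l,m;p,1]}=(\nu_{0,2}+\rho_{0,2}-l+p)A_{[2l,2m;2l-p+m-2,0]},\qquad\gamma_{[l,m;p,-1]}=(\nu_{0,2}+\rho_{0,2}+l-p)A_{[2l,2m;2l-p+m+2,4]},$$ $$\gamma_{[l,m;p,0]}=-\tfrac13\Big(2\nu_{0,1}-\nu_{0,2}+2\rho_{0,1}-\rho_{0,2}+lm-3+\tfrac{m(m+1)}2\Big)A_{[2l,2m;2l-p+m,2]},$$ and let $n(\sigma_0;l,m)$ be $(2-m)/2$ if $m$ is even, $(3-m)/2$ if $m$ is odd and $l+\sigma_{0,2}$ is even, and $(1-m)/2$ if $m$ and $l+\sigma_{0,2}$ are odd. Write $d=d(\sigma_0;l)$ and $\gamma_i(k)=\gamma_{[l,m;2k+\delta(\sigma_0;l),i]}$, and count rows and columns from $0$. For integers $r\geq 0$ and $c$, let $D_r^c(f)$ be the matrix with $d$ columns whose entry at $(k+r,k)$ is $f(k)$ for $0\le k\le c$ and whose other entries are $0$, and let $E_j(x)$ be the matrix with $d$ columns whose only nonzero entry is $x$, at $(j,d-1)$. Then $$\begin{pmatrix}O_{n(\sigma_0;l,m),\,d}\\R(\Gamma^0_{l,m})\end{pmatrix}$$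 equals (as matrices of the stated number of rows, so that in particular the first $n(\sigma_0;l,m)$ rows of the following sums vanish): 1. if $\sigma_{0,2}=0$, $m$ even, $\sigma_{0,1}+l$ even ($d+1$ rows): $D_0^{d-1}(\gamma_{-1})+D_1^{d-1}(\gamma_0)+D_2^{d-2}(\gamma_1)+E_{d-1}(\gamma_{[l,m;l,1]})$; 2. if $\sigma_{0,2}=0$, $m$ even, $\sigma_{0,1}+l$ odd ($d+1$ rows): $D_0^{d-1}(\gamma_{-1})+D_1^{d-1}(\gamma_0)+D_2^{d-2}(\gamma_1)$; 3. if $\sigma_{0,2}=0$, $m$ odd, $\sigma_{0,1}+l$ even ($d$ rows): $D_0^{d-1}(\gamma_{-1})+D_1^{d-2}(\gamma_0)+D_2^{d-3}(\gamma_1)+E_{d-1}(-\gamma_{[l,m;l,1]})$; 4. if $\sigma_{0,2}=0$, $m$ odd, $\sigma_{0,1}+l$ odd ($d+2$ rows): $D_0^{d-1}(\gamma_{-1})+D_1^{d-1}(\gamma_0)+D_2^{d-1}(\gamma_1)$; 5. if $\sigma_{0,2}=1$ ($d+1$ rows): $D_0^{d-1}(\gamma_{-1})+D_1^{d-1}(\gamma_0)+D_2^{d-2}(\gamma_1)+E_{d}\big((-1)^{\varepsilon(\sigma_0;l+m)}\gamma_{[l,m;l-1,1]}\big)$.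 -/

import Mathlib

open scoped ContDiff

namespace SL3

open Matrix

/-- The group `G = SL(3, ℝ)`. -/
abbrev G : Type := Matrix.SpecialLinearGroup (Fin 3) ℝ

/-- The underlying matrix of `g ∈ G`. -/
def mat (g : G) : Matrix (Fin 3) (Fin 3) ℝ := g.1

/-- The element of `G` with the given matrix. -/
def mkG (A : Matrix (Fin 3) (Fin 3) ℝ) (hA : A.det = 1) : G := ⟨A, hA⟩

theorem mat_ext {g h : G} (e : mat g = mat h) : g = h := Subtype.ext e
@[simp] theorem mat_mkG (A : Matrix (Fin 3) (Fin 3) ℝ) (hA : A.det = 1) : mat (mkG A hA) = A := rfl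
@[simp] theorem mat_mul (g h : G) : mat (g * h) = mat g * mat h := rfl
@[simp] theorem mat_one : mat 1 = 1 := rfl
@[simp] theorem det_mat (g : G) : (mat g).det = 1 := g.2

theorem mat_inv (g : G) : mat g⁻¹ = (mat g)⁻¹ := by
  symm; apply Matrix.inv_eq_right_inv
  rw [← mat_mul, mul_inv_cancel, mat_one]

/-- The fixed points `K = SO(3)` of the Cartan involution `g ↦ ᵗg⁻¹`. -/
def K : Subgroup G where
  carrier := {g | (mat g)ᵀ * mat g = 1}
  mul_mem' := by
    intro a b (ha : _ = _) (hb : _ = _)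
    change _ = _
    rw [mat_mul, transpose_mul, Matrix.mul_assoc, ← Matrix.mul_assoc (mat a)ᵀ, ha, Matrix.one_mul,
      hb]
  one_mem' := by change _ = _; simp
  inv_mem' := by
    intro a (ha : _ = _)
    change _ = _
    rw [mat_inv, Matrix.inv_eq_left_inv ha, transpose_transpose]
    exact mul_eq_one_comm.mp ha

/-- The matrix entries of `g`, as a point of the Euclidean space of `3 × 3` matrices. -/
def entries (g : G) : Fin 3 → Fin 3 → ℝ := fun i j => mat g i j

/-- Smooth functions on the embedded submanifold `SL(3, ℝ)` of the space of matrices: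
locally the restriction of a smooth function on an open set of matrices. -/
def IsSmooth (f : G → ℂ) : Prop :=
  ∀ g : G, ∃ U : Set (Fin 3 → Fin 3 → ℝ), IsOpen U ∧ entries g ∈ U ∧
    ∃ F : (Fin 3 → Fin 3 → ℝ) → ℂ, ContDiffOn ℝ ∞ F U ∧
      ∀ h : G, entries h ∈ U → f h = F (entries h)

/-- The right regular action of `G` on functions on `G`. -/
def rightReg : Representation ℂ G (G → ℂ) where
  toFun g :=
    { toFun := fun f x => f (x * g)
      map_add' := fun _ _ => rfl
      map_smul' := fun _ _ => rfl }
  map_one' := by ext f x; simp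
  map_mul' g h := by ext f x; simp [mul_assoc]

theorem rightReg_apply (g : G) (f : G → ℂ) (x : G) : rightReg g f x = f (x * g) := rfl

/-! ### The one-parameter groups and the differential of the right regular action -/

section exp
open scoped Matrix.Norms.Operator

theorem hasDerivAt_exp_apply (X : Matrix (Fin 3) (Fin 3) ℝ) (t : ℝ) (i j : Fin 3) :
    HasDerivAt (fun u : ℝ => NormedSpace.exp (u • X) i j)
      ((NormedSpace.exp (t • X) * X) i j) t := by
  have h := hasDerivAt_exp_smul_const (𝕂 := ℝ) X t
  have h2 : HasFDerivAt (fun M : Matrix (Fin 3) (Fin 3) ℝ => M i j)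
      (LinearMap.toContinuousLinearMap (Matrix.entryLinearMap ℝ ℝ i j)) (NormedSpace.exp (t • X)) :=
    (LinearMap.toContinuousLinearMap (Matrix.entryLinearMap ℝ ℝ i j)).hasFDerivAt
  exact h2.comp_hasDerivAt t h

end exp

theorem det_exp_eq_one (X : Matrix (Fin 3) (Fin 3) ℝ) (hX : X.trace = 0) :
    (NormedSpace.exp X).det = 1 := by
  have key : ∀ t : ℝ, HasDerivAt (fun u : ℝ => (NormedSpace.exp (u • X)).det) 0 t := by
    intro t
    have h := hasDerivAt_exp_apply X t
    simp only [Matrix.det_fin_three]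
    have := ((((((h 0 0).mul (h 1 1)).mul (h 2 2)).sub (((h 0 0).mul (h 1 2)).mul (h 2 1))).sub
      (((h 0 1).mul (h 1 0)).mul (h 2 2))).add (((h 0 1).mul (h 1 2)).mul (h 2 0))).add
      (((h 0 2).mul (h 1 0)).mul (h 2 1)) |>.sub (((h 0 2).mul (h 1 1)).mul (h 2 0))
    refine this.congr_deriv ?_
    have hX' : X 2 2 = - X 0 0 - X 1 1 := by
      have := hX; simp only [Matrix.trace, Matrix.diag, Fin.sum_univ_three] at this; linarith
    simp only [Matrix.mul_apply, Fin.sum_univ_three, hX', Pi.mul_apply]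
    ring
  have hc := is_const_of_deriv_eq_zero (f := fun u : ℝ => (NormedSpace.exp (u • X)).det)
    (fun t => (key t).differentiableAt) (fun t => (key t).deriv) 1 0
  simpa using hc

/-- The exponential map `𝔰𝔩(3, ℝ) → SL(3, ℝ)`. -/
noncomputable def expSL (X : LieAlgebra.SpecialLinear.sl (Fin 3) ℝ) : G :=
  mkG (NormedSpace.exp (X : Matrix (Fin 3) (Fin 3) ℝ)) (det_exp_eq_one _ X.2)

/-- The differential of the right regular action in the direction `X ∈ 𝔤`. -/
noncomputable def lieDeriv (X : LieAlgebra.SpecialLinear.sl (Fin 3) ℝ) (f : G → ℂ) : G → ℂ :=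
  fun g => deriv (fun t : ℝ => f (g * expSL (t • X))) 0

/-- The tangent vector `g X` at `g`. -/
def tang (X : Matrix (Fin 3) (Fin 3) ℝ) (y : Fin 3 → Fin 3 → ℝ) : Fin 3 → Fin 3 → ℝ :=
  fun i j => ∑ k, y i k * X k j

theorem hasDerivAt_entries (X : LieAlgebra.SpecialLinear.sl (Fin 3) ℝ) (g : G) :
    HasDerivAt (fun t : ℝ => entries (g * expSL (t • X))) (tang X (entries g)) 0 := by
  rw [hasDerivAt_pi]; intro i
  rw [hasDerivAt_pi]; intro j
  have h := fun k => (hasDerivAt_exp_apply X.1 0 k j).const_mul (mat g i k)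
  have := HasDerivAt.fun_sum (u := Finset.univ) (fun k _ => h k)
  simp only [zero_smul, NormedSpace.exp_zero, Matrix.one_mul] at this
  refine this.congr_of_eventuallyEq (Filter.Eventually.of_forall fun t => ?_)
  simp [entries, expSL, Matrix.mul_apply]

theorem hasDerivAt_of_local {f : G → ℂ} {U : Set (Fin 3 → Fin 3 → ℝ)} (hU : IsOpen U)
    {F : (Fin 3 → Fin 3 → ℝ) → ℂ} (hF : ContDiffOn ℝ ∞ F U)
    (hf : ∀ h : G, entries h ∈ U → f h = F (entries h))
    (X : LieAlgebra.SpecialLinear.sl (Fin 3) ℝ) (g : G) (hg : entries g ∈ U) :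
    HasDerivAt (fun t : ℝ => f (g * expSL (t • X)))
      (fderiv ℝ F (entries g) (tang X (entries g))) 0 := by
  have hc := hasDerivAt_entries X g
  have h0 : entries (g * expSL ((0 : ℝ) • X)) = entries g := by
    ext i j; simp [entries, expSL]
  have hd : HasFDerivAt F (fderiv ℝ F (entries g)) (entries (g * expSL ((0 : ℝ) • X))) := by
    rw [h0]
    exact ((hF.contDiffAt (hU.mem_nhds hg)).differentiableAt (by simp)).hasFDerivAt
  have h1 := hd.comp_hasDerivAt (0 : ℝ) hc
  refine h1.congr_of_eventuallyEq ?_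
  have hm : entries (g * expSL ((0 : ℝ) • X)) ∈ U := by rw [h0]; exact hg
  have := hc.continuousAt.eventually (hU.mem_nhds hm)
  filter_upwards [this] with t ht
  exact hf _ ht

theorem IsSmooth.hasDerivAt {f : G → ℂ} (hf : IsSmooth f)
    (X : LieAlgebra.SpecialLinear.sl (Fin 3) ℝ) (g : G) :
    HasDerivAt (fun t : ℝ => f (g * expSL (t • X))) (lieDeriv X f g) 0 := by
  obtain ⟨U, hU, hg, F, hF, h⟩ := hf g
  exact (hasDerivAt_of_local hU hF h X g hg).differentiableAt.hasDerivAt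

theorem tang_contDiff (X : Matrix (Fin 3) (Fin 3) ℝ) : ContDiff ℝ ∞ (tang X) := by
  unfold tang
  fun_prop

theorem IsSmooth.lieDeriv {f : G → ℂ} (hf : IsSmooth f)
    (X : LieAlgebra.SpecialLinear.sl (Fin 3) ℝ) : IsSmooth (lieDeriv X f) := by
  intro g
  obtain ⟨U, hU, hg, F, hF, h⟩ := hf g
  refine ⟨U, hU, hg, fun y => fderiv ℝ F y (tang X y), ?_, fun k hk =>
    (hasDerivAt_of_local hU hF h X k hk).deriv⟩
  exact (hF.fderiv_of_isOpen hU (m := ∞) (by simp)).clm_apply (tang_contDiff _).contDiffOn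

theorem lieDeriv_add (X Y : LieAlgebra.SpecialLinear.sl (Fin 3) ℝ) {f : G → ℂ} (hf : IsSmooth f) :
    lieDeriv (X + Y) f = lieDeriv X f + lieDeriv Y f := by
  ext g
  obtain ⟨U, hU, hg, F, hF, h⟩ := hf g
  have e := fun Z => (hasDerivAt_of_local hU hF h Z g hg).deriv
  have e2 : tang (X + Y : LieAlgebra.SpecialLinear.sl (Fin 3) ℝ).1 (entries g)
      = tang X.1 (entries g) + tang Y.1 (entries g) := by
    ext i j; simp [tang, mul_add, Finset.sum_add_distrib]
  simp only [lieDeriv, Pi.add_apply]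
  rw [e, e, e, e2, map_add]

theorem lieDeriv_smul (c : ℝ) (X : LieAlgebra.SpecialLinear.sl (Fin 3) ℝ) {f : G → ℂ}
    (hf : IsSmooth f) : lieDeriv (c • X) f = (c : ℂ) • lieDeriv X f := by
  ext g
  obtain ⟨U, hU, hg, F, hF, h⟩ := hf g
  have e := fun Z => (hasDerivAt_of_local hU hF h Z g hg).deriv
  have e2 : tang (c • X : LieAlgebra.SpecialLinear.sl (Fin 3) ℝ).1 (entries g)
      = c • tang X.1 (entries g) := by
    ext i j; simp [tang, mul_left_comm, Finset.mul_sum]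
  simp only [lieDeriv, Pi.smul_apply]
  rw [e, e, e2, map_smul]
  simp

theorem lieDeriv_add_fun (X : LieAlgebra.SpecialLinear.sl (Fin 3) ℝ) {f₁ f₂ : G → ℂ}
    (h₁ : IsSmooth f₁) (h₂ : IsSmooth f₂) :
    lieDeriv X (f₁ + f₂) = lieDeriv X f₁ + lieDeriv X f₂ := by
  ext g
  exact ((h₁.hasDerivAt X g).add (h₂.hasDerivAt X g)).deriv

theorem lieDeriv_smul_fun (X : LieAlgebra.SpecialLinear.sl (Fin 3) ℝ) (c : ℂ) {f : G → ℂ}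
    (hf : IsSmooth f) : lieDeriv X (c • f) = c • lieDeriv X f := by
  ext g
  exact ((hf.hasDerivAt X g).const_mul c).deriv

theorem IsSmooth.add {f₁ f₂ : G → ℂ} (h₁ : IsSmooth f₁) (h₂ : IsSmooth f₂) :
    IsSmooth (f₁ + f₂) := by
  intro g
  obtain ⟨U, hU, hg, F, hF, h⟩ := h₁ g
  obtain ⟨U', hU', hg', F', hF', h'⟩ := h₂ g
  refine ⟨U ∩ U', hU.inter hU', ⟨hg, hg'⟩, F + F',
    (hF.mono Set.inter_subset_left).add (hF'.mono Set.inter_subset_right), fun k hk => ?_⟩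
  simp [h k hk.1, h' k hk.2]

theorem IsSmooth.smul (c : ℂ) {f : G → ℂ} (hf : IsSmooth f) : IsSmooth (c • f) := by
  intro g
  obtain ⟨U, hU, hg, F, hF, h⟩ := hf g
  refine ⟨U, hU, hg, c • F, contDiffOn_const.smul hF, fun k hk => ?_⟩
  simp [h k hk]

theorem isSmooth_zero : IsSmooth 0 := fun _ =>
  ⟨Set.univ, isOpen_univ, trivial, 0, contDiffOn_const, fun _ _ => rfl⟩

theorem IsSmooth.rightReg (g : G) {f : G → ℂ} (hf : IsSmooth f) : IsSmooth (rightReg g f) := by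
  intro x
  obtain ⟨U, hU, hx, F, hF, h⟩ := hf (x * g)
  have e : ∀ y : G, tang (mat g) (entries y) = entries (y * g) := by
    intro y; ext i j; simp [tang, entries, Matrix.mul_apply]
  refine ⟨tang (mat g) ⁻¹' U, hU.preimage (tang_contDiff _).continuous, ?_, F ∘ tang (mat g),
    hF.comp (tang_contDiff _).contDiffOn (fun _ hy => hy), fun y hy => ?_⟩
  · rw [Set.mem_preimage, e]; exact hx
  · rw [Set.mem_preimage, e] at hy
    rw [Function.comp_apply, e, ← h _ hy]; rfl

/-- `Ad(g) X = g X g⁻¹`. -/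
noncomputable def Ad (g : G) (X : LieAlgebra.SpecialLinear.sl (Fin 3) ℝ) :
    LieAlgebra.SpecialLinear.sl (Fin 3) ℝ :=
  ⟨mat g * X.1 * mat g⁻¹, by
    have hX : X.1.trace = 0 := X.2
    have : (mat g * X.1 * mat g⁻¹).trace = 0 := by
      rw [Matrix.trace_mul_comm, ← Matrix.mul_assoc, ← mat_mul]
      simpa using hX
    exact this⟩

theorem expSL_Ad (g : G) (X : LieAlgebra.SpecialLinear.sl (Fin 3) ℝ) :
    expSL (Ad g X) = g * expSL X * g⁻¹ := by
  apply mat_ext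
  have hg : IsUnit (mat g) := (Matrix.isUnit_iff_isUnit_det _).mpr (by simp)
  have := Matrix.exp_conj (mat g) X.1 hg
  rw [← mat_inv] at this
  exact this

theorem rightReg_lieDeriv (g : G) (X : LieAlgebra.SpecialLinear.sl (Fin 3) ℝ) (f : G → ℂ) :
    rightReg g (lieDeriv X f) = lieDeriv (Ad g X) (rightReg g f) := by
  ext x
  simp only [rightReg_apply, lieDeriv]
  congr 1
  ext t
  have : t • Ad g X = Ad g (t • X) := by
    apply Subtype.ext; simp [Ad]
  rw [this, expSL_Ad]
  congr 1
  group

/-! ### The principal series -/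

/-- The Lie algebra `𝔞₀`: the diagonal matrices `diag(t₁, t₂, t₃)` of trace zero. -/
def a0 : Submodule ℝ (Fin 3 → ℝ) where
  carrier := {t | t 0 + t 1 + t 2 = 0}
  add_mem' := by
    intro s t (hs : _ = _) (ht : _ = _)
    change _ = _
    simp only [Pi.add_apply]; linarith
  zero_mem' := by change _ = _; simp
  smul_mem' := by
    intro c t (ht : _ = _)
    change _ = _
    simp only [Pi.smul_apply, smul_eq_mul, ← mul_add, ht, mul_zero]

/-- `H₁ = diag(1, 0, -1)`. -/
def H₁ : a0 := ⟨![1, 0, -1], show _ = _ by simp⟩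

/-- `H₂ = diag(0, 1, -1)`. -/
def H₂ : a0 := ⟨![0, 1, -1], show _ = _ by simp⟩

/-- The linear form `e_i` on `𝔞₀`. -/
noncomputable def eForm (i : Fin 3) : a0 →ₗ[ℝ] ℂ where
  toFun t := (t.1 i : ℂ)
  map_add' _ _ := by simp
  map_smul' _ _ := by simp

/-- The half sum `ρ₀` of the positive roots `e₁ - e₂`, `e₁ - e₃`, `e₂ - e₃`. -/
noncomputable def rho0 : a0 →ₗ[ℝ] ℂ :=
  (1 / 2 : ℝ) • ((eForm 0 - eForm 1) + (eForm 0 - eForm 2) + (eForm 1 - eForm 2))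

/-- The element `exp(t)` of `A₀`, for `t ∈ 𝔞₀`. -/
noncomputable def aElt (t : a0) : G :=
  mkG (Matrix.diagonal fun i => Real.exp (t.1 i)) (by
    have ht : t.1 0 + t.1 1 + t.1 2 = 0 := t.2
    rw [Matrix.det_diagonal, Fin.prod_univ_three, ← Real.exp_add, ← Real.exp_add, ht,
      Real.exp_zero])

/-- The elements of `N₀`: the upper triangular unipotent matrices. -/
def nElt (x y z : ℝ) : G :=
  mkG !![1, x, y; 0, 1, z; 0, 0, 1] (by simp [Matrix.det_fin_three])

/-- The elements `diag(ε₁, ε₂, ε₁ ε₂)` of `M₀`. -/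
def mElt (ε₁ ε₂ : ℤˣ) : G :=
  mkG (Matrix.diagonal ![((ε₁ : ℤ) : ℝ), ((ε₂ : ℤ) : ℝ), ((ε₁ : ℤ) : ℝ) * ((ε₂ : ℤ) : ℝ)]) (by
    rcases Int.units_eq_one_or ε₁ with rfl | rfl <;> rcases Int.units_eq_one_or ε₂ with rfl | rfl <;>
      simp [Matrix.det_diagonal, Fin.prod_univ_three])

/-- The value at `diag(ε₁, ε₂, ε₁ ε₂)` of the character `σ₀` of `M₀` with parameters
`(σ₀₁, σ₀₂) ∈ {0, 1}²`. -/
def charM (σ : Fin 2 × Fin 2) (ε₁ ε₂ : ℤˣ) : ℂ :=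
  ((ε₁ : ℤ) : ℂ) ^ (σ.1 : ℕ) * ((ε₂ : ℤ) : ℂ) ^ (σ.2 : ℕ)

/-- The smooth functions `f` on `G` with `f(n a m x) = e^{ν₀ + ρ₀}(a) σ₀(m) f(x)`. -/
def Hinf (ν : a0 →ₗ[ℝ] ℂ) (σ : Fin 2 × Fin 2) : Submodule ℂ (G → ℂ) where
  carrier := {f | IsSmooth f ∧ ∀ (u v w : ℝ) (t : a0) (ε₁ ε₂ : ℤˣ) (x : G),
    f (nElt u v w * aElt t * mElt ε₁ ε₂ * x) =
      Complex.exp ((ν + rho0) t) * charM σ ε₁ ε₂ * f x}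
  add_mem' := by
    rintro f g ⟨hf, hf'⟩ ⟨hg, hg'⟩
    refine ⟨hf.add hg, fun u v w t ε₁ ε₂ x => ?_⟩
    simp only [Pi.add_apply, hf', hg', mul_add]
  zero_mem' := ⟨isSmooth_zero, by simp⟩
  smul_mem' := by
    rintro c f ⟨hf, hf'⟩
    refine ⟨hf.smul c, fun u v w t ε₁ ε₂ x => ?_⟩
    simp only [Pi.smul_apply, hf', smul_eq_mul]; ring

/-- The span of the right `K`-translates of `f`. -/
def orbitSpan (f : G → ℂ) : Submodule ℂ (G → ℂ) :=
  Submodule.span ℂ (Set.range fun k : K => rightReg (k : G) f)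

/-- The space `H_{(ν₀, σ₀), K}` of `K`-finite vectors of the principal series. -/
def HK (ν : a0 →ₗ[ℝ] ℂ) (σ : Fin 2 × Fin 2) : Submodule ℂ (G → ℂ) where
  carrier := {f | f ∈ Hinf ν σ ∧ FiniteDimensional ℂ (orbitSpan f)}
  add_mem' := by
    rintro f g ⟨hf, hf'⟩ ⟨hg, hg'⟩
    refine ⟨add_mem hf hg, Submodule.finiteDimensional_of_le (S₂ := orbitSpan f ⊔ orbitSpan g) ?_⟩
    refine Submodule.span_le.mpr ?_
    rintro _ ⟨k, rfl⟩
    simp only [map_add]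
    exact Submodule.add_mem_sup (Submodule.subset_span ⟨k, rfl⟩) (Submodule.subset_span ⟨k, rfl⟩)
  zero_mem' := by
    refine ⟨zero_mem _, Submodule.finiteDimensional_of_le (S₂ := ⊥) ?_⟩
    refine Submodule.span_le.mpr ?_
    rintro _ ⟨k, rfl⟩
    simp
  smul_mem' := by
    rintro c f ⟨hf, hf'⟩
    refine ⟨Submodule.smul_mem _ c hf, Submodule.finiteDimensional_of_le (S₂ := orbitSpan f) ?_⟩
    refine Submodule.span_le.mpr ?_
    rintro _ ⟨k, rfl⟩
    simp only [map_smul]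
    exact Submodule.smul_mem _ c (Submodule.subset_span ⟨k, rfl⟩)

theorem orbitSpan_smooth {f : G → ℂ} (hf : IsSmooth f) {w : G → ℂ} (hw : w ∈ orbitSpan f) :
    IsSmooth w := by
  refine Submodule.span_induction (p := fun w _ => IsSmooth w) ?_ isSmooth_zero
    (fun _ _ _ _ h h' => h.add h') (fun c _ _ h => h.smul c) hw
  rintro _ ⟨k, rfl⟩
  exact hf.rightReg k

theorem rightReg_mem_HK {ν : a0 →ₗ[ℝ] ℂ} {σ : Fin 2 × Fin 2} (k : K) {f : G → ℂ}
    (hf : f ∈ HK ν σ) : rightReg (k : G) f ∈ HK ν σ := by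
  obtain ⟨⟨h1, h2⟩, h3⟩ := hf
  refine ⟨⟨h1.rightReg k, fun u v w t ε₁ ε₂ x => ?_⟩,
    Submodule.finiteDimensional_of_le (S₂ := orbitSpan f) ?_⟩
  · simp only [rightReg_apply, mul_assoc] at *
    exact h2 ..
  · refine Submodule.span_le.mpr ?_
    rintro _ ⟨k', rfl⟩
    refine Submodule.subset_span ⟨k' * k, ?_⟩
    simp [map_mul]

theorem lieDeriv_mem_HK {ν : a0 →ₗ[ℝ] ℂ} {σ : Fin 2 × Fin 2}
    (X : LieAlgebra.SpecialLinear.sl (Fin 3) ℝ) {f : G → ℂ}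
    (hf : f ∈ HK ν σ) : lieDeriv X f ∈ HK ν σ := by
  obtain ⟨⟨h1, h2⟩, h3⟩ := hf
  refine ⟨⟨h1.lieDeriv X, fun u v w t ε₁ ε₂ x => ?_⟩, ?_⟩
  · have e := (h1.hasDerivAt X x).const_mul (Complex.exp ((ν + rho0) t) * charM σ ε₁ ε₂)
    rw [← e.deriv]
    simp only [lieDeriv]
    congr 1
    ext s
    rw [← h2, mul_assoc]
  · let b := Module.finBasis ℝ (LieAlgebra.SpecialLinear.sl (Fin 3) ℝ)
    let T : Fin (Module.finrank ℝ (LieAlgebra.SpecialLinear.sl (Fin 3) ℝ)) →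
        orbitSpan f →ₗ[ℂ] (G → ℂ) := fun i =>
      { toFun := fun w => lieDeriv (b i) w.1
        map_add' := fun w w' => lieDeriv_add_fun _ (orbitSpan_smooth h1 w.2)
          (orbitSpan_smooth h1 w'.2)
        map_smul' := fun c w => lieDeriv_smul_fun _ c (orbitSpan_smooth h1 w.2) }
    refine Submodule.finiteDimensional_of_le (S₂ := ⨆ i, LinearMap.range (T i)) ?_
    refine Submodule.span_le.mpr ?_
    rintro _ ⟨k, rfl⟩
    simp only [rightReg_lieDeriv]
    have hw : rightReg (k : G) f ∈ orbitSpan f := Submodule.subset_span ⟨k, rfl⟩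
    have hs := orbitSpan_smooth h1 hw
    have hY : Ad (k : G) X ∈ Submodule.span ℝ (Set.range b) := by rw [b.span_eq]; trivial
    refine Submodule.span_induction
      (p := fun Y _ => lieDeriv Y (rightReg (k : G) f) ∈ ⨆ i, LinearMap.range (T i))
      ?_ ?_ ?_ ?_ hY
    · rintro _ ⟨i, rfl⟩
      exact Submodule.mem_iSup_of_mem i ⟨⟨_, hw⟩, rfl⟩
    · have := lieDeriv_smul 0 0 hs
      simp only [smul_zero, Complex.ofReal_zero, zero_smul] at this
      rw [this]; exact zero_mem _
    · intro Y Y' _ _ h h'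
      rw [lieDeriv_add _ _ hs]; exact add_mem h h'
    · intro c Y _ h
      rw [lieDeriv_smul _ _ hs]; exact Submodule.smul_mem _ _ h

/-- The action of `K` on `H_{(ν₀, σ₀), K}` by right translation. -/
def piK (ν : a0 →ₗ[ℝ] ℂ) (σ : Fin 2 × Fin 2) : Representation ℂ K (HK ν σ) where
  toFun k := (rightReg (k : G)).restrict fun _ hf => rightReg_mem_HK k hf
  map_one' := by ext f x; simp
  map_mul' k k' := by ext f x; simp [rightReg_apply, mul_assoc]

/-- The real part of `Z ∈ 𝔤_ℂ = 𝔰𝔩(3, ℂ)`. -/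
def reSL (Z : LieAlgebra.SpecialLinear.sl (Fin 3) ℂ) : LieAlgebra.SpecialLinear.sl (Fin 3) ℝ :=
  ⟨Z.1.map Complex.re, by
    have h : Z.1.trace = 0 := Z.2
    have : (Z.1.map Complex.re).trace = 0 := by
      simpa [Matrix.trace, Fin.sum_univ_three] using congrArg Complex.re h
    exact this⟩

/-- The imaginary part of `Z ∈ 𝔤_ℂ = 𝔰𝔩(3, ℂ)`. -/
def imSL (Z : LieAlgebra.SpecialLinear.sl (Fin 3) ℂ) : LieAlgebra.SpecialLinear.sl (Fin 3) ℝ :=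
  ⟨Z.1.map Complex.im, by
    have h : Z.1.trace = 0 := Z.2
    have : (Z.1.map Complex.im).trace = 0 := by
      simpa [Matrix.trace, Fin.sum_univ_three] using congrArg Complex.im h
    exact this⟩

/-- The differential of the principal series on `K`-finite vectors, extended complex linearly
to `𝔤_ℂ`: `π(X + √-1 Y) = π(X) + √-1 π(Y)` for `X, Y ∈ 𝔤`. -/
noncomputable def piLie (ν : a0 →ₗ[ℝ] ℂ) (σ : Fin 2 × Fin 2) :
    LieAlgebra.SpecialLinear.sl (Fin 3) ℂ →ₗ[ℂ] HK ν σ →ₗ[ℂ] HK ν σ :=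
  LinearMap.mk₂ ℂ
    (fun Z f => ⟨lieDeriv (reSL Z) f.1 + Complex.I • lieDeriv (imSL Z) f.1,
      add_mem (lieDeriv_mem_HK _ f.2) (Submodule.smul_mem _ _ (lieDeriv_mem_HK _ f.2))⟩)
    (by
      intro Z Z' f
      apply Subtype.ext
      have e1 : reSL (Z + Z') = reSL Z + reSL Z' := by apply Subtype.ext; ext; simp [reSL]
      have e2 : imSL (Z + Z') = imSL Z + imSL Z' := by apply Subtype.ext; ext; simp [imSL]
      simp only [Submodule.coe_add, e1, e2, lieDeriv_add _ _ f.2.1.1, smul_add]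
      abel)
    (by
      intro c Z f
      apply Subtype.ext
      have e1 : reSL (c • Z) = c.re • reSL Z + (-c.im) • imSL Z := by
        apply Subtype.ext; ext; simp [reSL, imSL]; ring
      have e2 : imSL (c • Z) = c.re • imSL Z + c.im • reSL Z := by
        apply Subtype.ext; ext; simp [reSL, imSL]
      simp only [Submodule.coe_smul, e1, e2, lieDeriv_add _ _ f.2.1.1, lieDeriv_smul _ _ f.2.1.1]
      ext x
      simp only [Pi.add_apply, Pi.smul_apply, smul_eq_mul, Complex.ofReal_neg]
      have hc : c = c.re + c.im * Complex.I := (Complex.re_add_im c).symm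
      have hI := Complex.I_mul_I
      generalize lieDeriv (reSL Z) f.1 x = A
      generalize lieDeriv (imSL Z) f.1 x = B
      conv_rhs => rw [hc]
      linear_combination (-c.im * B) * hI)
    (by
      intro Z f f'
      apply Subtype.ext
      simp only [Submodule.coe_add, lieDeriv_add_fun _ f.2.1.1 f'.2.1.1, smul_add]
      abel)
    (by
      intro c Z f
      apply Subtype.ext
      simp only [Submodule.coe_smul, lieDeriv_smul_fun _ c f.2.1.1, smul_add]
      rw [smul_comm])

/-! ### The spinor covering -/

/-- The group `SU(2)`. -/
abbrev SU2 : Type := Matrix.specialUnitaryGroup (Fin 2) ℂ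

theorem SU2_entries (x : SU2) : x.1 1 0 = -star (x.1 0 1) ∧ x.1 1 1 = star (x.1 0 0) := by
  have h1 : star x.1 * x.1 = 1 := x.2.1.1
  have h2 : x.1.det = 1 := x.2.2
  have h3 : star x.1 = x.1.adjugate := by
    calc star x.1 = star x.1 * (x.1 * x.1.adjugate) := by
          rw [Matrix.mul_adjugate, h2, one_smul, Matrix.mul_one]
      _ = x.1.adjugate := by rw [← Matrix.mul_assoc, h1, Matrix.one_mul]
  rw [Matrix.adjugate_fin_two] at h3
  constructor
  · have := congrFun (congrFun h3 1) 0
    simp [Matrix.star_apply] at this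
    simp [this]
  · have := congrFun (congrFun h3 0) 0
    simpa [Matrix.star_apply] using this.symm

theorem SU2_norm (x : SU2) :
    (x.1 0 0).re ^ 2 + (x.1 0 0).im ^ 2 + (x.1 0 1).re ^ 2 + (x.1 0 1).im ^ 2 = 1 := by
  have h2 : x.1.det = 1 := x.2.2
  rw [Matrix.det_fin_two, (SU2_entries x).1, (SU2_entries x).2] at h2
  have := congrArg Complex.re h2
  simp at this
  linarith

/-- The matrix `φ(x)` for `x` with first row `(p + √-1 q, r + √-1 s)`. -/
def phiMat (p q r s : ℝ) : Matrix (Fin 3) (Fin 3) ℝ :=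
  !![p ^ 2 + q ^ 2 - r ^ 2 - s ^ 2, -2 * (p * s - q * r), 2 * (p * r + q * s);
     2 * (p * s + q * r), p ^ 2 - q ^ 2 + r ^ 2 - s ^ 2, -2 * (p * q - r * s);
     -2 * (p * r - q * s), 2 * (p * q + r * s), p ^ 2 - q ^ 2 - r ^ 2 + s ^ 2]

theorem phiMat_det (p q r s : ℝ) (h : p ^ 2 + q ^ 2 + r ^ 2 + s ^ 2 = 1) :
    (phiMat p q r s).det = 1 := by
  have : (phiMat p q r s).det = (p ^ 2 + q ^ 2 + r ^ 2 + s ^ 2) ^ 3 := by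
    simp [phiMat, Matrix.det_fin_three]; ring
  rw [this, h, one_pow]

theorem phiMat_orth (p q r s : ℝ) (h : p ^ 2 + q ^ 2 + r ^ 2 + s ^ 2 = 1) :
    (phiMat p q r s)ᵀ * phiMat p q r s = 1 := by
  have : (phiMat p q r s)ᵀ * phiMat p q r s = (p ^ 2 + q ^ 2 + r ^ 2 + s ^ 2) ^ 2 • 1 := by
    ext i j
    fin_cases i <;> fin_cases j <;>
      simp [phiMat, Matrix.mul_apply, Fin.sum_univ_three] <;> ring
  rw [this, h, one_pow, one_smul]

/-- The covering `φ : SU(2) → SO(3)`. -/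
noncomputable def spinCover : SU2 →* K where
  toFun x := ⟨mkG (phiMat (x.1 0 0).re (x.1 0 0).im (x.1 0 1).re (x.1 0 1).im)
    (phiMat_det _ _ _ _ (SU2_norm x)), phiMat_orth _ _ _ _ (SU2_norm x)⟩
  map_one' := by
    apply Subtype.ext; apply mat_ext
    ext i j
    fin_cases i <;> fin_cases j <;> simp [phiMat]
  map_mul' x y := by
    apply Subtype.ext; apply mat_ext
    have hy := SU2_entries y
    have e0 : (x * y).1 0 0 = x.1 0 0 * y.1 0 0 - x.1 0 1 * star (y.1 0 1) := by
      simp [Matrix.mul_apply, Fin.sum_univ_two, hy.1, sub_eq_add_neg]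
    have e1 : (x * y).1 0 1 = x.1 0 0 * y.1 0 1 + x.1 0 1 * star (y.1 0 0) := by
      simp [Matrix.mul_apply, Fin.sum_univ_two, hy.2]
    simp only [e0, e1, Subgroup.coe_mul, mat_mul, mat_mkG]
    ext i j
    fin_cases i <;> fin_cases j <;>
      simp [phiMat, Matrix.mul_apply, Fin.sum_univ_three] <;> ring

theorem mat_spinCover (x : SU2) : mat (spinCover x : G) =
    phiMat (x.1 0 0).re (x.1 0 0).im (x.1 0 1).re (x.1 0 1).im := rfl

theorem exists_SU2 (p q r s : ℝ) (h : p ^ 2 + q ^ 2 + r ^ 2 + s ^ 2 = 1) :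
    ∃ x : SU2, mat (spinCover x : G) = phiMat p q r s := by
  have hm : !![(⟨p, q⟩ : ℂ), ⟨r, s⟩; ⟨-r, s⟩, ⟨p, -q⟩] ∈ Matrix.specialUnitaryGroup (Fin 2) ℂ := by
    rw [Matrix.mem_specialUnitaryGroup_iff, Matrix.mem_unitaryGroup_iff]
    constructor
    · ext i j
      fin_cases i <;> fin_cases j <;>
        simp [Matrix.mul_apply, Fin.sum_univ_two, Matrix.star_apply, Complex.ext_iff] <;>
        (try constructor) <;> linarith
    · rw [Matrix.det_fin_two]
      simp [Complex.ext_iff]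
      constructor <;> linarith
  exact ⟨⟨_, hm⟩, rfl⟩

theorem half_angle (c s : ℝ) (h : c ^ 2 + s ^ 2 = 1) :
    ∃ p q : ℝ, p ^ 2 + q ^ 2 = 1 ∧ p ^ 2 - q ^ 2 = c ∧ 2 * p * q = s := by
  obtain ⟨w, hw⟩ := IsAlgClosed.exists_pow_nat_eq (⟨c, s⟩ : ℂ) (n := 2) (by norm_num)
  have hr := congrArg Complex.re hw
  have hi := congrArg Complex.im hw
  simp [pow_two] at hr hi
  refine ⟨w.re, w.im, ?_, by linarith, by linarith⟩
  have : (w.re ^ 2 + w.im ^ 2) ^ 2 = 1 := by rw [← h, ← hr, ← hi]; ring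
  nlinarith [sq_nonneg w.re, sq_nonneg w.im]

theorem rot1_mem (g : K) (c s : ℝ) (h : c ^ 2 + s ^ 2 = 1)
    (hg : mat (g : G) = !![1, 0, 0; 0, c, -s; 0, s, c]) : g ∈ spinCover.range := by
  obtain ⟨p, q, h1, h2, h3⟩ := half_angle c s h
  obtain ⟨x, hx⟩ := exists_SU2 p q 0 0 (by linarith)
  refine ⟨x, ?_⟩
  apply Subtype.ext; apply mat_ext
  rw [hx, hg, ← h2, ← h3]
  ext i j
  fin_cases i <;> fin_cases j <;> simp [phiMat] <;> first | exact h1 | ring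

theorem rot3_mem (g : K) (c s : ℝ) (h : c ^ 2 + s ^ 2 = 1)
    (hg : mat (g : G) = !![c, -s, 0; s, c, 0; 0, 0, 1]) : g ∈ spinCover.range := by
  obtain ⟨p, q, h1, h2, h3⟩ := half_angle c s h
  obtain ⟨x, hx⟩ := exists_SU2 p 0 0 q (by linarith)
  refine ⟨x, ?_⟩
  apply Subtype.ext; apply mat_ext
  rw [hx, hg, ← h2, ← h3]
  ext i j
  fin_cases i <;> fin_cases j <;> simp [phiMat] <;> first | exact h1 | ring

theorem exists_rot1 (c s : ℝ) (h : c ^ 2 + s ^ 2 = 1) :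
    ∃ g : K, mat (g : G) = !![1, 0, 0; 0, c, -s; 0, s, c] := by
  refine ⟨⟨mkG !![1, 0, 0; 0, c, -s; 0, s, c] ?_, ?_⟩, rfl⟩
  · simp [Matrix.det_fin_three]; linarith
  · change _ = _
    ext i j
    fin_cases i <;> fin_cases j <;> simp [Matrix.mul_apply, Fin.sum_univ_three] <;> linarith

theorem exists_rot3 (c s : ℝ) (h : c ^ 2 + s ^ 2 = 1) :
    ∃ g : K, mat (g : G) = !![c, -s, 0; s, c, 0; 0, 0, 1] := by
  refine ⟨⟨mkG !![c, -s, 0; s, c, 0; 0, 0, 1] ?_, ?_⟩, rfl⟩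
  · simp [Matrix.det_fin_three]; linarith
  · change _ = _
    ext i j
    fin_cases i <;> fin_cases j <;> simp [Matrix.mul_apply, Fin.sum_univ_three] <;> linarith

theorem K_orth (g : K) (i j : Fin 3) :
    mat (g : G) 0 i * mat (g : G) 0 j + mat (g : G) 1 i * mat (g : G) 1 j
      + mat (g : G) 2 i * mat (g : G) 2 j = if i = j then 1 else 0 := by
  have h : (mat (g : G))ᵀ * mat (g : G) = 1 := g.2
  have := congrFun (congrFun h i) j
  simpa [Matrix.mul_apply, Fin.sum_univ_three, Matrix.one_apply] using this

theorem spinCover_surjective : Function.Surjective spinCover := by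
  rw [← MonoidHom.range_eq_top, eq_top_iff]
  rintro g -
  have h00 := K_orth g 0 0
  rw [if_pos rfl] at h00
  obtain ⟨c, s, hcs, hz⟩ : ∃ c s : ℝ, c ^ 2 + s ^ 2 = 1 ∧
      s * mat (g : G) 1 0 + c * mat (g : G) 2 0 = 0 := by
    by_cases hb : mat (g : G) 1 0 ^ 2 + mat (g : G) 2 0 ^ 2 = 0
    · refine ⟨1, 0, by norm_num, ?_⟩
      nlinarith [sq_nonneg (mat (g : G) 1 0), sq_nonneg (mat (g : G) 2 0)]
    · have hpos : 0 ≤ mat (g : G) 1 0 ^ 2 + mat (g : G) 2 0 ^ 2 := by positivity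
      have hs := Real.sq_sqrt hpos
      have hne : √(mat (g : G) 1 0 ^ 2 + mat (g : G) 2 0 ^ 2) ≠ 0 := by
        intro h0; rw [h0] at hs; apply hb; rw [← hs]; norm_num
      refine ⟨mat (g : G) 1 0 / √(mat (g : G) 1 0 ^ 2 + mat (g : G) 2 0 ^ 2),
        - mat (g : G) 2 0 / √(mat (g : G) 1 0 ^ 2 + mat (g : G) 2 0 ^ 2), ?_, ?_⟩
      · rw [div_pow, div_pow, hs, ← add_div, neg_sq, div_self hb]
      · field_simp; ring
  obtain ⟨g₁, hg₁⟩ := exists_rot1 c s hcs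
  have m₁ := rot1_mem g₁ c s hcs hg₁
  have z1 : mat ((g₁ * g : K) : G) 2 0 = 0 := by
    simp [hg₁, Matrix.mul_apply, Fin.sum_univ_three]; linarith
  have n1 := K_orth (g₁ * g) 0 0
  rw [if_pos rfl, z1] at n1
  have hcs2 : mat ((g₁ * g : K) : G) 0 0 ^ 2 + (-mat ((g₁ * g : K) : G) 1 0) ^ 2 = 1 := by
    linarith
  obtain ⟨g₂, hg₂⟩ := exists_rot3 _ _ hcs2
  have m₂ := rot3_mem g₂ _ _ hcs2 hg₂
  have a0 : mat ((g₂ * (g₁ * g) : K) : G) 0 0 = 1 := by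
    rw [Subgroup.coe_mul, mat_mul, hg₂]
    simp only [Matrix.mul_apply, Fin.sum_univ_three]
    simp only [Matrix.of_apply, Matrix.cons_val', Matrix.cons_val_zero, Matrix.cons_val_one,
      Matrix.cons_val]
    linarith
  have b0 : mat ((g₂ * (g₁ * g) : K) : G) 1 0 = 0 := by
    rw [Subgroup.coe_mul, mat_mul, hg₂]
    simp only [Matrix.mul_apply, Fin.sum_univ_three]
    simp only [Matrix.of_apply, Matrix.cons_val', Matrix.cons_val_zero, Matrix.cons_val_one,
      Matrix.cons_val]
    ring
  have c0 : mat ((g₂ * (g₁ * g) : K) : G) 2 0 = 0 := by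
    rw [Subgroup.coe_mul, mat_mul, hg₂]
    simp only [Matrix.mul_apply, Fin.sum_univ_three]
    simp only [Matrix.of_apply, Matrix.cons_val', Matrix.cons_val_zero, Matrix.cons_val_one,
      Matrix.cons_val]
    rw [z1]; ring
  have m₃ : g₂ * (g₁ * g) ∈ spinCover.range := by
    generalize g₂ * (g₁ * g) = k at *
    have o01 := K_orth k 0 1
    have o02 := K_orth k 0 2
    have o11 := K_orth k 1 1
    have o12 := K_orth k 1 2
    have o22 := K_orth k 2 2
    have hd := det_mat (k : G)
    rw [Matrix.det_fin_three] at hd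
    simp only [a0, b0, c0, one_mul, zero_mul, add_zero, mul_zero, sub_zero] at o01 o02 hd
    simp at o01 o02 o11 o12 o22
    rw [o01] at o11 o12
    rw [o02] at o22
    have e1 : mat (k : G) 2 2 = mat (k : G) 1 1 := by
      linear_combination (-mat (k : G) 2 2) * o11 + mat (k : G) 2 1 * o12 + mat (k : G) 1 1 * hd
    have e2 : mat (k : G) 1 2 = - mat (k : G) 2 1 := by
      linear_combination (-mat (k : G) 1 2) * o11 + mat (k : G) 1 1 * o12 - mat (k : G) 2 1 * hd
    refine rot1_mem k (mat (k : G) 1 1) (mat (k : G) 2 1) (by linarith) ?_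
    ext i j
    fin_cases i <;> fin_cases j <;> simp [a0, b0, c0, o01, o02, e1, e2]
  have : g = g₁⁻¹ * (g₂⁻¹ * (g₂ * (g₁ * g))) := by group
  rw [this]
  exact mul_mem (inv_mem m₁) (mul_mem (inv_mem m₂) m₃)

theorem spinCover_ker (x : SU2) (hx : spinCover x = 1) : x.1 = 1 ∨ x.1 = -1 := by
  have hm : phiMat (x.1 0 0).re (x.1 0 0).im (x.1 0 1).re (x.1 0 1).im = 1 := by
    rw [← mat_spinCover, hx]; simp
  have hn := SU2_norm x
  have d0 := congrFun (congrFun hm 0) 0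
  have d1 := congrFun (congrFun hm 1) 1
  have d2 := congrFun (congrFun hm 2) 2
  simp [phiMat] at d0 d1 d2
  have q0 : (x.1 0 0).im = 0 := by
    have : (x.1 0 0).im ^ 2 = 0 := by
      linarith
    simpa using this
  have r0 : (x.1 0 1).re = 0 := by
    have : (x.1 0 1).re ^ 2 = 0 := by
      linarith
    simpa using this
  have s0 : (x.1 0 1).im = 0 := by
    have : (x.1 0 1).im ^ 2 = 0 := by
      linarith
    simpa using this
  have p1 : (x.1 0 0).re ^ 2 = 1 := by rw [q0, r0, s0] at hn; linarith
  have z : x.1 0 1 = 0 := Complex.ext r0 s0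
  have he := SU2_entries x
  rcases (mul_self_eq_one_iff.mp ((sq _).symm.trans p1)) with h | h
  · have w : x.1 0 0 = 1 := Complex.ext h q0
    left; ext i j; fin_cases i <;> fin_cases j <;> simp [he, w, z]
  · have w : x.1 0 0 = -1 := Complex.ext (by simpa using h) (by simpa using q0)
    right; ext i j; fin_cases i <;> fin_cases j <;> simp [he, w, z]

/-! ### The representations `τ_l` -/

/-- The space `V_n` of homogeneous polynomials of degree `n` in two variables `x = X 0`, `y = X 1`
(used for `n ≥ 0` only). -/
noncomputable abbrev V (n : ℤ) : Submodule ℂ (MvPolynomial (Fin 2) ℂ) :=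
  MvPolynomial.homogeneousSubmodule (Fin 2) ℂ n.toNat

/-- Linear substitution `f(x, y) ↦ f(M₀₀ x + M₀₁ y, M₁₀ x + M₁₁ y)`. -/
noncomputable def subst (M : Matrix (Fin 2) (Fin 2) ℂ) :
    MvPolynomial (Fin 2) ℂ →ₐ[ℂ] MvPolynomial (Fin 2) ℂ :=
  MvPolynomial.aeval fun i => ∑ j, MvPolynomial.C (M i j) * MvPolynomial.X j

theorem subst_one : subst 1 = AlgHom.id ℂ _ := by
  apply MvPolynomial.algHom_ext
  intro i
  fin_cases i <;> simp [subst, Matrix.one_apply]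

theorem subst_mul (M N : Matrix (Fin 2) (Fin 2) ℂ) :
    subst (M * N) = (subst N).comp (subst M) := by
  apply MvPolynomial.algHom_ext
  intro i
  simp [subst, Matrix.mul_apply, Fin.sum_univ_two]
  ring

theorem subst_mem (M : Matrix (Fin 2) (Fin 2) ℂ) (n : ℤ) {f : MvPolynomial (Fin 2) ℂ}
    (hf : f ∈ V n) : subst M f ∈ V n := by
  rw [MvPolynomial.mem_homogeneousSubmodule] at *
  have := hf.aeval (n := 1) (fun i => ∑ j, MvPolynomial.C (M i j) * MvPolynomial.X j) (fun i =>
    MvPolynomial.IsHomogeneous.sum _ _ _ fun j _ => MvPolynomial.isHomogeneous_C_mul_X _ _)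
  simpa [subst] using this

theorem subst_neg_one {n : ℤ} (hn : Even n.toNat) {f : MvPolynomial (Fin 2) ℂ} (hf : f ∈ V n) :
    subst (-1) f = f := by
  rw [MvPolynomial.mem_homogeneousSubmodule] at hf
  have e : (fun i : Fin 2 => ∑ j, MvPolynomial.C ((-1 : Matrix (Fin 2) (Fin 2) ℂ) i j) *
      MvPolynomial.X j) = fun i => -(MvPolynomial.X i : MvPolynomial (Fin 2) ℂ) := by
    ext1 i
    fin_cases i <;> simp [Matrix.one_apply]
  rw [subst, e]
  conv_rhs => rw [← MvPolynomial.aeval_X_left_apply f]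
  rw [MvPolynomial.aeval_def, MvPolynomial.aeval_def, MvPolynomial.eval₂_eq', MvPolynomial.eval₂_eq']
  refine Finset.sum_congr rfl fun d hd => ?_
  congr 1
  have h2 : d 0 + d 1 = n.toNat := by
    have := hf (MvPolynomial.mem_support_iff.mp hd)
    rw [← this, Finsupp.weight_apply, Finsupp.sum_fintype _ _ (by simp)]
    simp
  simp only [Fin.prod_univ_two]
  rw [neg_pow (MvPolynomial.X 0 : MvPolynomial (Fin 2) ℂ),
    neg_pow (MvPolynomial.X 1 : MvPolynomial (Fin 2) ℂ)]
  have : ((-1 : MvPolynomial (Fin 2) ℂ) ^ d 0) * (-1) ^ d 1 = 1 := by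
    rw [← pow_add, h2]; exact hn.neg_one_pow
  linear_combination (MvPolynomial.X 0 ^ d 0 * MvPolynomial.X 1 ^ d 1) * this

/-- The representation `τ_n` of `SU(2)` on `V_n`: `τ_n(g) f = f ∘ g⁻¹`. -/
noncomputable def tauSU (n : ℤ) : Representation ℂ SU2 (V n) where
  toFun g := ((subst (g⁻¹ : SU2).1).toLinearMap).restrict fun _ hf => subst_mem _ n hf
  map_one' := by
    apply LinearMap.ext; intro f; apply Subtype.ext
    simp [LinearMap.restrict_apply, subst_one]
  map_mul' g h := by
    apply LinearMap.ext; intro f; apply Subtype.ext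
    change subst ((g * h)⁻¹ : SU2).1 f.1 = subst (g⁻¹ : SU2).1 (subst (h⁻¹ : SU2).1 f.1)
    have e : ((g * h)⁻¹ : SU2).1 = (h⁻¹ : SU2).1 * (g⁻¹ : SU2).1 := by
      rw [_root_.mul_inv_rev]; rfl
    rw [e, subst_mul]; rfl

theorem tauSU_congr (l : ℤ) {x y : SU2} (h : spinCover x = spinCover y) :
    tauSU (2 * l) x = tauSU (2 * l) y := by
  have h1 : spinCover (y⁻¹ * x) = 1 := by rw [map_mul, map_inv, h, inv_mul_cancel]
  have h2 : tauSU (2 * l) (y⁻¹ * x) = 1 := by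
    have h3 : spinCover (y⁻¹ * x)⁻¹ = 1 := by rw [map_inv, h1, inv_one]
    apply LinearMap.ext; intro f; apply Subtype.ext
    change subst ((y⁻¹ * x)⁻¹ : SU2).1 f.1 = f.1
    rcases spinCover_ker _ h3 with e | e
    · rw [e, subst_one]; rfl
    · rw [e]
      refine subst_neg_one (n := 2 * l) ?_ f.2
      rcases le_total 0 l with hl | hl
      · exact ⟨l.toNat, by omega⟩
      · exact ⟨0, by omega⟩
  have : x = y * (y⁻¹ * x) := by group
  rw [this, map_mul, h2, mul_one]

/-- The representation `τ_{2l}` of `K = SO(3)` on `V_{2l}` induced from that of `SU(2)`: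
`τ_{2l}(φ(x)) = τ_{2l}(x)`. -/
noncomputable def tau (l : ℤ) : Representation ℂ K (V (2 * l)) where
  toFun k := tauSU (2 * l) (Function.surjInv spinCover_surjective k)
  map_one' := by
    rw [← map_one (tauSU (2 * l))]
    exact tauSU_congr l (by rw [Function.surjInv_eq spinCover_surjective, map_one])
  map_mul' k k' := by
    rw [← map_mul]
    exact tauSU_congr l (by
      rw [map_mul]; simp only [Function.surjInv_eq spinCover_surjective])

theorem tau_spinCover (l : ℤ) (x : SU2) : tau l (spinCover x) = tauSU (2 * l) x :=
  tauSU_congr l (Function.surjInv_eq spinCover_surjective _)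

/-- The standard basis vector `v_k = x^k y^{n-k}` of `V_n`, and `0` unless `0 ≤ k ≤ n`. -/
noncomputable def vec (n k : ℤ) : V n :=
  if h : 0 ≤ k ∧ k ≤ n then
    ⟨MvPolynomial.X 0 ^ k.toNat * MvPolynomial.X 1 ^ (n - k).toNat, by
      rw [MvPolynomial.mem_homogeneousSubmodule]
      have := (MvPolynomial.isHomogeneous_X_pow (R := ℂ) (0 : Fin 2) k.toNat).mul
        (MvPolynomial.isHomogeneous_X_pow (R := ℂ) (1 : Fin 2) (n - k).toNat)
      have e : k.toNat + (n - k).toNat = n.toNat := by omega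
      rwa [e] at this⟩
  else 0

/-- The dual basis vector `v_k^*` in `V_n^*`: the coefficient of `x^k y^{n-k}`
(and `0` unless `0 ≤ k ≤ n`). -/
noncomputable def dualVec (n k : ℤ) : Module.Dual ℂ (V n) :=
  if 0 ≤ k ∧ k ≤ n then
    MvPolynomial.lcoeff ℂ (Finsupp.single 0 k.toNat + Finsupp.single 1 (n - k).toNat) ∘ₗ
      (V n).subtype
  else 0

/-! ### The `K`-module `𝔭_ℂ` and the Clebsch-Gordan coefficients -/

/-- `𝔭_ℂ`: the symmetric matrices in `𝔤_ℂ = 𝔰𝔩(3, ℂ)`. -/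
def pC : Submodule ℂ (LieAlgebra.SpecialLinear.sl (Fin 3) ℂ) where
  carrier := {Z | Z.1ᵀ = Z.1}
  add_mem' := by
    intro Z W (hZ : _ = _) (hW : _ = _)
    change (Z.1 + W.1)ᵀ = Z.1 + W.1
    rw [Matrix.transpose_add, hZ, hW]
  zero_mem' := Matrix.transpose_zero
  smul_mem' := by
    intro c Z (hZ : _ = _)
    change (c • Z.1)ᵀ = c • Z.1
    rw [Matrix.transpose_smul, hZ]

/-- The matrices `X_0, …, X_4`. -/
noncomputable def Xmat : Fin 5 → Matrix (Fin 3) (Fin 3) ℂ :=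
  ![!![0, 0, 0; 0, 1, -Complex.I; 0, -Complex.I, -1],
    (-1 / 2 : ℂ) • !![0, Complex.I, 1; Complex.I, 0, 0; 1, 0, 0],
    (-1 / 3 : ℂ) • !![2, 0, 0; 0, -1, 0; 0, 0, -1],
    (-1 / 2 : ℂ) • !![0, Complex.I, -1; Complex.I, 0, 0; -1, 0, 0],
    !![0, 0, 0; 0, 1, Complex.I; 0, Complex.I, -1]]

theorem Xmat_trace (i : Fin 5) : (Xmat i).trace = 0 := by
  fin_cases i <;> simp [Xmat, Matrix.trace, Fin.sum_univ_three]
  ring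

theorem Xmat_symm (i : Fin 5) : (Xmat i)ᵀ = Xmat i := by
  fin_cases i <;> ext a b <;> fin_cases a <;> fin_cases b <;> simp [Xmat]

/-- The basis `X_0, …, X_4` of `𝔭_ℂ`. -/
noncomputable def X (i : Fin 5) : pC := ⟨⟨Xmat i, Xmat_trace i⟩, Xmat_symm i⟩

/-- The numerators `a(l, 2m; k, i)`. -/
def aCoef (l m k : ℤ) : Fin 5 → ℤ :=
  if m = 2 then
    ![(l + 4 - k) * (l + 3 - k) * (l + 2 - k) * (l + 1 - k),
      4 * (l + 4 - k) * (l + 3 - k) * (l + 2 - k) * k,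
      6 * (l + 4 - k) * (l + 3 - k) * k * (k - 1),
      4 * (l + 4 - k) * k * (k - 1) * (k - 2),
      k * (k - 1) * (k - 2) * (k - 3)]
  else if m = 1 then
    ![(l + 2 - k) * (l + 1 - k) * (l - k),
      -(l + 2 - k) * (l + 1 - k) * (l - 4 * k),
      -3 * (l + 2 - k) * (l - 2 * k + 2) * k,
      -(3 * l - 4 * k + 8) * k * (k - 1),
      -k * (k - 1) * (k - 2)]
  else if m = 0 then
    ![(l - k) * (l - 1 - k),
      -2 * (l - k) * (l - 2 * k - 1),
      l ^ 2 - 6 * k * l + 6 * k ^ 2 - l,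
      2 * (l - 2 * k + 1) * k,
      k * (k - 1)]
  else if m = -1 then
    ![l - k - 2, -(3 * l - 4 * k - 6), 3 * (l - 2 * k - 2), -(l - 4 * k - 2), -k]
  else if m = -2 then ![1, -4, 6, -4, 1]
  else 0

/-- The denominators `d(l, 2m)`. -/
def dCoef (l m : ℤ) : ℤ :=
  if m = 2 then (l + 4) * (l + 3) * (l + 2) * (l + 1)
  else if m = 1 then (l + 2) * (l + 1) * l
  else if m = 0 then l * (l - 1)
  else if m = -1 then l - 2
  else 1

/-- The Clebsch-Gordan coefficients `A_[l, 2m; k, i]`, put equal to zero unless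
`0 ≤ k ≤ l + 2m`. -/
noncomputable def A (l m k : ℤ) (i : Fin 5) : ℂ :=
  if 0 ≤ k ∧ k ≤ l + 2 * m then (aCoef l m k i : ℂ) / (dCoef l m : ℂ) else 0

open scoped TensorProduct in
/-- The map `I^{2l}_{2m} : V_{2(l+m)} → V_{2l} ⊗ 𝔭_ℂ`,
`v_k ↦ ∑_i A_[2l, 2m; k, i] v_{k+2-m-i} ⊗ X_i`. -/
noncomputable def injector (l m : ℤ) : V (2 * (l + m)) →ₗ[ℂ] V (2 * l) ⊗[ℂ] pC :=
  ∑ k ∈ Finset.Icc 0 (2 * (l + m)), (dualVec (2 * (l + m)) k).smulRight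
    (∑ i : Fin 5, A (2 * l) m k i • (vec (2 * l) (k + 2 - m - (i : ℕ)) ⊗ₜ[ℂ] X i))

open scoped TensorProduct in
/-- The linear map `η̃ : V_{2l} ⊗ 𝔭_ℂ → H_K`, `v ⊗ X ↦ π(X) η(v)`. -/
noncomputable def etaTilde (ν : a0 →ₗ[ℝ] ℂ) (σ : Fin 2 × Fin 2) (l : ℤ)
    (η : V (2 * l) →ₗ[ℂ] HK ν σ) : V (2 * l) ⊗[ℂ] pC →ₗ[ℂ] HK ν σ :=
  TensorProduct.lift ((piLie ν σ ∘ₗ pC.subtype).flip ∘ₗ η)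

/-- `Γ_{l,m}(η) = η̃ ∘ I^{2l}_{2m}`. -/
noncomputable def GammaFun (ν : a0 →ₗ[ℝ] ℂ) (σ : Fin 2 × Fin 2) (l m : ℤ)
    (η : V (2 * l) →ₗ[ℂ] HK ν σ) : V (2 * (l + m)) →ₗ[ℂ] HK ν σ :=
  etaTilde ν σ l η ∘ₗ injector l m

/-! ### The elementary functions and the induced basis -/

/-- `ε(σ₀; l) ∈ {0, 1}`, congruent to `l - σ₀₁ - σ₀₂` modulo `2`. -/
def eps (σ : Fin 2 × Fin 2) (l : ℤ) : ℕ := ((l - (σ.1 : ℕ) - (σ.2 : ℕ)) % 2).toNat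

/-- `δ(σ₀; l) ∈ {0, 1}`, congruent to `l - σ₀₂` modulo `2`. -/
def delta (σ : Fin 2 × Fin 2) (l : ℤ) : ℤ := (l - (σ.2 : ℕ)) % 2

/-- The index set `Z(σ₀; l)`. -/
noncomputable def Z (σ : Fin 2 × Fin 2) (l : ℤ) : Finset ℤ :=
  (Finset.Icc 0 (if eps σ l = 0 then l else l - 1)).filter fun k => k ≡ l - (σ.2 : ℕ) [ZMOD 2]

/-- `d(σ₀; l)`, the number of elements of `Z(σ₀; l)`. -/
noncomputable def d (σ : Fin 2 × Fin 2) (l : ℤ) : ℕ := (Z σ l).card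

/-- The function `x ↦ ⟨v^*_{2l-p} + (-1)^ε v^*_p, τ_{2l}(x) v_q⟩` on `K`, for `ε = ε(σ₀; l)`. -/
noncomputable def matCoeff (σ : Fin 2 × Fin 2) (l p q : ℤ) : K → ℂ := fun x =>
  (dualVec (2 * l) (2 * l - p) + (-1 : ℂ) ^ eps σ l • dualVec (2 * l) p)
    (tau l x (vec (2 * l) q))

/-- The restriction `r_K` of functions to `K`. -/
def restrictK (ν : a0 →ₗ[ℝ] ℂ) (σ : Fin 2 × Fin 2) (f : HK ν σ) : K → ℂ := fun k => f.1 k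

/-- The elementary function `s(l; p, q) ∈ H_K`, whose restriction to `K` is the matrix coefficient
`matCoeff`. -/
noncomputable def s (ν : a0 →ₗ[ℝ] ℂ) (σ : Fin 2 × Fin 2) (l p q : ℤ) : HK ν σ :=
  Function.invFun (restrictK ν σ) (matCoeff σ l p q)

/-- `S(l; p)`, as the linear map `V_{2l} → H_K`, `v_q ↦ s(l; p, q)`. -/
noncomputable def S (ν : a0 →ₗ[ℝ] ℂ) (σ : Fin 2 × Fin 2) (l p : ℤ) :
    V (2 * l) →ₗ[ℂ] HK ν σ :=
  ∑ q ∈ Finset.Icc 0 (2 * l), (dualVec (2 * l) q).smulRight (s ν σ l p q)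

/-- The entry in row `q` and column `k` (both counted from `0`) of the canonical block
`𝐒(σ₀; l) = (S(l; δ), S(l; δ + 2), …)`, for `δ = δ(σ₀; l)`. -/
noncomputable def block (ν : a0 →ₗ[ℝ] ℂ) (σ : Fin 2 × Fin 2) (l q k : ℤ) : HK ν σ :=
  s ν σ l (2 * k + delta σ l) q

/-- The entry in row `r` and column `q` (both counted from `0`) of `R(ι_i^{(l,m)})`, where
`I^{2l}_{2m} = ∑_i ι_i^{(l,m)} ⊗ X_i`. -/
noncomputable def iotaMat (l m : ℤ) (i : Fin 5) (r q : ℤ) : ℂ :=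
  if q = r + 2 - m - (i : ℕ) then A (2 * l) m r i else 0

/-- The component `r` of `ℭ_{l,m} v = ∑_{i,q} (R(ι_i^{(l,m)}) e_q) ⊗ π(X_i) v_q`. -/
noncomputable def pMatMul (ν : a0 →ₗ[ℝ] ℂ) (σ : Fin 2 × Fin 2) (l m : ℤ) (v : ℤ → HK ν σ)
    (r : ℤ) : HK ν σ :=
  ∑ i : Fin 5, ∑ q ∈ Finset.Icc 0 (2 * l), iotaMat l m i r q • piLie ν σ (X i : pC) (v q)

/-! ### The matrix `R(Γ_{l,m})` -/

/-- `γ_[l,m;p,1]`. -/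
noncomputable def gammaPos (ν : a0 →ₗ[ℝ] ℂ) (l m p : ℤ) : ℂ :=
  (ν H₂ + rho0 H₂ - l + p) * A (2 * l) m (2 * l - p + m - 2) 0

/-- `γ_[l,m;p,0]`. -/
noncomputable def gammaZero (ν : a0 →ₗ[ℝ] ℂ) (l m p : ℤ) : ℂ :=
  -(1 / 3) * (2 * ν H₁ - ν H₂ + 2 * rho0 H₁ - rho0 H₂ + l * m - 3 + m * (m + 1) / 2) *
    A (2 * l) m (2 * l - p + m) 2

/-- `γ_[l,m;p,-1]`. -/
noncomputable def gammaNeg (ν : a0 →ₗ[ℝ] ℂ) (l m p : ℤ) : ℂ :=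
  (ν H₂ + rho0 H₂ + l - p) * A (2 * l) m (2 * l - p + m + 2) 4

/-- `n(σ₀; l, m)`. -/
def nRows (σ : Fin 2 × Fin 2) (l m : ℤ) : ℤ :=
  if Even m then (2 - m) / 2
  else if Even (l + (σ.2 : ℕ)) then (3 - m) / 2
  else (1 - m) / 2

/-- The entry in row `j` and column `k` (both counted from `0`) of the matrix
`(O_{r, ·} ; Diag_{0 ≤ n ≤ c} (f n))`, extended by zero. -/
def diagBlock (r c : ℤ) (f : ℤ → ℂ) (j k : ℤ) : ℂ :=
  if j = k + r ∧ 0 ≤ k ∧ k ≤ c then f k else 0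

/-- The entry in row `j` and column `k` of the matrix whose only nonzero entry is `x`, in row `j₀`
and column `k₀`. -/
def unitEntry (j₀ k₀ : ℤ) (x : ℂ) (j k : ℤ) : ℂ := if j = j₀ ∧ k = k₀ then x else 0

/-- The number of rows of the matrix `stacked`. -/
noncomputable def stackedRows (σ : Fin 2 × Fin 2) (l m : ℤ) : ℤ :=
  if σ.2 = 0 ∧ ¬ Even m then
    if Even ((σ.1 : ℕ) + l) then d σ l else d σ l + 2
  else d σ l + 1

/-- The entry in row `j` and column `k` (both counted from `0`) of the matrix
`(O_{n(σ₀; l, m), d(σ₀; l)} ; R(Γ_{l,m}))`, in the five cases of the statement. -/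
noncomputable def stacked (ν : a0 →ₗ[ℝ] ℂ) (σ : Fin 2 × Fin 2) (l m j k : ℤ) : ℂ :=
  let D : ℤ := d σ l
  let γn : ℤ → ℂ := fun k => gammaNeg ν l m (2 * k + delta σ l)
  let γz : ℤ → ℂ := fun k => gammaZero ν l m (2 * k + delta σ l)
  let γp : ℤ → ℂ := fun k => gammaPos ν l m (2 * k + delta σ l)
  if σ.2 = 0 then
    if Even m then
      if Even ((σ.1 : ℕ) + l) then
        diagBlock 0 (D - 1) γn j k + diagBlock 1 (D - 1) γz j k + diagBlock 2 (D - 2) γp j k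
          + unitEntry (D - 1) (D - 1) (gammaPos ν l m l) j k
      else
        diagBlock 0 (D - 1) γn j k + diagBlock 1 (D - 1) γz j k + diagBlock 2 (D - 2) γp j k
    else
      if Even ((σ.1 : ℕ) + l) then
        diagBlock 0 (D - 1) γn j k + diagBlock 1 (D - 2) γz j k + diagBlock 2 (D - 3) γp j k
          + unitEntry (D - 1) (D - 1) (-gammaPos ν l m l) j k
      else
        diagBlock 0 (D - 1) γn j k + diagBlock 1 (D - 1) γz j k + diagBlock 2 (D - 1) γp j k
  else
    diagBlock 0 (D - 1) γn j k + diagBlock 1 (D - 1) γz j k + diagBlock 2 (D - 2) γp j k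
      + unitEntry D (D - 1) ((-1) ^ eps σ (l + m) * gammaPos ν l m (l - 1)) j k

/-- The matrix `R(Γ_{l,m})` of size `d(σ₀; l+m) × d(σ₀; l)`. -/
noncomputable def RGamma (ν : a0 →ₗ[ℝ] ℂ) (σ : Fin 2 × Fin 2) (l m : ℤ) :
    Matrix (Fin (d σ (l + m))) (Fin (d σ l)) ℂ :=
  Matrix.of fun j k => stacked ν σ l m (nRows σ l m + (j : ℕ)) (k : ℕ)

end SL3

open SL3

namespace SL3
open Matrix

/-! ### The standard basis of `V_n` -/

/-! The proof is Frobenius reciprocity followed by a computation at the identity of `G`. By the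
Iwasawa decomposition `G = N₀A₀K` (`exists_iwasawa`), an element of `H_K` is determined by its
restriction to `K`. Hence a `K`-homomorphism `η : V_{2l} → H_K` is determined by the functional `v ↦
η(v)(1)`. The functionals that arise are exactly those transforming by `σ₀` under `M₀`
(`evalOne_injective`, `evalOne_mem`, `evalOne_frob`). Being equivariant under `M₀` means a parity
condition on the support and a reflection symmetry `k ↔ 2l - k`, so the symmetrized dual vectors
`symDual σ l p`, `p ∈ Z σ l`, form a basis of the space of functionals and yield the induced basis.
Smoothness of the extended matrix coefficients holds because they are polynomial in the entries of
the `K`-factor, which in turn is smooth in `g`.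

That `Γ` maps `K`-homomorphisms to `K`-homomorphisms is the equivariance of the injector
(`injector_tau`). A tensor in `V_{2l} ⊗ 𝔭_ℂ` is read as a polynomial in two pairs of variables `a`,
`b`, with `X_i` becoming the monomial `b₀^i b₁^{4-i}`. In this model the Clebsch-Gordan formula is a
classical transvectant: up to a constant, `f` goes to `(a₀b₁ - a₁b₀)^{2-m}` times the coefficient of
`t^{2+m}` in `f(a + tb)` (`clebschGordan_identity`), and this is visibly invariant under matrices of
determinant one.

For the matrix, split `X ∈ 𝔤` along `𝔤 = 𝔫 + 𝔞 + 𝔨`. At the identity `𝔫` acts by zero, `𝔞` by `ν₀ +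
ρ₀`, and `𝔨` through the differential of `τ_{2l}` (`lieDeriv_one`). Inserting the `X_i`, the terms
`i = 1, 2, 3` of `Γ(η)(v_r)(1)` all involve the same basis vector and merge by `A_middle`. The
result is the three-term relation `evalOne_gammaMap_symDual`, taking the index `p` to `p + m - 2`,
`p + m`, `p + m + 2`. The five cases of the matrix express these targets in the basis: a negative
index gives zero, an index beyond the centre `l + m` is folded back by `symDual_reflect`, and the
centre itself gives zero when the reflection sign is `-1` (`sum_RGamma`). -/

theorem vec_coe {n k : ℤ} (hk : 0 ≤ k ∧ k ≤ n) :
    (vec n k : MvPolynomial (Fin 2) ℂ) =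
      MvPolynomial.X 0 ^ k.toNat * MvPolynomial.X 1 ^ (n - k).toNat := by
  simp [vec, hk]

theorem vec_eq_zero {n k : ℤ} (hk : ¬(0 ≤ k ∧ k ≤ n)) : vec n k = 0 := by
  simp [vec, hk]

theorem dualVec_eq_zero {n k : ℤ} (hk : ¬(0 ≤ k ∧ k ≤ n)) : dualVec n k = 0 := by
  simp [dualVec, hk]

theorem dualVec_apply {n k : ℤ} (hk : 0 ≤ k ∧ k ≤ n) (f : V n) :
    dualVec n k f = MvPolynomial.coeff
      (Finsupp.single 0 k.toNat + Finsupp.single 1 (n - k).toNat) f.1 := by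
  simp [dualVec, hk, MvPolynomial.lcoeff]

theorem X_pow_mul_X_pow (a b : ℕ) :
    (MvPolynomial.X 0 ^ a * MvPolynomial.X 1 ^ b : MvPolynomial (Fin 2) ℂ) =
      MvPolynomial.monomial (Finsupp.single 0 a + Finsupp.single 1 b) 1 := by
  rw [MvPolynomial.X_pow_eq_monomial, MvPolynomial.X_pow_eq_monomial, MvPolynomial.monomial_mul,
    one_mul]

theorem dualVec_vec {n k : ℤ} (hk : 0 ≤ k ∧ k ≤ n) (j : ℤ) :
    dualVec n j (vec n k) = if j = k then 1 else 0 := by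
  by_cases hj : 0 ≤ j ∧ j ≤ n
  · rw [dualVec_apply hj, vec_coe hk, X_pow_mul_X_pow, MvPolynomial.coeff_monomial]
    refine if_congr ⟨fun h => ?_, fun h => by rw [h]⟩ rfl rfl
    have := DFunLike.congr_fun h 0
    simp at this
    omega
  · rw [dualVec_eq_zero hj, if_neg (by rintro rfl; exact hj hk)]; rfl

/-- A homogeneous polynomial is the sum of its monomials. Nonnegativity matters: for `n < 0`
truncation makes `V n` the constants, while the range of summation is empty. -/
theorem sum_dualVec_smul_vec {n : ℤ} (hn : 0 ≤ n) (f : V n) :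
    ∑ k ∈ Finset.Icc 0 n, dualVec n k f • vec n k = f := by
  apply Subtype.ext
  apply MvPolynomial.ext
  intro e
  have hf : f.1.IsHomogeneous n.toNat := (MvPolynomial.mem_homogeneousSubmodule _ _).mp f.2
  rw [Submodule.coe_sum, MvPolynomial.coeff_sum]
  have hterm : ∀ k ∈ Finset.Icc 0 n,
      MvPolynomial.coeff e ((dualVec n k f • vec n k : V n) : MvPolynomial (Fin 2) ℂ) =
        if Finsupp.single 0 k.toNat + Finsupp.single 1 (n - k).toNat = e then
          MvPolynomial.coeff e f.1 else 0 := by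
    intro k hk
    rw [Finset.mem_Icc] at hk
    rw [Submodule.coe_smul, MvPolynomial.coeff_smul, vec_coe hk, dualVec_apply hk, X_pow_mul_X_pow,
      MvPolynomial.coeff_monomial]
    split_ifs with h
    · rw [h]; simp
    · simp
  rw [Finset.sum_congr rfl hterm]
  by_cases he : e 0 + e 1 = n.toNat
  · rw [Finset.sum_eq_single (e 0 : ℤ)]
    · rw [if_pos]
      ext i
      fin_cases i <;> simp
      omega
    · intro k hk hne
      rw [Finset.mem_Icc] at hk
      rw [if_neg]
      rintro rfl
      apply hne
      simp
      omega
    · intro h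
      exfalso; apply h
      rw [Finset.mem_Icc]
      omega
  · have h0 : MvPolynomial.coeff e f.1 = 0 := by
      by_contra hne
      apply he
      have := hf hne
      rw [← this, Finsupp.weight_apply, Finsupp.sum_fintype _ _ (by simp)]
      simp
    simp [h0]

theorem linearMap_ext_vec {W : Type*} [AddCommMonoid W] [Module ℂ W] {n : ℤ} (hn : 0 ≤ n)
    {f g : V n →ₗ[ℂ] W} (h : ∀ k ∈ Finset.Icc 0 n, f (vec n k) = g (vec n k)) : f = g := by
  apply LinearMap.ext
  intro v
  rw [← sum_dualVec_smul_vec hn v, map_sum, map_sum]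
  refine Finset.sum_congr rfl fun k hk => ?_
  rw [map_smul, map_smul, h k hk]

theorem sum_smulRight_vec {W : Type*} [AddCommMonoid W] [Module ℂ W] {n k : ℤ}
    (hk : 0 ≤ k ∧ k ≤ n) (w : ℤ → W) :
    (∑ j ∈ Finset.Icc 0 n, (dualVec n j).smulRight (w j)) (vec n k) = w k := by
  rw [LinearMap.sum_apply, Finset.sum_eq_single k]
  · simp [dualVec_vec hk]
  · intro j _ hj
    simp [dualVec_vec hk, hj]
  · intro h
    exact absurd (Finset.mem_Icc.mpr hk) h

/-- This is the source of `K`-finiteness in `frobFun_mem_HK`, where the translates of a function lie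
in an image of `V (2 * l)`. Degrees `n ≤ 0` all collapse to `V 0`. -/
instance finiteDimensional_V (n : ℤ) : FiniteDimensional ℂ (V n) := by
  rcases le_total 0 n with hn | hn
  · refine ⟨⟨(Finset.Icc 0 n).image (vec n), eq_top_iff.mpr fun v _ => ?_⟩⟩
    rw [← sum_dualVec_smul_vec hn v]
    refine Submodule.sum_mem _ fun k hk => Submodule.smul_mem _ _ (Submodule.subset_span ?_)
    exact Finset.mem_coe.mpr (Finset.mem_image_of_mem _ hk)
  · have e : V n = V 0 := by
      have : n.toNat = (0 : ℤ).toNat := by omega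
      unfold V; rw [this]
    rw [e]
    refine ⟨⟨(Finset.Icc 0 0).image (vec 0), eq_top_iff.mpr fun v _ => ?_⟩⟩
    rw [← sum_dualVec_smul_vec le_rfl v]
    refine Submodule.sum_mem _ fun k hk => Submodule.smul_mem _ _ (Submodule.subset_span ?_)
    exact Finset.mem_coe.mpr (Finset.mem_image_of_mem _ hk)

/-- The substitution action on homogeneous polynomials of degree `n`. -/
noncomputable def substV (n : ℤ) (M : Matrix (Fin 2) (Fin 2) ℂ) : V n →ₗ[ℂ] V n :=
  (subst M).toLinearMap.restrict fun _ hf => subst_mem M n hf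

theorem substV_coe (n : ℤ) (M : Matrix (Fin 2) (Fin 2) ℂ) (f : V n) :
    (substV n M f : MvPolynomial (Fin 2) ℂ) = subst M f.1 := rfl

theorem tau_spinCover_apply (l : ℤ) (x : SU2) :
    tau l (spinCover x) = substV (2 * l) (x⁻¹ : SU2).1 := tau_spinCover l x

theorem subst_X (M : Matrix (Fin 2) (Fin 2) ℂ) (i : Fin 2) :
    subst M (MvPolynomial.X i) =
      MvPolynomial.C (M i 0) * MvPolynomial.X 0 + MvPolynomial.C (M i 1) * MvPolynomial.X 1 := by
  simp [subst, Fin.sum_univ_two]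

theorem SU2_inv (x : SU2) : (x⁻¹ : SU2).1 = !![star (x.1 0 0), -(x.1 0 1); star (x.1 0 1), x.1 0 0] := by
  have e : (x⁻¹ : SU2).1 = star x.1 := rfl
  have hx := SU2_entries x
  rw [e]
  ext i j
  fin_cases i <;> fin_cases j <;> simp [Matrix.star_apply, hx]

end SL3

namespace SL3
open Matrix

/-! ### Coefficientwise calculus of families of polynomials -/

/-- A family of polynomials with smooth coefficients. -/
def ContDiffCoeff {E : Type*} [NormedAddCommGroup E] [NormedSpace ℝ E]
    (P : E → MvPolynomial (Fin 2) ℂ) : Prop :=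
  ∀ e, ContDiff ℝ ∞ fun y => MvPolynomial.coeff e (P y)

namespace ContDiffCoeff

variable {E : Type*} [NormedAddCommGroup E] [NormedSpace ℝ E] {P Q : E → MvPolynomial (Fin 2) ℂ}

theorem const (p : MvPolynomial (Fin 2) ℂ) : ContDiffCoeff fun _ : E => p :=
  fun _ => contDiff_const

theorem add (hP : ContDiffCoeff P) (hQ : ContDiffCoeff Q) :
    ContDiffCoeff fun y => P y + Q y := by
  intro e
  simp only [MvPolynomial.coeff_add]
  exact (hP e).add (hQ e)

theorem mul (hP : ContDiffCoeff P) (hQ : ContDiffCoeff Q) :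
    ContDiffCoeff fun y => P y * Q y := by
  intro e
  simp only [MvPolynomial.coeff_mul]
  exact ContDiff.sum fun x _ => (hP x.1).mul (hQ x.2)

theorem pow (hP : ContDiffCoeff P) (n : ℕ) : ContDiffCoeff fun y => P y ^ n := by
  induction n with
  | zero => simpa using const 1
  | succ n ih => simpa only [pow_succ] using ih.mul hP

theorem smul_const {c : E → ℂ} (hc : ContDiff ℝ ∞ c) (p : MvPolynomial (Fin 2) ℂ) :
    ContDiffCoeff fun y => c y • p := by
  intro e
  simp only [MvPolynomial.coeff_smul]
  exact hc.smul contDiff_const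

end ContDiffCoeff

/-- A curve of polynomials whose coefficients have the derivatives given by `P'` at `t`. -/
def HasDerivCoeff (P : ℝ → MvPolynomial (Fin 2) ℂ) (P' : MvPolynomial (Fin 2) ℂ) (t : ℝ) : Prop :=
  ∀ e, HasDerivAt (fun u => MvPolynomial.coeff e (P u)) (MvPolynomial.coeff e P') t

namespace HasDerivCoeff

variable {P Q : ℝ → MvPolynomial (Fin 2) ℂ} {P' Q' : MvPolynomial (Fin 2) ℂ} {t : ℝ}

theorem add (hP : HasDerivCoeff P P' t) (hQ : HasDerivCoeff Q Q' t) :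
    HasDerivCoeff (fun u => P u + Q u) (P' + Q') t := by
  intro e
  simp only [MvPolynomial.coeff_add]
  exact (hP e).add (hQ e)

theorem mul (hP : HasDerivCoeff P P' t) (hQ : HasDerivCoeff Q Q' t) :
    HasDerivCoeff (fun u => P u * Q u) (P' * Q t + P t * Q') t := by
  intro e
  simp only [MvPolynomial.coeff_add, MvPolynomial.coeff_mul, ← Finset.sum_add_distrib]
  exact HasDerivAt.fun_sum fun x _ => (hP x.1).mul (hQ x.2)

theorem pow (hP : HasDerivCoeff P P' t) (n : ℕ) :
    HasDerivCoeff (fun u => P u ^ n) (n * P t ^ (n - 1) * P') t := by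
  induction n with
  | zero => intro e; simpa using hasDerivAt_const t _
  | succ n ih =>
    have h := ih.mul hP
    simp only [← pow_succ] at h
    convert h using 1
    -- The exponent `n - 1` is truncated, so the induction step from `0` is treated apart.
    rcases n with _ | n
    · simp
    · simp only [Nat.add_sub_cancel, pow_succ]; push_cast; ring

theorem congr (hP : HasDerivCoeff P P' t) (h : P' = Q') : HasDerivCoeff P Q' t := h ▸ hP

theorem C_mul {c : ℝ → ℂ} {c' : ℂ} (hc : HasDerivAt c c' t) (p : MvPolynomial (Fin 2) ℂ) :
    HasDerivCoeff (fun u => MvPolynomial.C (c u) * p) (MvPolynomial.C c' * p) t := by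
  intro e
  simp only [MvPolynomial.coeff_C_mul]
  exact hc.mul_const _

end HasDerivCoeff

/-! ### The quadratic polynomials spanning `V_2` -/

/-- The basis of `V_2` on which `SO(3)` acts by its standard matrices. -/
noncomputable def quad : Fin 3 → MvPolynomial (Fin 2) ℂ :=
  ![MvPolynomial.C Complex.I * (MvPolynomial.X 0 * MvPolynomial.X 1),
    MvPolynomial.C (1 / 2) * (MvPolynomial.X 0 ^ 2 + MvPolynomial.X 1 ^ 2),
    MvPolynomial.C (-Complex.I / 2) * (MvPolynomial.X 0 ^ 2 - MvPolynomial.X 1 ^ 2)]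

/-- The values of the polynomials `quad`. -/
noncomputable def quadVal (b : Fin 2 → ℂ) : Fin 3 → ℂ :=
  ![Complex.I * (b 0 * b 1), (1 / 2) * (b 0 ^ 2 + b 1 ^ 2), (-Complex.I / 2) * (b 0 ^ 2 - b 1 ^ 2)]

theorem eval_quad (b : Fin 2 → ℂ) (j : Fin 3) : MvPolynomial.eval b (quad j) = quadVal b j := by
  fin_cases j <;> simp [quad, quadVal]

theorem eval_subst (M : Matrix (Fin 2) (Fin 2) ℂ) (f : MvPolynomial (Fin 2) ℂ) (b : Fin 2 → ℂ) :
    MvPolynomial.eval b (subst M f) = MvPolynomial.eval (M *ᵥ b) f := by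
  have : (MvPolynomial.aeval b).comp (subst M) = MvPolynomial.aeval (M *ᵥ b) := by
    apply MvPolynomial.algHom_ext
    intro i
    fin_cases i <;> simp [subst_X]
  simpa [MvPolynomial.coe_aeval_eq_eval] using DFunLike.congr_fun this f

/-- The vector `quadVal b` is the isotropic vector of `ℂ³` attached to the spinor `b`, and the
covering `φ` is the resulting action on `ℂ³`. Both sides are homogeneous quadratic in the four real
coordinates of `x`, so the identity needs only the relation `I² = -1`. -/
theorem quadVal_inv (x : SU2) (b : Fin 2 → ℂ) (j : Fin 3) :
    quadVal ((x⁻¹ : SU2).1 *ᵥ b) j = ∑ i, (mat (spinCover x : G) i j : ℂ) * quadVal b i := by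
  have hn := SU2_norm x
  rw [SU2_inv, mat_spinCover]
  generalize x.1 0 0 = α at *
  generalize x.1 0 1 = β at *
  have hα : α = α.re + α.im * Complex.I := (Complex.re_add_im α).symm
  have hβ : β = β.re + β.im * Complex.I := (Complex.re_add_im β).symm
  have hα' : star α = α.re - α.im * Complex.I := by
    apply Complex.ext <;> simp
  have hβ' : star β = β.re - β.im * Complex.I := by
    apply Complex.ext <;> simp
  have e : !![star α, -β; star β, α] =
      !![(α.re : ℂ) - α.im * Complex.I, -(β.re + β.im * Complex.I);
        β.re - β.im * Complex.I, α.re + α.im * Complex.I] := by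
    rw [hα', hβ', ← hα, ← hβ]
  rw [e]
  generalize α.re = p at *
  generalize α.im = q at *
  generalize β.re = r at *
  generalize β.im = s at *
  have hI := Complex.I_sq
  have hI3 : Complex.I ^ 3 = -Complex.I := by rw [pow_succ, hI]; ring
  fin_cases j <;> simp [quadVal, phiMat, Matrix.mulVec, dotProduct, Fin.sum_univ_two,
    Fin.sum_univ_three] <;> ring_nf <;> simp only [hI, hI3] <;> ring

theorem subst_quad (x : SU2) (j : Fin 3) :
    subst (x⁻¹ : SU2).1 (quad j) = ∑ i, (mat (spinCover x : G) i j : ℂ) • quad i := by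
  apply MvPolynomial.funext
  intro b
  rw [eval_subst, eval_quad, quadVal_inv, map_sum]
  refine Finset.sum_congr rfl fun i _ => ?_
  rw [MvPolynomial.smul_eval, eval_quad]

/-- The action of a `3 × 3` matrix on the polynomials `quad`. -/
noncomputable def quadMat (y : Fin 3 → Fin 3 → ℝ) (j : Fin 3) : MvPolynomial (Fin 2) ℂ :=
  ∑ i, (y i j : ℂ) • quad i

theorem contDiffCoeff_quadMat (j : Fin 3) : ContDiffCoeff fun y => quadMat y j := by
  unfold quadMat
  simp only [Fin.sum_univ_three]
  have h : ∀ i, ContDiffCoeff fun y : Fin 3 → Fin 3 → ℝ => (y i j : ℂ) • quad i := fun i =>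
    ContDiffCoeff.smul_const (Complex.ofRealCLM.contDiff.comp (by fun_prop)) _
  exact ((h 0).add (h 1)).add (h 2)

/-- Every monomial of even degree is a product of the quadratic forms `xy`, `x²`, `y²`, on which `K`
acts through its own matrix entries. So `τ_{2l}(k) v_q` is polynomial in the entries of `k`, with no
reference to a lift to `SU(2)`. -/
theorem exists_contDiffCoeff_tau (l q : ℤ) :
    ∃ P : (Fin 3 → Fin 3 → ℝ) → MvPolynomial (Fin 2) ℂ, ContDiffCoeff P ∧
      ∀ k : K, (tau l k (vec (2 * l) q) : MvPolynomial (Fin 2) ℂ) = P (entries (k : G)) := by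
  by_cases hq : 0 ≤ q ∧ q ≤ 2 * l
  swap
  · refine ⟨fun _ => 0, ContDiffCoeff.const 0, fun k => ?_⟩
    rw [vec_eq_zero hq, map_zero]; rfl
  have hq2 : ∀ x : SU2, ∀ j, subst (x⁻¹ : SU2).1 (quad j) =
      quadMat (entries (spinCover x : G)) j := subst_quad
  have hCI : (MvPolynomial.C Complex.I * MvPolynomial.C Complex.I : MvPolynomial (Fin 2) ℂ) = -1 := by
    rw [← map_mul, Complex.I_mul_I]; simp
  have hxy : (MvPolynomial.X 0 * MvPolynomial.X 1 : MvPolynomial (Fin 2) ℂ) =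
      MvPolynomial.C (-Complex.I) * quad 0 := by
    simp only [quad, cons_val_zero, map_neg]
    linear_combination (MvPolynomial.X 0 * MvPolynomial.X 1) * hCI
  have h2 : (MvPolynomial.C (1 / 2) + MvPolynomial.C (1 / 2) : MvPolynomial (Fin 2) ℂ) = 1 := by
    rw [← map_add]; norm_num
  have e2 : (MvPolynomial.C (-Complex.I / 2) : MvPolynomial (Fin 2) ℂ) =
      -(MvPolynomial.C Complex.I * MvPolynomial.C (1 / 2)) := by
    rw [← map_mul, ← map_neg]; congr 1; ring
  have hxx : (MvPolynomial.X 0 ^ 2 : MvPolynomial (Fin 2) ℂ) =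
      quad 1 + MvPolynomial.C Complex.I * quad 2 := by
    simp only [quad, cons_val_one, cons_val, cons_val_zero, e2]
    linear_combination (-MvPolynomial.X 0 ^ 2) * h2 +
      (MvPolynomial.C (1 / 2) * (MvPolynomial.X 0 ^ 2 - MvPolynomial.X 1 ^ 2)) * hCI
  have hyy : (MvPolynomial.X 1 ^ 2 : MvPolynomial (Fin 2) ℂ) =
      quad 1 + MvPolynomial.C (-Complex.I) * quad 2 := by
    simp only [quad, cons_val_one, cons_val, cons_val_zero, e2, map_neg]
    linear_combination (-MvPolynomial.X 1 ^ 2) * h2 -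
      (MvPolynomial.C (1 / 2) * (MvPolynomial.X 0 ^ 2 - MvPolynomial.X 1 ^ 2)) * hCI
  have hC : ∀ (M : Matrix (Fin 2) (Fin 2) ℂ) (c : ℂ), subst M (MvPolynomial.C c) = MvPolynomial.C c := by
    intro M c; simp [subst]
  -- For `q ≤ l` the monomial is `(xy)^q (y²)^{l-q}`; otherwise it is `(xy)^{2l-q} (x²)^{q-l}`.
  rcases le_total q l with h | h
  · refine ⟨fun y => (MvPolynomial.C (-Complex.I) * quadMat y 0) ^ q.toNat *
      (quadMat y 1 + MvPolynomial.C (-Complex.I) * quadMat y 2) ^ (l - q).toNat,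
      (((ContDiffCoeff.const _).mul (contDiffCoeff_quadMat 0)).pow _).mul
        (((contDiffCoeff_quadMat 1).add ((ContDiffCoeff.const _).mul
          (contDiffCoeff_quadMat 2))).pow _), fun k => ?_⟩
    obtain ⟨x, rfl⟩ := spinCover_surjective k
    have e : (2 * l - q).toNat = q.toNat + 2 * (l - q).toNat := by omega
    rw [tau_spinCover_apply, substV_coe, vec_coe hq, e, pow_add, ← mul_assoc, ← mul_pow, pow_mul,
      hxy, hyy]
    simp only [map_mul, map_pow, map_add, hC, hq2]
  · refine ⟨fun y => (MvPolynomial.C (-Complex.I) * quadMat y 0) ^ (2 * l - q).toNat *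
      (quadMat y 1 + MvPolynomial.C Complex.I * quadMat y 2) ^ (q - l).toNat,
      (((ContDiffCoeff.const _).mul (contDiffCoeff_quadMat 0)).pow _).mul
        (((contDiffCoeff_quadMat 1).add ((ContDiffCoeff.const _).mul
          (contDiffCoeff_quadMat 2))).pow _), fun k => ?_⟩
    obtain ⟨x, rfl⟩ := spinCover_surjective k
    have e : q.toNat = (2 * l - q).toNat + 2 * (q - l).toNat := by omega
    rw [tau_spinCover_apply, substV_coe, vec_coe hq, e, pow_add, mul_right_comm, ← mul_pow, pow_mul,
      hxy, hxx]
    simp only [map_mul, map_pow, map_add, hC, hq2]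

/-- The matrix coefficients of `τ_{2l}` are smooth functions of the matrix entries. -/
theorem exists_contDiff_matrixCoeff {l : ℤ} (hl : 0 ≤ l) (ψ : Module.Dual ℂ (V (2 * l)))
    (v : V (2 * l)) :
    ∃ P : (Fin 3 → Fin 3 → ℝ) → ℂ, ContDiff ℝ ∞ P ∧
      ∀ k : K, ψ (tau l k v) = P (entries (k : G)) := by
  choose P hP hPe using exists_contDiffCoeff_tau l
  refine ⟨fun y => ∑ q ∈ Finset.Icc 0 (2 * l), dualVec (2 * l) q v *
    ∑ j ∈ Finset.Icc 0 (2 * l), MvPolynomial.coeff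
      (Finsupp.single 0 j.toNat + Finsupp.single 1 (2 * l - j).toNat) (P q y) *
        ψ (vec (2 * l) j), ?_, fun k => ?_⟩
  · exact ContDiff.sum fun q _ => contDiff_const.mul
      (ContDiff.sum fun j _ => (hP q _).mul contDiff_const)
  · conv_lhs => rw [← sum_dualVec_smul_vec (by omega) v]
    simp only [map_sum, map_smul, smul_eq_mul]
    refine Finset.sum_congr rfl fun q _ => ?_
    congr 1
    conv_lhs => rw [← sum_dualVec_smul_vec (by omega) (tau l k (vec (2 * l) q))]
    simp only [map_sum, map_smul, smul_eq_mul]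
    refine Finset.sum_congr rfl fun j hj => ?_
    rw [dualVec_apply (Finset.mem_Icc.mp hj), hPe]

end SL3

namespace SL3
open Matrix

/-! ### The Iwasawa decomposition -/

/-- The cross product of the second and third rows. -/
def rowCross (y : Fin 3 → Fin 3 → ℝ) : Fin 3 → ℝ :=
  ![y 1 1 * y 2 2 - y 1 2 * y 2 1, y 1 2 * y 2 0 - y 1 0 * y 2 2, y 1 0 * y 2 1 - y 1 1 * y 2 0]

/-- The squared norm of the cross product of the second and third rows. -/
def crossSq (y : Fin 3 → Fin 3 → ℝ) : ℝ :=
  rowCross y 0 ^ 2 + rowCross y 1 ^ 2 + rowCross y 2 ^ 2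

/-- The squared norm of the third row. -/
def lastSq (y : Fin 3 → Fin 3 → ℝ) : ℝ := y 2 0 ^ 2 + y 2 1 ^ 2 + y 2 2 ^ 2

/-- The norm of the cross product of the second and third rows. -/
noncomputable def crossNorm (y : Fin 3 → Fin 3 → ℝ) : ℝ := √(crossSq y)

/-- The norm of the third row. -/
noncomputable def lastNorm (y : Fin 3 → Fin 3 → ℝ) : ℝ := √(lastSq y)

/-- The matrix of the orthogonal factor of the Iwasawa decomposition. -/
noncomputable def kappaMat (y : Fin 3 → Fin 3 → ℝ) : Matrix (Fin 3) (Fin 3) ℝ :=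
  !![rowCross y 0 / crossNorm y, rowCross y 1 / crossNorm y, rowCross y 2 / crossNorm y;
     (y 2 1 * rowCross y 2 - y 2 2 * rowCross y 1) / (crossNorm y * lastNorm y),
     (y 2 2 * rowCross y 0 - y 2 0 * rowCross y 2) / (crossNorm y * lastNorm y),
     (y 2 0 * rowCross y 1 - y 2 1 * rowCross y 0) / (crossNorm y * lastNorm y);
     y 2 0 / lastNorm y, y 2 1 / lastNorm y, y 2 2 / lastNorm y]

/-- This is the expansion of the determinant along the first row. It forces the last row and the
cross product to be nonzero, so the denominators in `kappaMat` do not vanish on `G`. -/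
theorem det_entries (g : G) : entries g 0 0 * rowCross (entries g) 0 +
    entries g 0 1 * rowCross (entries g) 1 + entries g 0 2 * rowCross (entries g) 2 = 1 := by
  have h := det_mat g
  rw [Matrix.det_fin_three] at h
  simp only [rowCross, entries, cons_val_zero, cons_val_one, cons_val]
  linarith

theorem crossSq_pos (g : G) : 0 < crossSq (entries g) := by
  have h := det_entries g
  unfold crossSq
  by_contra hn
  have h0 : rowCross (entries g) 0 = 0 := by nlinarith [sq_nonneg (rowCross (entries g) 0), sq_nonneg (rowCross (entries g) 1), sq_nonneg (rowCross (entries g) 2)]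
  have h1 : rowCross (entries g) 1 = 0 := by nlinarith [sq_nonneg (rowCross (entries g) 0), sq_nonneg (rowCross (entries g) 1), sq_nonneg (rowCross (entries g) 2)]
  have h2 : rowCross (entries g) 2 = 0 := by nlinarith [sq_nonneg (rowCross (entries g) 0), sq_nonneg (rowCross (entries g) 1), sq_nonneg (rowCross (entries g) 2)]
  simp [h0, h1, h2] at h

theorem lastSq_pos (g : G) : 0 < lastSq (entries g) := by
  have h := det_entries g
  unfold lastSq
  by_contra hn
  have h0 : entries g 2 0 = 0 := by nlinarith [sq_nonneg (entries g 2 0), sq_nonneg (entries g 2 1), sq_nonneg (entries g 2 2)]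
  have h1 : entries g 2 1 = 0 := by nlinarith [sq_nonneg (entries g 2 0), sq_nonneg (entries g 2 1), sq_nonneg (entries g 2 2)]
  have h2 : entries g 2 2 = 0 := by nlinarith [sq_nonneg (entries g 2 0), sq_nonneg (entries g 2 1), sq_nonneg (entries g 2 2)]
  simp [rowCross, h0, h1, h2] at h

theorem crossNorm_pos (g : G) : 0 < crossNorm (entries g) := Real.sqrt_pos.mpr (crossSq_pos g)
theorem lastNorm_pos (g : G) : 0 < lastNorm (entries g) := Real.sqrt_pos.mpr (lastSq_pos g)

theorem crossNorm_sq (g : G) : crossNorm (entries g) ^ 2 = crossSq (entries g) :=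
  Real.sq_sqrt (crossSq_pos g).le

theorem lastNorm_sq (g : G) : lastNorm (entries g) ^ 2 = lastSq (entries g) :=
  Real.sq_sqrt (lastSq_pos g).le

/-- Gram-Schmidt from the bottom: the rows are the normalized vectors `c`, `r × c` and `r`, where
`r` is the last row of `g` and `c ⟂ r` is the cross product of its last two rows. -/
theorem kappaMat_mul_transpose (g : G) :
    kappaMat (entries g) * (kappaMat (entries g))ᵀ = 1 := by
  have ha := crossNorm_sq g
  have hb := lastNorm_sq g
  have ha0 := (crossNorm_pos g).ne'
  have hb0 := (lastNorm_pos g).ne'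
  have hortho : entries g 2 0 * rowCross (entries g) 0 + entries g 2 1 * rowCross (entries g) 1
      + entries g 2 2 * rowCross (entries g) 2 = 0 := by
    simp only [rowCross, cons_val_zero, cons_val_one, cons_val]; ring
  unfold crossSq at ha
  unfold lastSq at hb
  unfold kappaMat
  generalize crossNorm (entries g) = α at *
  generalize lastNorm (entries g) = β at *
  generalize rowCross (entries g) = c at *
  generalize entries g 2 = r at *
  ext i j
  fin_cases i <;> fin_cases j <;>
    simp [Matrix.mul_apply, Fin.sum_univ_three] <;> field_simp
  · linarith
  · ring
  · linarith
  · ring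
  -- Lagrange's identity `|r × c|² = |r|²|c|² - (r·c)²` together with `r·c = 0`.
  · linear_combination (-β ^ 2) * ha - (c 0 ^ 2 + c 1 ^ 2 + c 2 ^ 2) * hb -
      (r 0 * c 0 + r 1 * c 1 + r 2 * c 2) * hortho
  · ring
  · linarith
  · ring
  · linarith

theorem kappaMat_det (g : G) : (kappaMat (entries g)).det = 1 := by
  have ha := crossNorm_sq g
  have hb := lastNorm_sq g
  have ha0 := (crossNorm_pos g).ne'
  have hb0 := (lastNorm_pos g).ne'
  have hortho : entries g 2 0 * rowCross (entries g) 0 + entries g 2 1 * rowCross (entries g) 1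
      + entries g 2 2 * rowCross (entries g) 2 = 0 := by
    simp only [rowCross, cons_val_zero, cons_val_one, cons_val]; ring
  unfold crossSq at ha
  unfold lastSq at hb
  unfold kappaMat
  generalize crossNorm (entries g) = α at *
  generalize lastNorm (entries g) = β at *
  generalize rowCross (entries g) = c at *
  generalize entries g 2 = r at *
  rw [Matrix.det_fin_three]
  simp
  field_simp
  linear_combination (-β ^ 2) * ha - (c 0 ^ 2 + c 1 ^ 2 + c 2 ^ 2) * hb -
      (r 0 * c 0 + r 1 * c 1 + r 2 * c 2) * hortho

/-- The orthogonal factor of the Iwasawa decomposition. -/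
noncomputable def kappa (g : G) : K :=
  ⟨mkG (kappaMat (entries g)) (kappaMat_det g), mul_eq_one_comm.mp (kappaMat_mul_transpose g)⟩

theorem mat_kappa (g : G) : mat (kappa g : G) = kappaMat (entries g) := rfl

/-- The logarithm of the diagonal factor of the Iwasawa decomposition. -/
noncomputable def iwaH (g : G) : a0 :=
  ⟨![-Real.log (crossNorm (entries g)),
    Real.log (crossNorm (entries g)) - Real.log (lastNorm (entries g)),
    Real.log (lastNorm (entries g))], show _ = _ by simp; ring⟩

theorem mat_nElt (u v w : ℝ) : mat (nElt u v w) = !![1, u, v; 0, 1, w; 0, 0, 1] := rfl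

theorem mat_aElt (t : a0) : mat (aElt t) = Matrix.diagonal fun i => Real.exp (t.1 i) := rfl

theorem mat_mElt (ε₁ ε₂ : ℤˣ) : mat (mElt ε₁ ε₂) =
    Matrix.diagonal ![((ε₁ : ℤ) : ℝ), ((ε₂ : ℤ) : ℝ), ((ε₁ : ℤ) : ℝ) * ((ε₂ : ℤ) : ℝ)] := rfl

/-- The product of `g` with the transpose of its orthogonal factor is upper triangular, because `c`
is orthogonal to the last two rows of `g` and `r × c` to the last one. Its diagonal is the
exponential of `iwaH g`. -/
theorem exists_iwasawa (g : G) :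
    ∃ u v w : ℝ, g = nElt u v w * aElt (iwaH g) * (kappa g : G) := by
  have ha0 := (crossNorm_pos g)
  have hb0 := (lastNorm_pos g)
  have ha := crossNorm_sq g
  have hb := lastNorm_sq g
  have hdet := det_entries g
  set B := mat g * (kappaMat (entries g))ᵀ with hB
  have hg : mat g = B * kappaMat (entries g) := by
    rw [hB, Matrix.mul_assoc, mul_eq_one_comm.mp (kappaMat_mul_transpose g), Matrix.mul_one]
  have entry : ∀ i j, B i j = entries g i 0 * kappaMat (entries g) j 0 +
      entries g i 1 * kappaMat (entries g) j 1 + entries g i 2 * kappaMat (entries g) j 2 := by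
    intro i j
    simp [hB, Matrix.mul_apply, Fin.sum_univ_three, entries]
  have b00 : B 0 0 = Real.exp ((iwaH g).1 0) := by
    rw [entry]
    simp only [kappaMat, iwaH, cons_val_zero, cons_val_one, cons_val, Matrix.of_apply, cons_val']
    rw [Real.exp_neg, Real.exp_log ha0]
    field_simp
    linarith
  have b11 : B 1 1 = Real.exp ((iwaH g).1 1) := by
    rw [entry]
    simp only [kappaMat, iwaH, cons_val_zero, cons_val_one, cons_val, Matrix.of_apply, cons_val']
    rw [Real.exp_sub, Real.exp_log ha0, Real.exp_log hb0]
    field_simp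
    rw [ha]
    simp only [crossSq, rowCross, cons_val_zero, cons_val_one, cons_val]
    ring
  have b22 : B 2 2 = Real.exp ((iwaH g).1 2) := by
    rw [entry]
    simp only [kappaMat, iwaH, cons_val, Matrix.of_apply, cons_val']
    rw [Real.exp_log hb0]
    field_simp
    rw [hb]
    simp only [lastSq]
  have b10 : B 1 0 = 0 := by
    rw [entry]
    simp only [kappaMat, cons_val_zero, cons_val_one, cons_val, Matrix.of_apply, cons_val']
    field_simp
    simp only [rowCross, cons_val_zero, cons_val_one, cons_val]
    ring
  have b20 : B 2 0 = 0 := by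
    rw [entry]
    simp only [kappaMat, cons_val_zero, cons_val_one, cons_val, Matrix.of_apply, cons_val']
    field_simp
    simp only [rowCross, cons_val_zero, cons_val_one, cons_val]
    ring
  have b21 : B 2 1 = 0 := by
    rw [entry]
    simp only [kappaMat, cons_val_zero, cons_val_one, cons_val, Matrix.of_apply, cons_val']
    field_simp
    simp only [rowCross, cons_val_zero, cons_val_one, cons_val]
    ring
  -- In `B = n a` the factor `a` scales the columns of `n`, so each entry above the diagonal is
  -- divided by the diagonal entry of its column.
  refine ⟨B 0 1 / Real.exp ((iwaH g).1 1), B 0 2 / Real.exp ((iwaH g).1 2),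
    B 1 2 / Real.exp ((iwaH g).1 2), mat_ext ?_⟩
  rw [mat_mul, mat_mul, mat_nElt, mat_aElt, mat_kappa]
  conv_lhs => rw [hg]
  congr 1
  ext i j
  fin_cases i <;> fin_cases j <;> simp [Matrix.mul_diagonal, b00, b11, b22, b10, b20, b21]

theorem entries_nam_mul (u v w : ℝ) (t : a0) (ε₁ ε₂ : ℤˣ) (g : G) (j : Fin 3) :
    entries (nElt u v w * aElt t * mElt ε₁ ε₂ * g) 1 j =
      Real.exp (t.1 1) * (ε₂ : ℤ) * entries g 1 j
        + w * (Real.exp (t.1 2) * ((ε₁ : ℤ) * (ε₂ : ℤ))) * entries g 2 j ∧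
    entries (nElt u v w * aElt t * mElt ε₁ ε₂ * g) 2 j =
      Real.exp (t.1 2) * ((ε₁ : ℤ) * (ε₂ : ℤ)) * entries g 2 j := by
  simp only [entries, mat_mul, mat_nElt, mat_aElt, mat_mElt]
  constructor <;>
    simp [Matrix.mul_apply, Fin.sum_univ_three, Matrix.vecMul_diagonal]

theorem units_sq (ε : ℤˣ) : ((ε : ℤ) : ℝ) ^ 2 = 1 := by
  rcases Int.units_eq_one_or ε with rfl | rfl <;> simp

/-- Adding a multiple of the third row to the second does not change their cross product. The
remaining factor is `e^{t₂+t₃} ε₁ ε₂²`, simplified by `t₁ + t₂ + t₃ = 0` and `ε₂² = 1`. -/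
theorem rowCross_nam_mul (u v w : ℝ) (t : a0) (ε₁ ε₂ : ℤˣ) (g : G) (j : Fin 3) :
    rowCross (entries (nElt u v w * aElt t * mElt ε₁ ε₂ * g)) j =
      Real.exp (-t.1 0) * (ε₁ : ℤ) * rowCross (entries g) j := by
  have ht : t.1 0 + t.1 1 + t.1 2 = 0 := t.2
  have he : Real.exp (-t.1 0) = Real.exp (t.1 1) * Real.exp (t.1 2) := by
    rw [← Real.exp_add]; congr 1; linarith
  have h := entries_nam_mul u v w t ε₁ ε₂ g
  have h2 := units_sq ε₂
  rw [he]
  fin_cases j <;> simp only [rowCross, h, Fin.zero_eta, Fin.mk_one, Fin.reduceFinMk, cons_val_zero,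
    cons_val_one, cons_val] <;> ring_nf <;> simp only [h2] <;> ring

theorem crossNorm_nam_mul (u v w : ℝ) (t : a0) (ε₁ ε₂ : ℤˣ) (g : G) :
    crossNorm (entries (nElt u v w * aElt t * mElt ε₁ ε₂ * g)) =
      Real.exp (-t.1 0) * crossNorm (entries g) := by
  have : crossSq (entries (nElt u v w * aElt t * mElt ε₁ ε₂ * g)) =
      (Real.exp (-t.1 0)) ^ 2 * crossSq (entries g) := by
    simp only [crossSq, rowCross_nam_mul, mul_pow, units_sq]; ring
  rw [crossNorm, this, Real.sqrt_mul (sq_nonneg _), Real.sqrt_sq (Real.exp_pos _).le, crossNorm]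

theorem lastNorm_nam_mul (u v w : ℝ) (t : a0) (ε₁ ε₂ : ℤˣ) (g : G) :
    lastNorm (entries (nElt u v w * aElt t * mElt ε₁ ε₂ * g)) =
      Real.exp (t.1 2) * lastNorm (entries g) := by
  have : lastSq (entries (nElt u v w * aElt t * mElt ε₁ ε₂ * g)) =
      (Real.exp (t.1 2)) ^ 2 * lastSq (entries g) := by
    simp only [lastSq, entries_nam_mul, mul_pow, units_sq]; ring
  rw [lastNorm, this, Real.sqrt_mul (sq_nonneg _), Real.sqrt_sq (Real.exp_pos _).le, lastNorm]

theorem iwaH_nam_mul (u v w : ℝ) (t : a0) (ε₁ ε₂ : ℤˣ) (g : G) :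
    iwaH (nElt u v w * aElt t * mElt ε₁ ε₂ * g) = t + iwaH g := by
  have ht : t.1 0 + t.1 1 + t.1 2 = 0 := t.2
  have ha0 := (crossNorm_pos g).ne'
  have hb0 := (lastNorm_pos g).ne'
  apply Subtype.ext
  ext i
  fin_cases i <;> simp [iwaH, crossNorm_nam_mul, lastNorm_nam_mul,
    Real.log_mul (Real.exp_ne_zero _) ha0, Real.log_mul (Real.exp_ne_zero _) hb0] <;> linarith

/-- The elements of `M₀`, as elements of `K`. -/
def mK (ε₁ ε₂ : ℤˣ) : K := ⟨mElt ε₁ ε₂, by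
  change _ = _
  rw [mat_mElt, Matrix.diagonal_transpose, Matrix.diagonal_mul_diagonal, ← Matrix.diagonal_one]
  congr 1
  ext i
  fin_cases i <;> simp [← sq, mul_pow, units_sq]⟩

theorem mK_coe (ε₁ ε₂ : ℤˣ) : (mK ε₁ ε₂ : G) = mElt ε₁ ε₂ := rfl

/-- Normalizing the rows removes the positive scalars coming from `A₀` and keeps the signs coming
from `M₀`. -/
theorem kappa_nam_mul (u v w : ℝ) (t : a0) (ε₁ ε₂ : ℤˣ) (g : G) :
    kappa (nElt u v w * aElt t * mElt ε₁ ε₂ * g) = mK ε₁ ε₂ * kappa g := by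
  have ha0 := (crossNorm_pos g).ne'
  have hb0 := (lastNorm_pos g).ne'
  have he0 := (Real.exp_pos (-t.1 0)).ne'
  have he2 := (Real.exp_pos (t.1 2)).ne'
  have h1 := units_sq ε₁
  apply Subtype.ext; apply mat_ext
  rw [Subgroup.coe_mul, mat_mul, mat_kappa, mat_kappa, mK_coe, mat_mElt]
  ext i j
  rw [Matrix.diagonal_mul]
  fin_cases i <;> fin_cases j <;> simp [kappaMat, rowCross_nam_mul, crossNorm_nam_mul,
    lastNorm_nam_mul, entries_nam_mul] <;> field_simp <;> ring_nf <;> simp only [h1] <;> ring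

theorem K_mul_transpose (k : K) : mat (k : G) * (mat (k : G))ᵀ = 1 := mul_eq_one_comm.mp k.2

/-- For a rotation the adjugate equals the transpose, so each row is the cross product of the two
others in cyclic order. -/
theorem rowCross_K (k : K) (j : Fin 3) : rowCross (entries (k : G)) j = mat (k : G) 0 j := by
  have h : (mat (k : G)).adjugate = (mat (k : G))ᵀ := by
    calc (mat (k : G)).adjugate = (mat (k : G))ᵀ * (mat (k : G) * (mat (k : G)).adjugate) := by
          rw [← Matrix.mul_assoc, show (mat (k : G))ᵀ * mat (k : G) = 1 from k.2, Matrix.one_mul]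
      _ = _ := by rw [Matrix.mul_adjugate, det_mat, one_smul, Matrix.mul_one]
  have h0 := congrFun (congrFun h j) 0
  rw [Matrix.transpose_apply, Matrix.adjugate_fin_three] at h0
  rw [← h0]
  fin_cases j <;> simp [rowCross, entries] <;> ring

theorem crossNorm_K (k : K) : crossNorm (entries (k : G)) = 1 := by
  have h := congrFun (congrFun (K_mul_transpose k) 0) 0
  simp [Matrix.mul_apply, Fin.sum_univ_three] at h
  have : crossSq (entries (k : G)) = 1 := by
    simp only [crossSq, rowCross_K]; linarith
  rw [crossNorm, this, Real.sqrt_one]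

theorem lastNorm_K (k : K) : lastNorm (entries (k : G)) = 1 := by
  have h := congrFun (congrFun (K_mul_transpose k) 2) 2
  simp [Matrix.mul_apply, Fin.sum_univ_three] at h
  have : lastSq (entries (k : G)) = 1 := by
    simp only [lastSq, entries]; linarith
  rw [lastNorm, this, Real.sqrt_one]

theorem iwaH_K (k : K) : iwaH (k : G) = 0 := by
  apply Subtype.ext
  ext i
  fin_cases i <;> simp [iwaH, crossNorm_K, lastNorm_K]

theorem nElt_zero : nElt 0 0 0 = 1 := by
  apply mat_ext
  ext i j
  fin_cases i <;> fin_cases j <;> simp [mat_nElt]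

theorem aElt_zero : aElt 0 = 1 := by
  apply mat_ext
  simp [mat_aElt]

theorem mElt_one : mElt 1 1 = 1 := by
  apply mat_ext
  rw [mat_mElt, mat_one, ← Matrix.diagonal_one]
  congr 1
  ext i
  fin_cases i <;> simp

theorem mK_one : mK 1 1 = 1 := Subtype.ext mElt_one

theorem kappa_K (k : K) : kappa (k : G) = k := by
  have horth := K_mul_transpose k
  have h : (mat (k : G)).adjugate = (mat (k : G))ᵀ := by
    calc (mat (k : G)).adjugate = (mat (k : G))ᵀ * (mat (k : G) * (mat (k : G)).adjugate) := by
          rw [← Matrix.mul_assoc, show (mat (k : G))ᵀ * mat (k : G) = 1 from k.2, Matrix.one_mul]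
      _ = _ := by rw [Matrix.mul_adjugate, det_mat, one_smul, Matrix.mul_one]
  rw [Matrix.adjugate_fin_three] at h
  have e0 := congrFun (congrFun h 0) 1
  have e1 := congrFun (congrFun h 1) 1
  have e2 := congrFun (congrFun h 2) 1
  simp at e0 e1 e2
  apply Subtype.ext; apply mat_ext
  rw [mat_kappa]
  ext i j
  fin_cases i <;> fin_cases j <;> simp [kappaMat, rowCross_K, crossNorm_K, lastNorm_K, entries]
  · linarith
  · linarith
  · linarith

/-- Right translation by `K` only changes the last factor of `g = n a κ(g)`, so the left
equivariance already known applies to `n a (κ(g) k)`. -/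
theorem kappa_mul (g : G) (k : K) : kappa (g * k) = kappa g * k := by
  obtain ⟨u, v, w, h⟩ := exists_iwasawa g
  have e : g * k = nElt u v w * aElt (iwaH g) * mElt 1 1 * ((kappa g * k : K) : G) := by
    rw [mElt_one, mul_one, Subgroup.coe_mul, ← mul_assoc, ← h]
  rw [e, kappa_nam_mul, kappa_K, mK_one, one_mul]

theorem iwaH_mul (g : G) (k : K) : iwaH (g * k) = iwaH g := by
  obtain ⟨u, v, w, h⟩ := exists_iwasawa g
  have e : g * k = nElt u v w * aElt (iwaH g) * mElt 1 1 * ((kappa g * k : K) : G) := by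
    rw [mElt_one, mul_one, Subgroup.coe_mul, ← mul_assoc, ← h]
  rw [e, iwaH_nam_mul, iwaH_K, add_zero]

theorem charM_one (σ : Fin 2 × Fin 2) : charM σ 1 1 = 1 := by simp [charM]

theorem apply_eq_kappa {ν : a0 →ₗ[ℝ] ℂ} {σ : Fin 2 × Fin 2} {f : G → ℂ} (hf : f ∈ Hinf ν σ)
    (g : G) : f g = Complex.exp ((ν + rho0) (iwaH g)) * f (kappa g) := by
  obtain ⟨u, v, w, h⟩ := exists_iwasawa g
  have := hf.2 u v w (iwaH g) 1 1 (kappa g)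
  rwa [mElt_one, mul_one, ← h, charM_one, mul_one] at this

/-- Uniqueness in the definition of `s(l; p, q)`: once a preimage exists, the choice made by
`Function.invFun` in `s` is forced. -/
theorem restrictK_injective (ν : a0 →ₗ[ℝ] ℂ) (σ : Fin 2 × Fin 2) :
    Function.Injective (restrictK ν σ) := by
  intro f f' h
  apply Subtype.ext
  ext g
  rw [apply_eq_kappa f.2.1, apply_eq_kappa f'.2.1]
  congr 1
  exact congrFun h (kappa g)

end SL3

namespace SL3
open Matrix

/-! ### Frobenius reciprocity for the principal series -/

theorem linear_a0_apply (μ : a0 →ₗ[ℝ] ℂ) (t : a0) :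
    μ t = (t.1 0 : ℂ) * μ H₁ + (t.1 1 : ℂ) * μ H₂ := by
  have ht : t.1 0 + t.1 1 + t.1 2 = 0 := t.2
  have e : t = t.1 0 • H₁ + t.1 1 • H₂ := by
    apply Subtype.ext
    ext i
    fin_cases i <;> simp [H₁, H₂]
    linarith
  conv_lhs => rw [e]
  rw [map_add, map_smul, map_smul, Complex.real_smul, Complex.real_smul]

/-- The functionals on `V_{2l}` which transform under `M₀` by the character `σ₀`. -/
noncomputable def equivariantDual (σ : Fin 2 × Fin 2) (l : ℤ) :
    Submodule ℂ (Module.Dual ℂ (V (2 * l))) where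
  carrier := {ψ | ∀ ε₁ ε₂ v, ψ (tau l (mK ε₁ ε₂) v) = charM σ ε₁ ε₂ * ψ v}
  add_mem' := by
    intro ψ ψ' h h' ε₁ ε₂ v
    rw [LinearMap.add_apply, LinearMap.add_apply, h, h', mul_add]
  zero_mem' := by intro ε₁ ε₂ v; simp
  smul_mem' := by
    intro c ψ h ε₁ ε₂ v
    rw [LinearMap.smul_apply, LinearMap.smul_apply, h, smul_eq_mul, smul_eq_mul]; ring

/-- The extension to `G` of the matrix coefficient `x ↦ ψ(τ(x) v)`. -/
noncomputable def frobFun (ν : a0 →ₗ[ℝ] ℂ) (l : ℤ) (ψ : Module.Dual ℂ (V (2 * l))) :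
    V (2 * l) →ₗ[ℂ] (G → ℂ) where
  toFun v g := Complex.exp ((ν + rho0) (iwaH g)) * ψ (tau l (kappa g) v)
  map_add' v v' := by ext g; simp [mul_add]
  map_smul' c v := by ext g; simp [mul_left_comm]

theorem frobFun_apply (ν : a0 →ₗ[ℝ] ℂ) (l : ℤ) (ψ : Module.Dual ℂ (V (2 * l))) (v : V (2 * l))
    (g : G) : frobFun ν l ψ v g = Complex.exp ((ν + rho0) (iwaH g)) * ψ (tau l (kappa g) v) := rfl

/-- The Iwasawa factors are given by square roots, logarithms and quotients that make sense on an
open set of matrices, and the matrix coefficient of `τ_{2l}` is the restriction of a smooth function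
on all matrices. -/
theorem isSmooth_frobFun (ν : a0 →ₗ[ℝ] ℂ) {l : ℤ} (hl : 0 ≤ l) (ψ : Module.Dual ℂ (V (2 * l)))
    (v : V (2 * l)) : IsSmooth (frobFun ν l ψ v) := by
  obtain ⟨P, hP, hPe⟩ := exists_contDiff_matrixCoeff hl ψ v
  have hc : ∀ j, ContDiff ℝ ∞ fun y => rowCross y j := by
    intro j
    fin_cases j <;> simp only [rowCross, Fin.zero_eta, Fin.mk_one, Fin.reduceFinMk, cons_val_zero,
      cons_val_one, cons_val] <;> fun_prop
  have hcs : ContDiff ℝ ∞ crossSq := by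
    unfold crossSq
    exact (((hc 0).pow 2).add ((hc 1).pow 2)).add ((hc 2).pow 2)
  have hls : ContDiff ℝ ∞ lastSq := by unfold lastSq; fun_prop
  intro g
  -- This set does not depend on `g` and contains all of `SL(3, ℝ)`.
  let U : Set (Fin 3 → Fin 3 → ℝ) := {y | 0 < crossSq y} ∩ {y | 0 < lastSq y}
  have hcn : ContDiffOn ℝ ∞ crossNorm U :=
    hcs.contDiffOn.sqrt fun y hy => (show 0 < crossSq y from hy.1).ne'
  have hln : ContDiffOn ℝ ∞ lastNorm U :=
    hls.contDiffOn.sqrt fun y hy => (show 0 < lastSq y from hy.2).ne'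
  have hcn0 : ∀ y ∈ U, crossNorm y ≠ 0 := fun y hy => (Real.sqrt_pos.mpr hy.1).ne'
  have hln0 : ∀ y ∈ U, lastNorm y ≠ 0 := fun y hy => (Real.sqrt_pos.mpr hy.2).ne'
  have hy : ∀ i j, ContDiffOn ℝ ∞ (fun y : Fin 3 → Fin 3 → ℝ => y i j) U := by
    intro i j; fun_prop
  have hk : ContDiffOn ℝ ∞ (fun y : Fin 3 → Fin 3 → ℝ => fun i j => kappaMat y i j) U := by
    rw [contDiffOn_pi]; intro i
    rw [contDiffOn_pi]; intro j
    have hc' := fun j => (hc j).contDiffOn (s := U)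
    have hm := fun y h => mul_ne_zero (hcn0 y h) (hln0 y h)
    fin_cases i <;> fin_cases j <;>
      simp only [kappaMat, Fin.zero_eta, Fin.mk_one, Fin.reduceFinMk, cons_val_zero,
        cons_val_one, cons_val, Matrix.of_apply, cons_val']
    · exact (hc' 0).div hcn hcn0
    · exact (hc' 1).div hcn hcn0
    · exact (hc' 2).div hcn hcn0
    · exact (((hy 2 1).mul (hc' 2)).sub ((hy 2 2).mul (hc' 1))).div (hcn.mul hln) hm
    · exact (((hy 2 2).mul (hc' 0)).sub ((hy 2 0).mul (hc' 2))).div (hcn.mul hln) hm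
    · exact (((hy 2 0).mul (hc' 1)).sub ((hy 2 1).mul (hc' 0))).div (hcn.mul hln) hm
    · exact (hy 2 0).div hln hln0
    · exact (hy 2 1).div hln hln0
    · exact (hy 2 2).div hln hln0
  refine ⟨U, (isOpen_lt continuous_const hcs.continuous).inter
    (isOpen_lt continuous_const hls.continuous), ⟨crossSq_pos g, lastSq_pos g⟩,
    fun y => Complex.exp (((-Real.log (crossNorm y) : ℝ) : ℂ) * (ν + rho0) H₁ +
      ((Real.log (crossNorm y) - Real.log (lastNorm y) : ℝ) : ℂ) * (ν + rho0) H₂) *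
      P (fun i j => kappaMat y i j), ?_, fun h _ => ?_⟩
  · have h1 := hcn.log hcn0
    have h2 := hln.log hln0
    have ofReal : ∀ {f : (Fin 3 → Fin 3 → ℝ) → ℝ}, ContDiffOn ℝ ∞ f U →
        ContDiffOn ℝ ∞ (fun y => (f y : ℂ)) U := fun hf =>
      Complex.ofRealCLM.contDiff.comp_contDiffOn hf
    exact (((ofReal h1.neg).mul contDiffOn_const).add
      ((ofReal (h1.sub h2)).mul contDiffOn_const)).cexp.mul (hP.comp_contDiffOn hk)
  · rw [frobFun_apply, hPe, linear_a0_apply]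
    rfl

theorem rightReg_frobFun (ν : a0 →ₗ[ℝ] ℂ) (l : ℤ) (ψ : Module.Dual ℂ (V (2 * l)))
    (v : V (2 * l)) (k : K) : rightReg (k : G) (frobFun ν l ψ v) = frobFun ν l ψ (tau l k v) := by
  ext g
  rw [rightReg_apply, frobFun_apply, frobFun_apply, kappa_mul, iwaH_mul, map_mul]
  rfl

theorem frobFun_mem_HK (ν : a0 →ₗ[ℝ] ℂ) {σ : Fin 2 × Fin 2} {l : ℤ} (hl : 0 ≤ l)
    {ψ : Module.Dual ℂ (V (2 * l))} (hψ : ψ ∈ equivariantDual σ l) (v : V (2 * l)) :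
    frobFun ν l ψ v ∈ HK ν σ := by
  refine ⟨⟨isSmooth_frobFun ν hl ψ v, fun a b c t ε₁ ε₂ x => ?_⟩, ?_⟩
  · rw [frobFun_apply, frobFun_apply, kappa_nam_mul, iwaH_nam_mul, map_mul]
    change _ * ψ (tau l (mK ε₁ ε₂) (tau l (kappa x) v)) = _
    rw [hψ, map_add, Complex.exp_add]
    ring
  · refine Submodule.finiteDimensional_of_le (S₂ := LinearMap.range (frobFun ν l ψ)) ?_
    refine Submodule.span_le.mpr ?_
    rintro _ ⟨k, rfl⟩
    exact ⟨_, (rightReg_frobFun ν l ψ v k).symm⟩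

theorem piK_coe {ν : a0 →ₗ[ℝ] ℂ} {σ : Fin 2 × Fin 2} (k : K) (f : HK ν σ) :
    (piK ν σ k f).1 = rightReg (k : G) f.1 := rfl

/-- The `K`-homomorphism into the principal series attached to an equivariant functional. -/
noncomputable def frob (ν : a0 →ₗ[ℝ] ℂ) {σ : Fin 2 × Fin 2} {l : ℤ} (hl : 0 ≤ l)
    {ψ : Module.Dual ℂ (V (2 * l))} (hψ : ψ ∈ equivariantDual σ l) :
    (tau l).IntertwiningMap (piK ν σ) :=
  LinearMap.intertwiningMap_of_isIntertwiningMap _ _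
    ((frobFun ν l ψ).codRestrict (HK ν σ) (frobFun_mem_HK ν hl hψ)) fun k v => by
      apply Subtype.ext
      exact (rightReg_frobFun ν l ψ v k).symm

/-- The value at the identity of a `K`-homomorphism into the principal series. -/
noncomputable def evalOne (ν : a0 →ₗ[ℝ] ℂ) (σ : Fin 2 × Fin 2) (l : ℤ) :
    (tau l).IntertwiningMap (piK ν σ) →ₗ[ℂ] Module.Dual ℂ (V (2 * l)) where
  toFun η := LinearMap.proj 1 ∘ₗ (HK ν σ).subtype ∘ₗ η.toLinearMap
  map_add' _ _ := rfl
  map_smul' _ _ := rfl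

theorem evalOne_apply {ν : a0 →ₗ[ℝ] ℂ} {σ : Fin 2 × Fin 2} {l : ℤ}
    (η : (tau l).IntertwiningMap (piK ν σ)) (v : V (2 * l)) :
    evalOne ν σ l η v = (η.toLinearMap v).1 1 := rfl

theorem apply_K {ν : a0 →ₗ[ℝ] ℂ} {σ : Fin 2 × Fin 2} {l : ℤ}
    (η : (tau l).IntertwiningMap (piK ν σ)) (v : V (2 * l)) (k : K) :
    (η.toLinearMap v).1 k = evalOne ν σ l η (tau l k v) := by
  have h : η.toLinearMap (tau l k v) = piK ν σ k (η.toLinearMap v) :=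
    Representation.IntertwiningMap.isIntertwining _ _ η k v
  rw [evalOne_apply, h, piK_coe, rightReg_apply, one_mul]

/-- By equivariance the value of `η(v)` at `k` is the value of `η(τ(k)v)` at the identity, and a
function in `H_K` is determined on `K`. -/
theorem evalOne_injective (ν : a0 →ₗ[ℝ] ℂ) (σ : Fin 2 × Fin 2) (l : ℤ) :
    Function.Injective (evalOne ν σ l) := by
  intro η η' h
  apply Representation.IntertwiningMap.ext
  apply LinearMap.ext
  intro v
  apply restrictK_injective
  ext k
  change (η.toLinearMap v).1 k = (η'.toLinearMap v).1 k
  rw [apply_K, apply_K, h]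

/-- For `m ∈ M₀ ⊂ K`, right translation by `m` evaluated at the identity is also left translation by
`m`, which acts by `σ₀`. -/
theorem evalOne_mem {ν : a0 →ₗ[ℝ] ℂ} {σ : Fin 2 × Fin 2} {l : ℤ}
    (η : (tau l).IntertwiningMap (piK ν σ)) : evalOne ν σ l η ∈ equivariantDual σ l := by
  intro ε₁ ε₂ v
  rw [← apply_K, evalOne_apply, mK_coe]
  have := (η.toLinearMap v).2.1.2 0 0 0 0 ε₁ ε₂ 1
  rw [nElt_zero, aElt_zero, one_mul, one_mul, mul_one, map_zero, Complex.exp_zero, one_mul] at this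
  exact this

theorem evalOne_frob (ν : a0 →ₗ[ℝ] ℂ) {σ : Fin 2 × Fin 2} {l : ℤ} (hl : 0 ≤ l)
    {ψ : Module.Dual ℂ (V (2 * l))} (hψ : ψ ∈ equivariantDual σ l) :
    evalOne ν σ l (frob ν hl hψ) = ψ := by
  apply LinearMap.ext
  intro v
  change frobFun ν l ψ v 1 = ψ v
  have h1 : iwaH 1 = 0 := iwaH_K 1
  have h2 : kappa 1 = 1 := kappa_K 1
  rw [frobFun_apply, h1, h2, map_zero, Complex.exp_zero, one_mul, map_one]
  rfl

/-! ### The functionals transforming by a character of `M₀` -/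

/-- The rotation `diag(1, -1, -1)` lifts to `diag(i, -i)`, under which `x^k y^{2l-k}` gets the
factor `(-i)^k i^{2l-k} = i^{2(l-k)}`. -/
theorem tau_mK_vec_neg_right (l k : ℤ) (hk : 0 ≤ k ∧ k ≤ 2 * l) :
    tau l (mK 1 (-1)) (vec (2 * l) k) = (-1 : ℂ) ^ (l - k) • vec (2 * l) k := by
  obtain ⟨x, hx⟩ : ∃ x : SU2, x.1 = !![Complex.I, 0; 0, -Complex.I] := by
    refine ⟨⟨!![Complex.I, 0; 0, -Complex.I], ?_⟩, rfl⟩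
    rw [Matrix.mem_specialUnitaryGroup_iff, Matrix.mem_unitaryGroup_iff]
    constructor
    · ext i j
      fin_cases i <;> fin_cases j <;> simp [Matrix.mul_apply, Fin.sum_univ_two, Matrix.star_apply]
    · simp [Matrix.det_fin_two]
  have hm : spinCover x = mK 1 (-1) := by
    apply Subtype.ext; apply mat_ext
    rw [mat_spinCover, mK_coe, mat_mElt, hx]
    ext i j
    fin_cases i <;> fin_cases j <;> simp [phiMat]
  rw [← hm, tau_spinCover_apply, SU2_inv, hx]
  apply Subtype.ext
  rw [substV_coe, Submodule.coe_smul, vec_coe hk, map_mul, map_pow, map_pow, subst_X, subst_X]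
  simp only [Matrix.of_apply, cons_val', cons_val_zero, cons_val_one, cons_val_fin_one, star_zero,
    neg_zero, MvPolynomial.C_0, zero_mul, add_zero, zero_add, mul_pow]
  obtain ⟨a, rfl⟩ : ∃ a : ℕ, k = a := ⟨k.toNat, by omega⟩
  obtain ⟨b, hb⟩ : ∃ b : ℕ, 2 * l - a = b := ⟨(2 * l - a).toNat, by omega⟩
  have e : (-1 : ℂ) ^ (l - (a : ℤ)) = (star Complex.I) ^ a * Complex.I ^ b := by
    have h1 : (-1 : ℂ) = Complex.I ^ (2 : ℤ) := by
      rw [zpow_ofNat, Complex.I_sq]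
    have h2 : star Complex.I = Complex.I ^ (-1 : ℤ) := by
      rw [_root_.zpow_neg_one, Complex.inv_I]; simp
    rw [h1, h2, ← zpow_natCast, ← zpow_natCast, ← _root_.zpow_mul, ← _root_.zpow_mul,
      ← zpow_add₀ Complex.I_ne_zero]
    congr 1; omega
  rw [hb, e, MvPolynomial.smul_eq_C_mul, map_mul, map_pow, map_pow, Int.toNat_natCast,
    Int.toNat_natCast]
  ring

/-- The rotation `diag(-1, 1, -1)` lifts to the Weyl element, which exchanges `x` and `y` up to
sign. -/
theorem tau_mK_vec_neg_left (l k : ℤ) (hk : 0 ≤ k ∧ k ≤ 2 * l) :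
    tau l (mK (-1) 1) (vec (2 * l) k) = (-1 : ℂ) ^ k • vec (2 * l) (2 * l - k) := by
  obtain ⟨x, hx⟩ : ∃ x : SU2, x.1 = !![0, 1; -1, 0] := by
    refine ⟨⟨!![0, 1; -1, 0], ?_⟩, rfl⟩
    rw [Matrix.mem_specialUnitaryGroup_iff, Matrix.mem_unitaryGroup_iff]
    constructor
    · ext i j
      fin_cases i <;> fin_cases j <;> simp [Matrix.mul_apply, Fin.sum_univ_two, Matrix.star_apply]
    · simp [Matrix.det_fin_two]
  have hm : spinCover x = mK (-1) 1 := by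
    apply Subtype.ext; apply mat_ext
    rw [mat_spinCover, mK_coe, mat_mElt, hx]
    ext i j
    fin_cases i <;> fin_cases j <;> simp [phiMat]
  rw [← hm, tau_spinCover_apply, SU2_inv, hx]
  apply Subtype.ext
  rw [substV_coe, Submodule.coe_smul, vec_coe hk, vec_coe (by omega), map_mul, map_pow, map_pow,
    subst_X, subst_X]
  simp only [Matrix.of_apply, cons_val', cons_val_zero, cons_val_one, cons_val_fin_one, star_zero,
    MvPolynomial.C_0, zero_mul, add_zero, zero_add, mul_pow, star_one, map_one, one_mul,
    map_neg]
  obtain ⟨a, rfl⟩ : ∃ a : ℕ, k = a := ⟨k.toNat, by omega⟩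
  rw [MvPolynomial.smul_eq_C_mul, zpow_natCast, map_pow, map_neg, map_one, sub_sub_cancel,
    Int.toNat_natCast]
  ring

end SL3

namespace SL3
open Matrix

/-! ### Parity and reflection of the equivariant functionals -/

theorem mK_mul (ε₁ ε₂ : ℤˣ) : mK ε₁ ε₂ = mK ε₁ 1 * mK 1 ε₂ := by
  apply Subtype.ext; apply mat_ext
  rw [Subgroup.coe_mul, mat_mul, mK_coe, mK_coe, mK_coe, mat_mElt, mat_mElt, mat_mElt,
    Matrix.diagonal_mul_diagonal]
  congr 1
  ext i
  fin_cases i <;> simp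

/-- It suffices to test the two generators of `M₀` on basis vectors: one acts diagonally and imposes
a parity, the other imposes a reflection symmetry. -/
theorem mem_equivariantDual_iff {σ : Fin 2 × Fin 2} {l : ℤ} (hl : 0 ≤ l)
    {ψ : Module.Dual ℂ (V (2 * l))} :
    ψ ∈ equivariantDual σ l ↔ ∀ k ∈ Finset.Icc 0 (2 * l),
      (-1 : ℂ) ^ (l - k) * ψ (vec (2 * l) k) = (-1) ^ (σ.2 : ℕ) * ψ (vec (2 * l) k) ∧
      (-1 : ℂ) ^ k * ψ (vec (2 * l) (2 * l - k)) = (-1) ^ (σ.1 : ℕ) * ψ (vec (2 * l) k) := by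
  constructor
  · intro h k hk
    have h1 := h 1 (-1) (vec (2 * l) k)
    have h2 := h (-1) 1 (vec (2 * l) k)
    rw [tau_mK_vec_neg_right l k (Finset.mem_Icc.mp hk), map_smul, smul_eq_mul] at h1
    rw [tau_mK_vec_neg_left l k (Finset.mem_Icc.mp hk), map_smul, smul_eq_mul] at h2
    simp only [charM] at h1 h2
    simp at h1 h2
    simp [h1, h2]
  · intro h
    have h1 : ∀ v, ψ (tau l (mK 1 (-1)) v) = (-1) ^ (σ.2 : ℕ) * ψ v := by
      intro v
      have : ψ ∘ₗ tau l (mK 1 (-1)) = ((-1) ^ (σ.2 : ℕ) : ℂ) • ψ := by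
        refine linearMap_ext_vec (by omega) fun k hk => ?_
        rw [LinearMap.comp_apply, tau_mK_vec_neg_right l k (Finset.mem_Icc.mp hk), map_smul,
          smul_eq_mul, (h k hk).1]; rfl
      exact LinearMap.congr_fun this v
    have h2 : ∀ v, ψ (tau l (mK (-1) 1) v) = (-1) ^ (σ.1 : ℕ) * ψ v := by
      intro v
      have : ψ ∘ₗ tau l (mK (-1) 1) = ((-1) ^ (σ.1 : ℕ) : ℂ) • ψ := by
        refine linearMap_ext_vec (by omega) fun k hk => ?_
        rw [LinearMap.comp_apply, tau_mK_vec_neg_left l k (Finset.mem_Icc.mp hk), map_smul,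
          smul_eq_mul, (h k hk).2]; rfl
      exact LinearMap.congr_fun this v
    intro ε₁ ε₂ v
    rw [mK_mul, map_mul, Module.End.mul_apply]
    rcases Int.units_eq_one_or ε₁ with rfl | rfl <;> rcases Int.units_eq_one_or ε₂ with rfl | rfl <;>
      simp [mK_one, h1, h2, charM]
    ring

theorem eps_eq (σ : Fin 2 × Fin 2) (l : ℤ) : (eps σ l : ℤ) = (l - (σ.1 : ℕ) - (σ.2 : ℕ)) % 2 := by
  unfold eps
  omega

theorem neg_one_zpow_eq_pow {a : ℤ} {b : ℕ} (h : a % 2 = (b : ℤ) % 2) :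
    (-1 : ℂ) ^ a = (-1) ^ b := by
  obtain ⟨c, hc⟩ : ∃ c : ℤ, a = b + 2 * c := ⟨(a - b) / 2, by omega⟩
  rw [hc, zpow_add₀ (by norm_num), zpow_natCast, _root_.zpow_mul]
  simp

theorem equivariantDual_apply_eq_zero {σ : Fin 2 × Fin 2} {l : ℤ} (hl : 0 ≤ l)
    {ψ : Module.Dual ℂ (V (2 * l))} (hψ : ψ ∈ equivariantDual σ l) {k : ℤ}
    (hk : k % 2 ≠ (l - (σ.2 : ℕ)) % 2) : ψ (vec (2 * l) k) = 0 := by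
  by_cases h : 0 ≤ k ∧ k ≤ 2 * l
  · have h1 := ((mem_equivariantDual_iff hl).mp hψ k (Finset.mem_Icc.mpr h)).1
    rw [neg_one_zpow_eq_pow (b := (σ.2 : ℕ) + 1) (by push_cast; omega), pow_succ] at h1
    have h2 : ((-1 : ℂ)) ^ (σ.2 : ℕ) ≠ 0 := pow_ne_zero _ (by norm_num)
    have h3 : 2 * ((-1 : ℂ)) ^ (σ.2 : ℕ) * ψ (vec (2 * l) k) = 0 := by linear_combination -h1
    simpa [h2] using h3
  · rw [vec_eq_zero h, map_zero]

/-- On the indices allowed by parity, `(-1)^{k + σ₀₁}` is the constant `(-1)^ε`. On the others both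
values vanish. -/
theorem equivariantDual_apply_reflect {σ : Fin 2 × Fin 2} {l : ℤ} (hl : 0 ≤ l)
    {ψ : Module.Dual ℂ (V (2 * l))} (hψ : ψ ∈ equivariantDual σ l) (k : ℤ) :
    ψ (vec (2 * l) (2 * l - k)) = (-1) ^ eps σ l * ψ (vec (2 * l) k) := by
  by_cases h : 0 ≤ k ∧ k ≤ 2 * l
  · by_cases hk : k % 2 = (l - (σ.2 : ℕ)) % 2
    · have h1 := ((mem_equivariantDual_iff hl).mp hψ k (Finset.mem_Icc.mpr h)).2
      have he := eps_eq σ l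
      rw [neg_one_zpow_eq_pow (b := eps σ l + (σ.1 : ℕ)) (by push_cast; omega), pow_add] at h1
      rcases neg_one_pow_eq_or ℂ (σ.1 : ℕ) with hs | hs <;>
        rcases neg_one_pow_eq_or ℂ (eps σ l) with ht | ht <;> rw [hs, ht] at h1 <;> rw [ht] <;>
        first | linear_combination h1 | linear_combination (-1 : ℂ) * h1
    · rw [equivariantDual_apply_eq_zero hl hψ hk, equivariantDual_apply_eq_zero hl hψ (by omega),
        mul_zero]
  · rw [vec_eq_zero h, vec_eq_zero (by omega), map_zero, mul_zero]

/-- The functional `v^*_{2l-p} + (-1)^ε v^*_p`. -/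
noncomputable def symDual (σ : Fin 2 × Fin 2) (l p : ℤ) : Module.Dual ℂ (V (2 * l)) :=
  dualVec (2 * l) (2 * l - p) + (-1 : ℂ) ^ eps σ l • dualVec (2 * l) p

theorem symDual_vec (σ : Fin 2 × Fin 2) (l p : ℤ) {q : ℤ} (hq : 0 ≤ q ∧ q ≤ 2 * l) :
    symDual σ l p (vec (2 * l) q) =
      (if p = 2 * l - q then 1 else 0) + (-1) ^ eps σ l * (if p = q then 1 else 0) := by
  rw [symDual, LinearMap.add_apply, LinearMap.smul_apply, dualVec_vec hq, dualVec_vec hq,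
    smul_eq_mul]
  congr 1
  exact if_congr (by omega) rfl rfl

theorem symDual_mem {σ : Fin 2 × Fin 2} {l p : ℤ} (hl : 0 ≤ l)
    (hp : p % 2 = (l - (σ.2 : ℕ)) % 2) : symDual σ l p ∈ equivariantDual σ l := by
  rw [mem_equivariantDual_iff hl]
  intro k hk
  have hk' := Finset.mem_Icc.mp hk
  have he := eps_eq σ l
  rw [symDual_vec σ l p hk', symDual_vec σ l p (q := 2 * l - k) (by omega), sub_sub_cancel]
  by_cases h1 : k % 2 = (l - (σ.2 : ℕ)) % 2
  · rw [neg_one_zpow_eq_pow (b := (σ.2 : ℕ)) (by omega),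
      neg_one_zpow_eq_pow (b := eps σ l + (σ.1 : ℕ)) (by push_cast; omega), pow_add]
    refine ⟨rfl, ?_⟩
    have h2 : ((-1 : ℂ)) ^ eps σ l * (-1) ^ eps σ l = 1 := by
      rw [← mul_pow]; norm_num
    linear_combination ((-1 : ℂ) ^ (σ.1 : ℕ) * (if p = 2 * l - k then 1 else 0)) * h2
  · rw [if_neg (by omega), if_neg (by omega)]
    simp

/-- This is why indices `p ≤ l` suffice for a basis, and it is what folds back the last columns of
the matrix of `Γ`. -/
theorem symDual_reflect (σ : Fin 2 × Fin 2) (l p : ℤ) :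
    symDual σ l p = (-1 : ℂ) ^ eps σ l • symDual σ l (2 * l - p) := by
  have h2 : ((-1 : ℂ)) ^ eps σ l * (-1) ^ eps σ l = 1 := by
    rw [← mul_pow]; norm_num
  simp only [symDual, sub_sub_cancel, smul_add, smul_smul, h2, one_smul]
  rw [add_comm]

theorem symDual_eq_zero (σ : Fin 2 × Fin 2) {l p : ℤ} (hp : p < 0) : symDual σ l p = 0 := by
  rw [symDual, dualVec_eq_zero (by omega), dualVec_eq_zero (by omega), smul_zero, add_zero]

/-! ### The index set `Z(σ₀; l)` -/

theorem Z_eq_image (σ : Fin 2 × Fin 2) (l : ℤ) :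
    Z σ l = (Finset.range (((if eps σ l = 0 then l else l - 1) - delta σ l) / 2 + 1).toNat).image
      fun k : ℕ => 2 * (k : ℤ) + delta σ l := by
  ext p
  rw [Z, Finset.mem_filter, Finset.mem_Icc, Finset.mem_image]
  simp only [Finset.mem_range, Int.ModEq, delta]
  generalize (if eps σ l = 0 then l else l - 1) = top
  constructor
  · rintro ⟨h1, h2⟩
    exact ⟨((p - (l - (σ.2 : ℕ)) % 2) / 2).toNat, by omega, by omega⟩
  · rintro ⟨k, hk, rfl⟩
    omega

theorem d_eq (σ : Fin 2 × Fin 2) (l : ℤ) :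
    d σ l = (((if eps σ l = 0 then l else l - 1) - delta σ l) / 2 + 1).toNat := by
  rw [d, Z_eq_image, Finset.card_image_of_injective, Finset.card_range]
  intro a b h
  simpa using h

theorem mem_Z_iff (σ : Fin 2 × Fin 2) (l p : ℤ) :
    p ∈ Z σ l ↔ ∃ k : Fin (d σ l), 2 * ((k : ℕ) : ℤ) + delta σ l = p := by
  rw [Z_eq_image, Finset.mem_image]
  constructor
  · rintro ⟨k, hk, rfl⟩
    rw [Finset.mem_range, ← d_eq] at hk
    exact ⟨⟨k, hk⟩, rfl⟩
  · rintro ⟨k, rfl⟩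
    exact ⟨k, by rw [Finset.mem_range, ← d_eq]; exact k.2, rfl⟩

theorem index_mem_Z (σ : Fin 2 × Fin 2) (l : ℤ) (k : Fin (d σ l)) :
    2 * ((k : ℕ) : ℤ) + delta σ l ∈ Z σ l := (mem_Z_iff ..).mpr ⟨k, rfl⟩

/-- The centre `p = l` is excluded when `ε = 1`, as `symDual σ l l` is then a difference of equal
terms. -/
theorem mem_Z {σ : Fin 2 × Fin 2} {l p : ℤ} : p ∈ Z σ l ↔
    0 ≤ p ∧ p ≤ l ∧ p % 2 = (l - (σ.2 : ℕ)) % 2 ∧ (p = l → eps σ l = 0) := by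
  rw [Z, Finset.mem_filter, Finset.mem_Icc, Int.ModEq]
  have he := eps_eq σ l
  split_ifs with h
  · omega
  · constructor
    · rintro ⟨h1, h2⟩
      exact ⟨by omega, by omega, h2, by omega⟩
    · rintro ⟨h1, h2, h3, h4⟩
      have : p ≠ l := fun e => h (h4 e)
      omega

theorem sum_fin_index (σ : Fin 2 × Fin 2) (l : ℤ) {M : Type*} [AddCommMonoid M] (f : ℤ → M) :
    ∑ k : Fin (d σ l), f (2 * ((k : ℕ) : ℤ) + delta σ l) = ∑ p ∈ Z σ l, f p := by
  refine Finset.sum_bij (fun k _ => 2 * ((k : ℕ) : ℤ) + delta σ l)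
    (fun k _ => index_mem_Z σ l k) (fun k _ k' _ h => Fin.ext (by omega))
    (fun p hp => ?_) (fun _ _ => rfl)
  obtain ⟨k, hk⟩ := (mem_Z_iff ..).mp hp
  exact ⟨k, Finset.mem_univ _, hk⟩

/-- The coordinates of an equivariant functional. -/
noncomputable def symCoord (l : ℤ) (ψ : Module.Dual ℂ (V (2 * l))) (p : ℤ) : ℂ :=
  if p = l then ψ (vec (2 * l) l) / 2 else ψ (vec (2 * l) (2 * l - p))

theorem equivariantDual_eq_sum {σ : Fin 2 × Fin 2} {l : ℤ} (hl : 0 ≤ l)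
    {ψ : Module.Dual ℂ (V (2 * l))} (hψ : ψ ∈ equivariantDual σ l) :
    ψ = ∑ p ∈ Z σ l, symCoord l ψ p • symDual σ l p := by
  refine linearMap_ext_vec (by omega) fun q hq => ?_
  have hq' := Finset.mem_Icc.mp hq
  rw [LinearMap.sum_apply]
  simp only [LinearMap.smul_apply, symDual_vec σ l _ hq', smul_eq_mul]
  have hrefl := equivariantDual_apply_reflect hl hψ q
  have h2 : ((-1 : ℂ)) ^ eps σ l * (-1) ^ eps σ l = 1 := by
    rw [← mul_pow]; norm_num
  by_cases hpar : q % 2 = (l - (σ.2 : ℕ)) % 2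
  swap
  · rw [equivariantDual_apply_eq_zero hl hψ hpar, Finset.sum_eq_zero]
    intro p hp
    rw [mem_Z] at hp
    rw [if_neg (by omega), if_neg (by omega)]
    simp
  rcases lt_trichotomy q l with h | h | h
  · rw [Finset.sum_eq_single q]
    · rw [symCoord, if_neg (by omega), if_neg (by omega), if_pos rfl, hrefl]
      linear_combination (-ψ (vec (2 * l) q)) * h2
    · intro p hp hne
      rw [mem_Z] at hp
      rw [if_neg (by omega), if_neg hne]
      simp
    · intro hn
      exact absurd (mem_Z.mpr ⟨by omega, by omega, hpar, by omega⟩) hn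
  · subst h
    by_cases he : eps σ q = 0
    · rw [Finset.sum_eq_single q]
      -- At the centre both summands of `symDual` coincide and give `2 v_l^*`, whence the half in
      -- `symCoord`.
      · rw [symCoord, if_pos rfl, if_pos (by omega), if_pos rfl, he]
        ring
      · intro p hp hne
        rw [if_neg (by omega), if_neg hne]
        simp
      · intro hn
        exact absurd (mem_Z.mpr ⟨by omega, by omega, hpar, fun _ => he⟩) hn
    · have he1 : eps σ q = 1 := by
        have := eps_eq σ q
        omega
      -- The centre is its own mirror image, so the sign `-1` forces the value there to vanish.
      rw [he1, show 2 * q - q = q by ring] at hrefl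
      rw [Finset.sum_eq_zero]
      · linear_combination (1 / 2 : ℂ) * hrefl
      · intro p hp
        rw [mem_Z] at hp
        have : p ≠ q := fun e => he (hp.2.2.2 e)
        rw [if_neg (by omega), if_neg this]
        simp
  · rw [Finset.sum_eq_single (2 * l - q)]
    · rw [symCoord, if_neg (by omega), if_pos rfl, if_neg (by omega), sub_sub_cancel]
      ring
    · intro p hp hne
      rw [mem_Z] at hp
      rw [if_neg (by omega), if_neg (by omega)]
      simp
    · intro hn
      exact absurd (mem_Z.mpr ⟨by omega, by omega, by omega, by omega⟩) hn

theorem linearIndependent_symDual (σ : Fin 2 × Fin 2) {l : ℤ} :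
    LinearIndependent ℂ fun k : Fin (d σ l) => symDual σ l (2 * ((k : ℕ) : ℤ) + delta σ l) := by
  rw [Fintype.linearIndependent_iff]
  intro g hg k
  have hk := mem_Z.mp (index_mem_Z σ l k)
  -- Evaluation at `v_{2l-p}` isolates the index `p`: two indices at most `l` add up to `2l` only if
  -- both are `l`. The value is `1`, or `2` at the centre.
  have h := LinearMap.congr_fun hg (vec (2 * l) (2 * l - (2 * ((k : ℕ) : ℤ) + delta σ l)))
  rw [LinearMap.sum_apply, Finset.sum_eq_single k] at h
  · rw [LinearMap.smul_apply, symDual_vec _ _ _ (by omega), if_pos (by omega)] at h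
    split_ifs at h with h1
    · rw [hk.2.2.2 (by omega)] at h
      simpa using h
    · simpa using h
  · intro k' _ hne
    have hk' := mem_Z.mp (index_mem_Z σ l k')
    have hne' : (k' : ℕ) ≠ k := fun e => hne (Fin.ext e)
    rw [LinearMap.smul_apply, symDual_vec _ _ _ (by omega), if_neg (by omega), if_neg (by omega)]
    simp
  · simp

/-! ### The induced basis -/

theorem symDual_mem_of_mem_Z {σ : Fin 2 × Fin 2} {l p : ℤ} (hl : 0 ≤ l) (hp : p ∈ Z σ l) :
    symDual σ l p ∈ equivariantDual σ l := symDual_mem hl (mem_Z.mp hp).2.2.1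

theorem restrictK_frob (ν : a0 →ₗ[ℝ] ℂ) {σ : Fin 2 × Fin 2} {l p : ℤ} (hl : 0 ≤ l)
    (hp : symDual σ l p ∈ equivariantDual σ l) (q : ℤ) :
    restrictK ν σ ((frob ν hl hp).toLinearMap (vec (2 * l) q)) = matCoeff σ l p q := by
  ext k
  change ((frob ν hl hp).toLinearMap (vec (2 * l) q)).1 k = _
  rw [apply_K, evalOne_frob]
  rfl

/-- Existence: the homomorphism `frob` built from `symDual` supplies the preimage that makes
`Function.invFun` meaningful. -/
theorem restrictK_s (ν : a0 →ₗ[ℝ] ℂ) {σ : Fin 2 × Fin 2} {l p : ℤ} (hl : 0 ≤ l)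
    (hp : p ∈ Z σ l) (q : ℤ) : restrictK ν σ (s ν σ l p q) = matCoeff σ l p q :=
  Function.invFun_eq ⟨_, restrictK_frob ν hl (symDual_mem_of_mem_Z hl hp) q⟩

theorem s_eq_frob (ν : a0 →ₗ[ℝ] ℂ) {σ : Fin 2 × Fin 2} {l p : ℤ} (hl : 0 ≤ l)
    (hp : p ∈ Z σ l) (q : ℤ) : s ν σ l p q =
      (frob ν hl (symDual_mem_of_mem_Z hl hp)).toLinearMap (vec (2 * l) q) :=
  restrictK_injective ν σ ((restrictK_s ν hl hp q).trans (restrictK_frob ν hl _ q).symm)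

theorem S_eq_frob (ν : a0 →ₗ[ℝ] ℂ) {σ : Fin 2 × Fin 2} {l p : ℤ} (hl : 0 ≤ l)
    (hp : p ∈ Z σ l) : S ν σ l p = (frob ν hl (symDual_mem_of_mem_Z hl hp)).toLinearMap := by
  refine linearMap_ext_vec (by omega) fun q hq => ?_
  rw [S, sum_smulRight_vec (Finset.mem_Icc.mp hq), s_eq_frob ν hl hp]

/-- The columns of the canonical block, as a basis of the space of `K`-homomorphisms. -/
noncomputable def inducedBasis (ν : a0 →ₗ[ℝ] ℂ) (σ : Fin 2 × Fin 2) {l : ℤ} (hl : 0 ≤ l) :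
    Module.Basis (Fin (d σ l)) ℂ ((tau l).IntertwiningMap (piK ν σ)) :=
  Module.Basis.mk (v := fun k => frob ν hl (symDual_mem_of_mem_Z hl (index_mem_Z σ l k)))
    (by
      refine LinearIndependent.of_comp (evalOne ν σ l) ?_
      convert linearIndependent_symDual σ (l := l) using 2 with k
      exact evalOne_frob ν hl _)
    (by
      intro η _
      have h : η = ∑ k : Fin (d σ l), symCoord l (evalOne ν σ l η)
          (2 * ((k : ℕ) : ℤ) + delta σ l) •
            frob ν hl (symDual_mem_of_mem_Z hl (index_mem_Z σ l k)) := by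
        apply evalOne_injective
        rw [map_sum]
        simp only [map_smul, evalOne_frob]
        rw [sum_fin_index σ l fun p => symCoord l (evalOne ν σ l η) p • symDual σ l p]
        exact equivariantDual_eq_sum hl (evalOne_mem η)
      rw [h]
      exact Submodule.sum_mem _ fun k _ => Submodule.smul_mem _ _ (Submodule.subset_span ⟨k, rfl⟩))

theorem inducedBasis_apply (ν : a0 →ₗ[ℝ] ℂ) (σ : Fin 2 × Fin 2) {l : ℤ} (hl : 0 ≤ l)
    (k : Fin (d σ l)) : inducedBasis ν σ hl k =
      frob ν hl (symDual_mem_of_mem_Z hl (index_mem_Z σ l k)) := by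
  simp [inducedBasis]

end SL3

namespace SL3
open Matrix

/-! ### The Lie algebra action at the identity -/

/-- The derivative depends only on the tangent vector, so the exponential curve may be replaced by
any curve convenient for `N₀`, `A₀` or `K`. -/
theorem IsSmooth.hasDerivAt_curve {f : G → ℂ} (hf : IsSmooth f) {γ : ℝ → G} (h0 : γ 0 = 1)
    {X : LieAlgebra.SpecialLinear.sl (Fin 3) ℝ}
    (hγ : ∀ i j, HasDerivAt (fun t => mat (γ t) i j) (X.1 i j) 0) :
    HasDerivAt (fun t => f (γ t)) (SL3.lieDeriv X f 1) 0 := by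
  obtain ⟨U, hU, hg, F, hF, h⟩ := hf 1
  have e : tang X.1 (entries 1) = fun i j => X.1 i j := by
    ext i j
    simp [tang, entries, Matrix.one_apply]
  have hl : SL3.lieDeriv X f 1 = fderiv ℝ F (entries 1) (tang X.1 (entries 1)) :=
    (hasDerivAt_of_local hU hF h X 1 hg).deriv
  have hc : HasDerivAt (fun t => entries (γ t)) (fun i j => X.1 i j) 0 := by
    rw [hasDerivAt_pi]; intro i
    rw [hasDerivAt_pi]; intro j
    exact hγ i j
  have hd : HasFDerivAt F (fderiv ℝ F (entries 1)) (entries (γ 0)) := by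
    rw [h0]
    exact ((hF.contDiffAt (hU.mem_nhds hg)).differentiableAt (by simp)).hasFDerivAt
  rw [hl, e]
  refine (hd.comp_hasDerivAt (0 : ℝ) hc).congr_of_eventuallyEq ?_
  have hm : entries (γ 0) ∈ U := by rw [h0]; exact hg
  filter_upwards [hc.continuousAt.eventually (hU.mem_nhds hm)] with t ht
  exact h _ ht

theorem lieDeriv_nilpotent {ν : a0 →ₗ[ℝ] ℂ} {σ : Fin 2 × Fin 2} {f : G → ℂ} (hf : f ∈ Hinf ν σ)
    {X : LieAlgebra.SpecialLinear.sl (Fin 3) ℝ} {u v w : ℝ}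
    (hX : X.1 = !![0, u, v; 0, 0, w; 0, 0, 0]) : lieDeriv X f 1 = 0 := by
  have h := hf.1.hasDerivAt_curve (γ := fun t => nElt (t * u) (t * v) (t * w)) (X := X)
    (by simp [nElt_zero]) (by
      intro i j
      rw [hX]
      simp only [mat_nElt]
      fin_cases i <;> fin_cases j <;> simp [hasDerivAt_const, hasDerivAt_mul_const])
  have h2 : ∀ t, f (nElt (t * u) (t * v) (t * w)) = f 1 := by
    intro t
    have := hf.2 (t * u) (t * v) (t * w) 0 1 1 1
    rwa [aElt_zero, mElt_one, mul_one, mul_one, mul_one, map_zero, Complex.exp_zero, charM_one,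
      one_mul, one_mul] at this
  simp only [h2] at h
  exact h.unique (hasDerivAt_const _ _)

theorem lieDeriv_diagonal {ν : a0 →ₗ[ℝ] ℂ} {σ : Fin 2 × Fin 2} {f : G → ℂ} (hf : f ∈ Hinf ν σ)
    {X : LieAlgebra.SpecialLinear.sl (Fin 3) ℝ} {t : a0} (hX : X.1 = Matrix.diagonal t.1) :
    lieDeriv X f 1 = (ν + rho0) t * f 1 := by
  have h := hf.1.hasDerivAt_curve (γ := fun u => aElt (u • t)) (X := X)
    (by simp [aElt_zero]) (by
      intro i j
      rw [hX]
      simp only [mat_aElt]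
      by_cases hij : i = j
      · subst hij
        simp only [Matrix.diagonal_apply_eq]
        have h1 : HasDerivAt (fun u : ℝ => u * t.1 i) (t.1 i) 0 := by
          simpa using hasDerivAt_mul_const (t.1 i) (x := (0 : ℝ))
        have := h1.exp
        simpa using this
      · simp only [Matrix.diagonal_apply_ne _ hij]
        exact hasDerivAt_const _ _)
  have h2 : ∀ u : ℝ, f (aElt (u • t)) = Complex.exp ((u : ℂ) * (ν + rho0) t) * f 1 := by
    intro u
    have := hf.2 0 0 0 (u • t) 1 1 1
    rwa [nElt_zero, mElt_one, mul_one, mul_one, one_mul, map_smul, charM_one, mul_one,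
      Complex.real_smul] at this
  simp only [h2] at h
  have h3 : HasDerivAt (fun u : ℝ => (u : ℂ) * (ν + rho0) t) ((ν + rho0) t) 0 := by
    simpa using (Complex.ofRealCLM.hasDerivAt (x := (0 : ℝ))).mul_const ((ν + rho0) t)
  have h4 := (h3.cexp).mul_const (f 1)
  rw [h.unique h4]
  simp

/-- The element `p + q i + r j + s k` of `SU(2)`. -/
def su2 (p q r s : ℝ) (h : p ^ 2 + q ^ 2 + r ^ 2 + s ^ 2 = 1) : SU2 :=
  ⟨!![(⟨p, q⟩ : ℂ), ⟨r, s⟩; ⟨-r, s⟩, ⟨p, -q⟩], by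
    rw [Matrix.mem_specialUnitaryGroup_iff, Matrix.mem_unitaryGroup_iff]
    constructor
    · ext i j
      fin_cases i <;> fin_cases j <;>
        simp [Matrix.mul_apply, Fin.sum_univ_two, Matrix.star_apply, Complex.ext_iff] <;>
        (try constructor) <;> linarith
    · rw [Matrix.det_fin_two]
      simp [Complex.ext_iff]
      constructor <;> linarith⟩

/-- The right side has the shape produced by differentiating a power. At `q = 0` the factor `q`
hides both the missing vector and the truncated exponent. -/
theorem coe_natCast_smul_vec_pred {n q : ℤ} (hq : 0 ≤ q ∧ q ≤ n) :
    (((q : ℂ) • vec n (q - 1) : V n) : MvPolynomial (Fin 2) ℂ) =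
      (q.toNat : MvPolynomial (Fin 2) ℂ) * MvPolynomial.X 0 ^ (q.toNat - 1) * MvPolynomial.X 1 *
        MvPolynomial.X 1 ^ (n - q).toNat := by
  rcases eq_or_lt_of_le hq.1 with h | h
  · subst h; simp
  · obtain ⟨a, rfl⟩ : ∃ a : ℕ, q = a + 1 := ⟨(q - 1).toNat, by omega⟩
    have e : (n - a).toNat = (n - (a + 1)).toNat + 1 := by omega
    rw [Submodule.coe_smul, vec_coe (by omega), add_sub_cancel_right, e,
      MvPolynomial.smul_eq_C_mul]
    have e2 : ((a : ℤ) + 1).toNat = a + 1 := by omega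
    rw [e2]
    simp
    ring

theorem coe_natCast_smul_vec_succ {n q : ℤ} (hq : 0 ≤ q ∧ q ≤ n) :
    (((n - q : ℂ)) • vec n (q + 1) : V n).1 =
      ((n - q).toNat : MvPolynomial (Fin 2) ℂ) * MvPolynomial.X 1 ^ ((n - q).toNat - 1) *
        MvPolynomial.X 0 * MvPolynomial.X 0 ^ q.toNat := by
  rcases eq_or_lt_of_le hq.2 with h | h
  · subst h; simp
  · obtain ⟨a, rfl⟩ : ∃ a : ℕ, n = a + 1 + q := ⟨(n - q - 1).toNat, by omega⟩
    have e : (q + 1).toNat = q.toNat + 1 := by omega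
    have e1 : ((a : ℤ) + 1 + q - (q + 1)).toNat = a := by omega
    have e2 : ((a : ℤ) + 1 + q - q).toNat = a + 1 := by omega
    rw [Submodule.coe_smul, vec_coe (by omega), e, e1, e2, MvPolynomial.smul_eq_C_mul]
    simp
    ring

theorem coe_smul_vec {n q : ℤ} (hq : 0 ≤ q ∧ q ≤ n) (c : ℂ) :
    (c • vec n q : V n).1 = MvPolynomial.C c * (MvPolynomial.X 0 ^ q.toNat *
      MvPolynomial.X 1 ^ (n - q).toNat) := by
  rw [Submodule.coe_smul, vec_coe hq, MvPolynomial.smul_eq_C_mul]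

theorem natCast_mul_pow_pred (p : MvPolynomial (Fin 2) ℂ) (n : ℕ) :
    (n : MvPolynomial (Fin 2) ℂ) * p ^ (n - 1) * p = n * p ^ n := by
  rcases n with _ | n
  · simp
  · rw [Nat.add_sub_cancel, pow_succ]; ring

/-- The differential of `τ_{2l}` on the basis vector `v_q`, in the direction of the rotation with
axis `(a, b, c)` in the coordinates of the Lie algebra of `SU(2)`. -/
noncomputable def dtau (l : ℤ) (a b c : ℝ) (q : ℤ) : V (2 * l) :=
  (2 * a * Complex.I * (l - q)) • vec (2 * l) q -
    (b + c * Complex.I) • ((q : ℂ) • vec (2 * l) (q - 1)) +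
      (b - c * Complex.I) • (((2 * l : ℤ) - q : ℂ) • vec (2 * l) (q + 1))

theorem hasDerivCoeff_subst {l q : ℤ} (hq : 0 ≤ q ∧ q ≤ 2 * l) (a b c : ℝ) :
    HasDerivCoeff (fun t : ℝ =>
      (MvPolynomial.C (Complex.cos t - a * Complex.I * Complex.sin t) * MvPolynomial.X 0 +
        MvPolynomial.C (-((b + c * Complex.I) * Complex.sin t)) * MvPolynomial.X 1) ^ q.toNat *
      (MvPolynomial.C ((b - c * Complex.I) * Complex.sin t) * MvPolynomial.X 0 +
        MvPolynomial.C (Complex.cos t + a * Complex.I * Complex.sin t) * MvPolynomial.X 1) ^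
          (2 * l - q).toNat)
      (dtau l a b c q : V (2 * l)).1 0 := by
  have hcos : HasDerivAt (fun t : ℝ => Complex.cos t) 0 0 := by
    simpa using (Complex.hasDerivAt_cos ((0 : ℝ) : ℂ)).comp_ofReal
  have hsin : HasDerivAt (fun t : ℝ => Complex.sin t) 1 0 := by
    simpa using (Complex.hasDerivAt_sin ((0 : ℝ) : ℂ)).comp_ofReal
  have h1 := HasDerivCoeff.C_mul (hcos.sub (hsin.const_mul (a * Complex.I))) (MvPolynomial.X 0)
  have h2 := HasDerivCoeff.C_mul ((hsin.const_mul (b + c * Complex.I)).neg) (MvPolynomial.X 1)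
  have h3 := HasDerivCoeff.C_mul (hsin.const_mul (b - c * Complex.I)) (MvPolynomial.X 0)
  have h4 := HasDerivCoeff.C_mul (hcos.add (hsin.const_mul (a * Complex.I))) (MvPolynomial.X 1)
  have h := ((h1.add h2).pow q.toNat).mul ((h3.add h4).pow (2 * l - q).toNat)
  refine h.congr ?_
  simp only [dtau, Submodule.coe_add, Submodule.coe_sub, Submodule.coe_smul (b + _ : ℂ),
    Submodule.coe_smul (b - _ : ℂ), coe_smul_vec hq, coe_natCast_smul_vec_pred hq,
    coe_natCast_smul_vec_succ hq, MvPolynomial.smul_eq_C_mul]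
  have e1 := natCast_mul_pow_pred (MvPolynomial.X 0) q.toNat
  have e2 := natCast_mul_pow_pred (MvPolynomial.X 1) (2 * l - q).toNat
  have e3 : (MvPolynomial.C (2 * a * Complex.I * (l - q)) : MvPolynomial (Fin 2) ℂ) =
      MvPolynomial.C (a * Complex.I) * (((2 * l - q).toNat : MvPolynomial (Fin 2) ℂ) -
        (q.toNat : MvPolynomial (Fin 2) ℂ)) := by
    have : (2 * a * Complex.I * (l - q) : ℂ) =
        a * Complex.I * (((2 * l - q).toNat : ℂ) - (q.toNat : ℂ)) := by
      have c1 : (((2 * l - q).toNat : ℕ) : ℂ) = 2 * l - q := by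
        have : (((2 * l - q).toNat : ℕ) : ℤ) = 2 * l - q := by omega
        exact_mod_cast congrArg (Int.cast (R := ℂ)) this
      have c2 : ((q.toNat : ℕ) : ℂ) = q := by
        have : ((q.toNat : ℕ) : ℤ) = q := by omega
        exact_mod_cast congrArg (Int.cast (R := ℂ)) this
      rw [c1, c2]; ring
    rw [this, map_mul, map_sub, map_natCast, map_natCast]
  rw [e3]
  simp only [Complex.ofReal_zero, Complex.cos_zero, Complex.sin_zero, mul_zero, sub_zero, map_one,
    one_mul, neg_zero, map_zero, zero_mul, Pi.sub_apply, Pi.add_apply, Pi.neg_apply, add_zero, zero_add, mul_one, zero_sub, map_neg]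
  linear_combination (-MvPolynomial.C (a * Complex.I) * MvPolynomial.X 1 ^ (2 * l - q).toNat) * e1 +
    (MvPolynomial.C (a * Complex.I) * MvPolynomial.X 0 ^ q.toNat) * e2

/-- The curve is the image under `φ` of `cos t + sin t · u` for the unit imaginary quaternion `u =
(a, b, c)`. The covering doubles angles, hence the factors `2` in `X`. Along it the function is
`ψ(τ(k) v_q)`, whose derivative is that of `τ_{2l}`. -/
theorem lieDeriv_rotation {ν : a0 →ₗ[ℝ] ℂ} {σ : Fin 2 × Fin 2} {l : ℤ} (hl : 0 ≤ l)
    (η : (tau l).IntertwiningMap (piK ν σ)) {q : ℤ} (hq : 0 ≤ q ∧ q ≤ 2 * l) {a b c : ℝ}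
    (habc : a ^ 2 + b ^ 2 + c ^ 2 = 1) {X : LieAlgebra.SpecialLinear.sl (Fin 3) ℝ}
    (hX : X.1 = !![0, -2 * c, 2 * b; 2 * c, 0, -2 * a; -2 * b, 2 * a, 0]) :
    lieDeriv X (η.toLinearMap (vec (2 * l) q)).1 1 = evalOne ν σ l η (dtau l a b c q) := by
  have hn : ∀ t : ℝ, Real.cos t ^ 2 + (a * Real.sin t) ^ 2 + (b * Real.sin t) ^ 2 +
      (c * Real.sin t) ^ 2 = 1 := by
    intro t
    linear_combination Real.sin_sq_add_cos_sq t + Real.sin t ^ 2 * habc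
  let x : ℝ → SU2 := fun t => su2 (Real.cos t) (a * Real.sin t) (b * Real.sin t) (c * Real.sin t)
    (hn t)
  have hx : ∀ t, mat (spinCover (x t) : G) = phiMat (Real.cos t) (a * Real.sin t) (b * Real.sin t)
    (c * Real.sin t) := fun t => rfl
  have h := (η.toLinearMap (vec (2 * l) q)).2.1.1.hasDerivAt_curve
    (γ := fun t => (spinCover (x t) : G)) (X := X)
    (by
      apply mat_ext
      rw [hx]
      ext i j
      fin_cases i <;> fin_cases j <;> simp [phiMat])
    (by
      intro i j
      rw [hX]
      simp only [hx]
      have hcos : HasDerivAt Real.cos 0 0 := by simpa using Real.hasDerivAt_cos 0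
      have hsin : HasDerivAt Real.sin 1 0 := by simpa using Real.hasDerivAt_sin 0
      -- The entries of `φ` are combinations of `cos²`, `sin²` and `cos · sin`, and only the mixed
      -- term has a nonzero derivative at `0`.
      have key : ∀ A B C D E F : ℝ, HasDerivAt (fun t => A * Real.cos t ^ 2 +
          B * Real.sin t ^ 2 + C * (Real.cos t * Real.sin t)) C 0 := by
        intro A B C D E F
        have := (((hcos.pow 2).const_mul A).add ((hsin.pow 2).const_mul B)).add
          ((hcos.mul hsin).const_mul C)
        refine this.congr_deriv ?_
        simp
      fin_cases i <;> fin_cases j <;> simp only [phiMat, Fin.zero_eta, Fin.mk_one, Fin.reduceFinMk,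
        cons_val_zero, cons_val_one, cons_val, Matrix.of_apply, cons_val']
      · convert key 1 (a ^ 2 - b ^ 2 - c ^ 2) 0 0 0 0 using 2; ring
      · convert key 0 (2 * a * b) (-2 * c) 0 0 0 using 2; ring
      · convert key 0 (2 * a * c) (2 * b) 0 0 0 using 2; ring
      · convert key 0 (2 * a * b) (2 * c) 0 0 0 using 2; ring
      · convert key 1 (b ^ 2 - a ^ 2 - c ^ 2) 0 0 0 0 using 2; ring
      · convert key 0 (2 * b * c) (-2 * a) 0 0 0 using 2; ring
      · convert key 0 (2 * a * c) (-2 * b) 0 0 0 using 2; ring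
      · convert key 0 (2 * b * c) (2 * a) 0 0 0 using 2; ring
      · convert key 1 (c ^ 2 - a ^ 2 - b ^ 2) 0 0 0 0 using 2; ring)
  refine h.unique ?_
  -- Expanding in coordinates reduces the claim to derivatives of single coefficients, as provided
  -- by `hasDerivCoeff_subst`.
  have hsum : ∀ v, evalOne ν σ l η v = ∑ j ∈ Finset.Icc 0 (2 * l),
      dualVec (2 * l) j v * evalOne ν σ l η (vec (2 * l) j) := by
    intro v
    conv_lhs => rw [← sum_dualVec_smul_vec (by omega) v]
    simp only [map_sum, map_smul, smul_eq_mul]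
  simp only [apply_K]
  simp only [tau_spinCover_apply]
  rw [hsum]
  have e : (fun t => evalOne ν σ l η (substV (2 * l) ((x t)⁻¹ : SU2).1 (vec (2 * l) q))) =
      fun t => ∑ j ∈ Finset.Icc 0 (2 * l),
        dualVec (2 * l) j (substV (2 * l) ((x t)⁻¹ : SU2).1 (vec (2 * l) q)) *
          evalOne ν σ l η (vec (2 * l) j) := by
    ext t
    rw [hsum]
  rw [e]
  refine HasDerivAt.fun_sum fun j hj => HasDerivAt.mul_const ?_ _
  have eP : ∀ t, (substV (2 * l) ((x t)⁻¹ : SU2).1 (vec (2 * l) q)).1 =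
      (MvPolynomial.C (Complex.cos t - a * Complex.I * Complex.sin t) * MvPolynomial.X 0 +
        MvPolynomial.C (-((b + c * Complex.I) * Complex.sin t)) * MvPolynomial.X 1) ^ q.toNat *
      (MvPolynomial.C ((b - c * Complex.I) * Complex.sin t) * MvPolynomial.X 0 +
        MvPolynomial.C (Complex.cos t + a * Complex.I * Complex.sin t) * MvPolynomial.X 1) ^
          (2 * l - q).toNat := by
    intro t
    rw [substV_coe, vec_coe hq, map_mul, map_pow, map_pow, subst_X, subst_X, SU2_inv]
    have x00 : (x t).1 0 0 = Complex.cos t + a * Complex.I * Complex.sin t := by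
      change (⟨Real.cos t, a * Real.sin t⟩ : ℂ) = _
      rw [Complex.mk_eq_add_mul_I]; push_cast; ring
    have x01 : (x t).1 0 1 = (b + c * Complex.I) * Complex.sin t := by
      change (⟨b * Real.sin t, c * Real.sin t⟩ : ℂ) = _
      rw [Complex.mk_eq_add_mul_I]; push_cast; ring
    have x00' : star ((x t).1 0 0) = Complex.cos t - a * Complex.I * Complex.sin t := by
      change (⟨Real.cos t, -(a * Real.sin t)⟩ : ℂ) = _
      rw [Complex.mk_eq_add_mul_I]; push_cast; ring
    have x01' : star ((x t).1 0 1) = (b - c * Complex.I) * Complex.sin t := by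
      change (⟨b * Real.sin t, -(c * Real.sin t)⟩ : ℂ) = _
      rw [Complex.mk_eq_add_mul_I]; push_cast; ring
    simp only [Matrix.of_apply, cons_val', cons_val_zero, cons_val_one, cons_val_fin_one]
    rw [x00', x01', x00, x01]
  simp only [dualVec_apply (Finset.mem_Icc.mp hj), eP]
  exact hasDerivCoeff_subst hq a b c _

end SL3

namespace SL3
open Matrix

/-! ### The operators `π(X_i)` evaluated at the identity -/

theorem mem_sl_of_trace_eq_zero {A : Matrix (Fin 3) (Fin 3) ℝ} (h : A.trace = 0) :
    A ∈ LieAlgebra.SpecialLinear.sl (Fin 3) ℝ := h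

/-- The infinitesimal Iwasawa decomposition `𝔤 = 𝔫 + 𝔞 + 𝔨`, in which the three summands act at the
identity by zero, by a scalar and by the differential of `τ_{2l}`. -/
theorem lieDeriv_one {ν : a0 →ₗ[ℝ] ℂ} {σ : Fin 2 × Fin 2} {l : ℤ} (hl : 0 ≤ l)
    (η : (tau l).IntertwiningMap (piK ν σ)) {q : ℤ} (hq : 0 ≤ q ∧ q ≤ 2 * l)
    (X : LieAlgebra.SpecialLinear.sl (Fin 3) ℝ) :
    lieDeriv X (η.toLinearMap (vec (2 * l) q)).1 1 =
      ((X.1 0 0 : ℂ) * (ν + rho0) H₁ + (X.1 1 1 : ℂ) * (ν + rho0) H₂ +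
        (X.1 2 1 : ℂ) * (Complex.I * (l - q))) * evalOne ν σ l η (vec (2 * l) q) +
      (X.1 2 0 / 2 - Complex.I * (X.1 1 0 / 2) : ℂ) *
        (q * evalOne ν σ l η (vec (2 * l) (q - 1))) -
      (X.1 2 0 / 2 + Complex.I * (X.1 1 0 / 2) : ℂ) *
        ((2 * l - q) * evalOne ν σ l η (vec (2 * l) (q + 1))) := by
  set f := η.toLinearMap (vec (2 * l) q) with hf
  have htr : X.1 0 0 + X.1 1 1 + X.1 2 2 = 0 := by
    have : X.1.trace = 0 := X.2
    simpa [Matrix.trace, Fin.sum_univ_three] using this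
  let t : a0 := ⟨![X.1 0 0, X.1 1 1, X.1 2 2], htr⟩
  let N : LieAlgebra.SpecialLinear.sl (Fin 3) ℝ :=
    ⟨!![0, X.1 0 1 + X.1 1 0, X.1 0 2 + X.1 2 0; 0, 0, X.1 1 2 + X.1 2 1; 0, 0, 0],
      mem_sl_of_trace_eq_zero (by simp [Matrix.trace, Fin.sum_univ_three])⟩
  let D : LieAlgebra.SpecialLinear.sl (Fin 3) ℝ :=
    ⟨Matrix.diagonal t.1, mem_sl_of_trace_eq_zero (by
      simpa [Matrix.trace, Fin.sum_univ_three, t] using htr)⟩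
  let R : ℝ → ℝ → ℝ → LieAlgebra.SpecialLinear.sl (Fin 3) ℝ := fun a b c =>
    ⟨!![0, -2 * c, 2 * b; 2 * c, 0, -2 * a; -2 * b, 2 * a, 0],
      mem_sl_of_trace_eq_zero (by simp [Matrix.trace, Fin.sum_univ_three])⟩
  -- The entries below the diagonal determine the skew part, and `N` absorbs the error above the
  -- diagonal. The halves undo the doubled angles in `R`.
  have hX : X = N + (D + ((X.1 2 1 / 2) • R 1 0 0 + ((-X.1 2 0 / 2) • R 0 1 0 +
      (X.1 1 0 / 2) • R 0 0 1))) := by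
    apply Subtype.ext
    ext i j
    fin_cases i <;> fin_cases j <;> simp [N, D, R, t]
  have hs := f.2.1.1
  have hN : lieDeriv N f.1 1 = 0 := lieDeriv_nilpotent f.2.1 rfl
  have hD : lieDeriv D f.1 1 = (ν + rho0) t * f.1 1 := lieDeriv_diagonal f.2.1 rfl
  have hR : ∀ a b c : ℝ, a ^ 2 + b ^ 2 + c ^ 2 = 1 →
      lieDeriv (R a b c) f.1 1 = evalOne ν σ l η (dtau l a b c q) := fun a b c h =>
    lieDeriv_rotation hl η hq h rfl
  conv_lhs => rw [hX]
  rw [lieDeriv_add _ _ hs, lieDeriv_add _ _ hs, lieDeriv_add _ _ hs, lieDeriv_add _ _ hs,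
    lieDeriv_smul _ _ hs, lieDeriv_smul _ _ hs, lieDeriv_smul _ _ hs]
  simp only [Pi.add_apply, Pi.smul_apply, smul_eq_mul]
  rw [hN, hD, hR 1 0 0 (by norm_num), hR 0 1 0 (by norm_num), hR 0 0 1 (by norm_num),
    linear_a0_apply]
  have hf1 : f.1 1 = evalOne ν σ l η (vec (2 * l) q) := rfl
  rw [hf1]
  simp only [dtau, map_add, map_sub, map_smul, smul_eq_mul, t, cons_val_zero, cons_val_one]
  push_cast
  ring

theorem piLie_one (ν : a0 →ₗ[ℝ] ℂ) (σ : Fin 2 × Fin 2)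
    (Z : LieAlgebra.SpecialLinear.sl (Fin 3) ℂ) (f : HK ν σ) :
    (piLie ν σ Z f).1 1 = lieDeriv (reSL Z) f.1 1 + Complex.I * lieDeriv (imSL Z) f.1 1 := rfl

/-- Each `X_i` involves a single value of the functional: `X_1` lowers the index, `X_3` raises it,
and the others keep it. In `X_1` and `X_3` the complex combination cancels one of the two
neighbours. -/
theorem piLie_X_one {ν : a0 →ₗ[ℝ] ℂ} {σ : Fin 2 × Fin 2} {l : ℤ} (hl : 0 ≤ l)
    (η : (tau l).IntertwiningMap (piK ν σ)) {q : ℤ} (hq : 0 ≤ q ∧ q ≤ 2 * l) (i : Fin 5) :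
    (piLie ν σ (X i : pC) (η.toLinearMap (vec (2 * l) q))).1 1 =
      ![(ν H₂ + rho0 H₂ + l - q) * evalOne ν σ l η (vec (2 * l) q),
        -(1 / 2) * (q * evalOne ν σ l η (vec (2 * l) (q - 1))),
        -(1 / 3) * ((2 * (ν H₁ + rho0 H₁) - (ν H₂ + rho0 H₂)) *
          evalOne ν σ l η (vec (2 * l) q)),
        -(1 / 2) * ((2 * l - q) * evalOne ν σ l η (vec (2 * l) (q + 1))),
        (ν H₂ + rho0 H₂ - l + q) * evalOne ν σ l η (vec (2 * l) q)] i := by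
  have hI := Complex.I_mul_I
  rw [piLie_one, lieDeriv_one hl η hq, lieDeriv_one hl η hq]
  generalize evalOne ν σ l η (vec (2 * l) q) = A
  generalize evalOne ν σ l η (vec (2 * l) (q - 1)) = B
  generalize evalOne ν σ l η (vec (2 * l) (q + 1)) = C
  fin_cases i <;> simp [X, Xmat, reSL, imSL]
  · linear_combination (-(l - q) * A) * hI
  · linear_combination ((1 / 4) * (q * B) + (1 / 4) * ((2 * l - q) * C)) * hI
  · ring
  · linear_combination ((1 / 4) * (q * B) + (1 / 4) * ((2 * l - q) * C)) * hI
  · linear_combination ((l - q) * A) * hI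

end SL3

namespace SL3
open Matrix

/-! ### Clebsch-Gordan coefficients -/

/-- Formulas valid only for indices in range extend to all indices once multiplied by these
coefficients. -/
theorem A_eq_zero {L m k : ℤ} {i : Fin 5} (hm : -2 ≤ m ∧ m ≤ 2)
    (h : ¬(0 ≤ k + 2 - m - (i : ℕ) ∧ k + 2 - m - (i : ℕ) ≤ L)) : A L m k i = 0 := by
  unfold A
  split_ifs with hk
  swap
  · rfl
  have : aCoef L m k i = 0 := by
    -- Here `t` is the exponent of `y` in `v_k`. The index leaves its range only for `k ≤ 3` or `t ≤
    -- 3`, which leaves finitely many cases, each with a vanishing factor.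
    obtain ⟨t, rfl⟩ : ∃ t, L = k - 2 * m + t := ⟨L + 2 * m - k, by ring⟩
    have ht : 0 ≤ t := by omega
    rcases not_and_or.mp h with h | h
    · have h5 : (i : ℕ) < 5 := i.2
      have hk4 : k ≤ 3 := by omega
      have hk0 := hk.1
      obtain ⟨hm1, hm2⟩ := hm
      clear hk
      interval_cases m <;> fin_cases i <;> simp at h <;> (try omega) <;> interval_cases k <;>
        (try omega) <;> simp [aCoef]
    · have h5 : (i : ℕ) < 5 := i.2
      have ht4 : t ≤ 3 := by omega
      obtain ⟨hm1, hm2⟩ := hm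
      clear hk
      interval_cases m <;> fin_cases i <;> simp at h <;> (try omega) <;> interval_cases t <;>
        (try omega) <;> simp [aCoef] <;> (try ring_nf) <;> (try simp)
  rw [this]
  simp

theorem cast_choose_three (n : ℕ) : 6 * (n.choose 3 : ℂ) = n * (n - 1) * (n - 2) := by
  induction n with
  | zero => simp
  | succ n ih =>
    rw [Nat.choose_succ_succ, Nat.cast_add, mul_add, ih, Nat.cast_choose_two]
    push_cast; ring

theorem cast_choose_four (n : ℕ) : 24 * (n.choose 4 : ℂ) = n * (n - 1) * (n - 2) * (n - 3) := by
  induction n with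
  | zero => simp
  | succ n ih =>
    rw [Nat.choose_succ_succ, Nat.cast_add, mul_add, ih]
    have := cast_choose_three n
    push_cast
    linear_combination 4 * this

/-- The form `u^k (w/u)^s` avoids the truncated exponent `k - s` and fits the integer powers used
later. -/
theorem coeff_linear_pow {u : ℂ} (hu : u ≠ 0) (w : ℂ) (k s : ℕ) :
    ((Polynomial.C u + Polynomial.X * Polynomial.C w) ^ k).coeff s =
      (k.choose s : ℂ) * u ^ k * (w / u) ^ s := by
  have e2 : (Polynomial.C u + Polynomial.X * Polynomial.C w) =
      Polynomial.C u * (Polynomial.X + 1 : Polynomial ℂ).comp (Polynomial.C (w / u) * Polynomial.X)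
      := by
    have : Polynomial.C w = Polynomial.C u * Polynomial.C (w / u) := by
      rw [← Polynomial.C_mul, mul_div_cancel₀ _ hu]
    simp only [Polynomial.add_comp, Polynomial.X_comp, Polynomial.one_comp, this]
    ring
  rw [e2, mul_pow, ← Polynomial.pow_comp, ← Polynomial.C_pow, Polynomial.coeff_C_mul,
    Polynomial.comp_C_mul_X_coeff, Polynomial.coeff_X_add_one_pow]
  ring

/-- The coefficient of `t^s` in `f(a + t b)`. -/
noncomputable def polar (a b : Fin 2 → ℂ) (s : ℕ) : MvPolynomial (Fin 2) ℂ →ₗ[ℂ] ℂ :=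
  Polynomial.lcoeff ℂ s ∘ₗ (MvPolynomial.aeval fun i =>
    Polynomial.C (a i) + Polynomial.X * Polynomial.C (b i)).toLinearMap

theorem polar_subst (M : Matrix (Fin 2) (Fin 2) ℂ) (a b : Fin 2 → ℂ) (s : ℕ)
    (f : MvPolynomial (Fin 2) ℂ) : polar a b s (subst M f) = polar (M *ᵥ a) (M *ᵥ b) s f := by
  have : (MvPolynomial.aeval fun i => Polynomial.C (a i) + Polynomial.X * Polynomial.C (b i)).comp
      (subst M) = MvPolynomial.aeval fun i =>
        Polynomial.C ((M *ᵥ a) i) + Polynomial.X * Polynomial.C ((M *ᵥ b) i) := by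
    apply MvPolynomial.algHom_ext
    intro i
    simp only [AlgHom.comp_apply, subst_X, map_add, map_mul, MvPolynomial.aeval_X,
      Matrix.mulVec, dotProduct, Fin.sum_univ_two, Polynomial.algebraMap_eq, MvPolynomial.algHom_C]
    ring
  simp only [polar, LinearMap.comp_apply, AlgHom.toLinearMap_apply]
  rw [← this]
  rfl

theorem polar_vec {a : Fin 2 → ℂ} (ha0 : a 0 ≠ 0) (ha1 : a 1 ≠ 0) (b : Fin 2 → ℂ) (s : ℕ)
    {n k : ℤ} (hk : 0 ≤ k ∧ k ≤ n) :
    polar a b s (vec n k).1 = a 0 ^ k * a 1 ^ (n - k) * ∑ x ∈ Finset.HasAntidiagonal.antidiagonal s,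
      (k.toNat.choose x.1 : ℂ) * (b 0 / a 0) ^ x.1 *
        (((n - k).toNat.choose x.2 : ℂ) * (b 1 / a 1) ^ x.2) := by
  have e1 : a 0 ^ k = a 0 ^ k.toNat := by
    rw [← zpow_natCast, Int.toNat_of_nonneg hk.1]
  have e2 : a 1 ^ (n - k) = a 1 ^ (n - k).toNat := by
    rw [← zpow_natCast, Int.toNat_of_nonneg (by omega)]
  rw [vec_coe hk, polar, LinearMap.comp_apply, AlgHom.toLinearMap_apply, map_mul, map_pow, map_pow,
    MvPolynomial.aeval_X, MvPolynomial.aeval_X, Polynomial.lcoeff_apply, Polynomial.coeff_mul,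
    Finset.mul_sum, e1, e2]
  refine Finset.sum_congr rfl fun x _ => ?_
  rw [coeff_linear_pow ha0, coeff_linear_pow ha1]
  ring

/-- The left side is the image of `v_k` as a polynomial in the pairs `a` and `b`; the right side is
a transvectant. The factorial clears the binomial denominators of the polarization. -/
theorem clebschGordan_identity {L m k : ℤ} (hm : -2 ≤ m ∧ m ≤ 2) (hk : 0 ≤ k ∧ k ≤ L + 2 * m)
    {a : Fin 2 → ℂ} (ha0 : a 0 ≠ 0) (ha1 : a 1 ≠ 0) (b : Fin 2 → ℂ) :
    ∑ i : Fin 5, A L m k i * (a 0 ^ (k + 2 - m - (i : ℕ)) * a 1 ^ (L - (k + 2 - m - (i : ℕ))) *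
        (b 0 ^ (i : ℕ) * b 1 ^ (4 - (i : ℕ)))) =
      ((2 + m).toNat.factorial : ℂ) / dCoef L m * (a 0 * b 1 - a 1 * b 0) ^ (2 - m).toNat *
        polar a b (2 + m).toNat (vec (L + 2 * m) k).1 := by
  rw [polar_vec ha0 ha1 b _ hk]
  have hpow : ∀ (u : ℂ), u ≠ 0 → ∀ (p q : ℤ), u ^ (p - q) = u ^ p / u ^ q := fun u hu p q =>
    zpow_sub₀ hu p q
  have eL : ∀ i : ℤ, a 0 ^ (k + 2 - m - i) * a 1 ^ (L - (k + 2 - m - i)) =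
      a 0 ^ k * a 1 ^ (L + 2 * m - k) * (a 0 ^ (2 - m - i) * a 1 ^ (i - 2 - m)) := by
    intro i
    rw [show k + 2 - m - i = k + (2 - m - i) by ring,
      show L - (k + (2 - m - i)) = (L + 2 * m - k) + (i - 2 - m) by ring, zpow_add₀ ha0,
      zpow_add₀ ha1]
    ring
  have hA : ∀ i, A L m k i = aCoef L m k i / dCoef L m := fun i => by rw [A, if_pos hk]
  simp only [eL, hA]
  -- After the common monomial is split off, only exponents depending on `m` and `i` remain.
  generalize hu : a 0 ^ k * a 1 ^ (L + 2 * m - k) = u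
  obtain ⟨p, rfl⟩ : ∃ p : ℕ, k = p := ⟨k.toNat, by omega⟩
  -- In terms of the exponents `p` of `x` and `r` of `y` in `v_k`, the numerators are polynomials in
  -- `p` and `r`, directly comparable with the products of binomials. For each `m` a rational
  -- identity is left.
  obtain ⟨r, hr⟩ : ∃ r : ℕ, L = r + p - 2 * m := ⟨(L + 2 * m - p).toNat, by omega⟩
  have er : (L + 2 * m - (p : ℤ)).toNat = r := by omega
  rw [er, Int.toNat_natCast]
  subst hr
  generalize dCoef _ m = D
  have p2 := Nat.cast_choose_two ℂ p
  have r2 := Nat.cast_choose_two ℂ r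
  have p3 := cast_choose_three p
  have r3 := cast_choose_three r
  have p4 := cast_choose_four p
  have r4 := cast_choose_four r
  have p3' : (p.choose 3 : ℂ) = p * (p - 1) * (p - 2) / 6 := by linear_combination p3 / 6
  have r3' : (r.choose 3 : ℂ) = r * (r - 1) * (r - 2) / 6 := by linear_combination r3 / 6
  have p4' : (p.choose 4 : ℂ) = p * (p - 1) * (p - 2) * (p - 3) / 24 := by
    linear_combination p4 / 24
  have r4' : (r.choose 4 : ℂ) = r * (r - 1) * (r - 2) * (r - 3) / 24 := by
    linear_combination r4 / 24
  clear hu eL hA er hpow hk p3 r3 p4 r4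
  generalize a 0 = x at *
  generalize a 1 = y at *
  generalize b 0 = z at *
  generalize b 1 = w at *
  obtain ⟨hm1, hm2⟩ := hm
  interval_cases m
  · simp [Fin.sum_univ_five, aCoef, zpow_ofNat]
    field_simp
    ring
  · simp [Fin.sum_univ_five, aCoef, zpow_ofNat, Finset.Nat.antidiagonal_succ]
    field_simp
    ring
  · simp [Fin.sum_univ_five, aCoef, zpow_ofNat, Finset.Nat.antidiagonal_succ, p2, r2]
    field_simp
    ring
  · simp [Fin.sum_univ_five, aCoef, zpow_ofNat, Finset.Nat.antidiagonal_succ, p2, r2, p3', r3',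
      Nat.factorial]
    field_simp
    ring
  · simp [Fin.sum_univ_five, aCoef, zpow_ofNat, Finset.Nat.antidiagonal_succ, p2, r2, p3', r3',
      p4', r4', Nat.factorial]
    field_simp
    ring

end SL3

namespace SL3
open Matrix
open scoped TensorProduct

/-! ### Equivariance of the injector -/

/-- The quartic form attached to a symmetric matrix. -/
noncomputable def quartic (b : Fin 2 → ℂ) : pC →ₗ[ℂ] ℂ where
  toFun Y := ∑ i, ∑ j, quadVal b i * Y.1.1 i j * quadVal b j
  map_add' Y Y' := by
    simp only [← Finset.sum_add_distrib]
    refine Finset.sum_congr rfl fun i _ => Finset.sum_congr rfl fun j _ => ?_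
    change quadVal b i * (Y.1.1 i j + Y'.1.1 i j) * quadVal b j = _
    ring
  map_smul' c Y := by
    simp only [Finset.mul_sum, RingHom.id_apply, smul_eq_mul]
    refine Finset.sum_congr rfl fun i _ => Finset.sum_congr rfl fun j _ => ?_
    change quadVal b i * (c * Y.1.1 i j) * quadVal b j = _
    ring

theorem quartic_apply (b : Fin 2 → ℂ) (Y : pC) :
    quartic b Y = ∑ i, ∑ j, quadVal b i * Y.1.1 i j * quadVal b j := rfl

/-- This explains the choice of the `X_i`: they correspond to the monomial basis of binary quartics.
-/
theorem quartic_X (b : Fin 2 → ℂ) (i : Fin 5) :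
    quartic b (X i) = b 0 ^ (i : ℕ) * b 1 ^ (4 - (i : ℕ)) := by
  have hI := Complex.I_sq
  rw [quartic_apply]
  fin_cases i <;> simp [X, Xmat, quadVal, Fin.sum_univ_three] <;> ring_nf <;>
    simp only [hI] <;> ring

/-- The value at `(a, b)` of the polynomial in two pairs of variables attached to a tensor. -/
noncomputable def evalPair (n : ℤ) (a b : Fin 2 → ℂ) : V n ⊗[ℂ] pC →ₗ[ℂ] ℂ :=
  TensorProduct.lift ((LinearMap.mul ℂ ℂ).compl₁₂
    ((MvPolynomial.aeval a).toLinearMap ∘ₗ (V n).subtype) (quartic b))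

theorem evalPair_tmul (n : ℤ) (a b : Fin 2 → ℂ) (v : V n) (Y : pC) :
    evalPair n a b (v ⊗ₜ Y) = MvPolynomial.eval a v.1 * quartic b Y := by
  simp [evalPair]

theorem exists_sum_X (Y : pC) : ∃ c : Fin 5 → ℂ, Y = ∑ i, c i • X i := by
  have htr : Y.1.1 0 0 + Y.1.1 1 1 + Y.1.1 2 2 = 0 := by
    have : Y.1.1.trace = 0 := Y.1.2
    simpa [Matrix.trace, Fin.sum_univ_three] using this
  have hsymm : Y.1.1ᵀ = Y.1.1 := Y.2
  have h01 : Y.1.1 1 0 = Y.1.1 0 1 := congrFun (congrFun hsymm 0) 1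
  have h02 : Y.1.1 2 0 = Y.1.1 0 2 := congrFun (congrFun hsymm 0) 2
  have h12 : Y.1.1 2 1 = Y.1.1 1 2 := congrFun (congrFun hsymm 1) 2
  have hI := Complex.I_mul_I
  refine ⟨![(Y.1.1 1 1 + Y.1.1 0 0 / 2 + Complex.I * Y.1.1 1 2) / 2,
    Complex.I * Y.1.1 0 1 - Y.1.1 0 2, -(3 / 2) * Y.1.1 0 0,
    Complex.I * Y.1.1 0 1 + Y.1.1 0 2,
    (Y.1.1 1 1 + Y.1.1 0 0 / 2 - Complex.I * Y.1.1 1 2) / 2], ?_⟩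
  rw [Fin.sum_univ_five]
  apply Subtype.ext; apply Subtype.ext
  ext i j
  change Y.1.1 i j = _ * Xmat 0 i j + _ * Xmat 1 i j + _ * Xmat 2 i j + _ * Xmat 3 i j +
    _ * Xmat 4 i j
  fin_cases i <;> fin_cases j <;> simp [Xmat, h01, h02, h12]
  · ring
  · linear_combination (Y.1.1 0 1) * hI
  · ring
  · linear_combination (Y.1.1 0 1) * hI
  · ring
  · linear_combination (Y.1.1 1 2) * hI
  · ring
  · linear_combination (Y.1.1 1 2) * hI
  · linear_combination htr

theorem exists_sum_tmul_X {n : ℤ} (t : V n ⊗[ℂ] pC) :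
    ∃ v : Fin 5 → V n, t = ∑ i, v i ⊗ₜ X i := by
  induction t with
  | zero => exact ⟨0, by simp⟩
  | tmul v Y =>
    obtain ⟨c, hc⟩ := exists_sum_X Y
    refine ⟨fun i => c i • v, ?_⟩
    rw [hc, TensorProduct.tmul_sum]
    simp only [TensorProduct.tmul_smul, TensorProduct.smul_tmul']
  | add t t' h h' =>
    obtain ⟨v, rfl⟩ := h
    obtain ⟨v', rfl⟩ := h'
    exact ⟨v + v', by simp [TensorProduct.add_tmul, Finset.sum_add_distrib]⟩

/-- The formulas to be compared require nonzero coordinates of `a`. Agreement off the zero set of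
`p` is enough, because polynomials form a domain and multiplication by `p` removes the restriction.
-/
theorem eq_of_evalPair {n : ℤ} {t t' : V n ⊗[ℂ] pC} {p : MvPolynomial (Fin 2) ℂ} (hp : p ≠ 0)
    (h : ∀ a b : Fin 2 → ℂ, MvPolynomial.eval a p ≠ 0 → evalPair n a b t = evalPair n a b t') :
    t = t' := by
  rw [← sub_eq_zero]
  obtain ⟨v, hv⟩ := exists_sum_tmul_X (t - t')
  have h0 : ∀ a b : Fin 2 → ℂ, MvPolynomial.eval a p ≠ 0 →
      ∑ i : Fin 5, MvPolynomial.eval a (v i).1 * (b 0 ^ (i : ℕ) * b 1 ^ (4 - (i : ℕ))) = 0 := by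
    intro a b ha
    have := h a b ha
    rw [← sub_eq_zero, ← map_sub, hv, map_sum] at this
    simpa only [evalPair_tmul, quartic_X] using this
  have h1 : ∀ a : Fin 2 → ℂ, MvPolynomial.eval a p ≠ 0 → ∀ i, MvPolynomial.eval a (v i).1 = 0 := by
    intro a ha
    -- A polynomial of degree at most four in `z`: its five coefficients are recovered by
    -- interpolation from the values at `0, ±1, ±2`.
    have e := fun z => h0 a ![z, 1] ha
    simp only [Fin.sum_univ_five, cons_val_zero, cons_val_one, one_pow, mul_one] at e
    have e0 := e 0
    have e1 := e 1
    have e2 := e (-1)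
    have e3 := e 2
    have e4 := e (-2)
    simp at e0 e1 e2 e3 e4
    intro i
    fin_cases i <;> simp only [Fin.zero_eta, Fin.mk_one, Fin.reduceFinMk]
    · exact e0
    · linear_combination (2 / 3) * e1 - (2 / 3) * e2 - (1 / 12) * e3 + (1 / 12) * e4
    · linear_combination -(5 / 4) * e0 + (2 / 3) * e1 + (2 / 3) * e2 - (1 / 24) * e3 -
        (1 / 24) * e4
    · linear_combination -(1 / 6) * e1 + (1 / 6) * e2 + (1 / 12) * e3 - (1 / 12) * e4
    · linear_combination (1 / 4) * e0 - (1 / 6) * e1 - (1 / 6) * e2 + (1 / 24) * e3 +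
        (1 / 24) * e4
  have h2 : ∀ i, v i = 0 := by
    intro i
    apply Subtype.ext
    have : p * (v i).1 = 0 := by
      apply MvPolynomial.funext
      intro a
      by_cases ha : MvPolynomial.eval a p = 0
      · simp [ha]
      simp [h1 a ha i]
    simpa [hp] using this
  rw [hv]
  simp [h2]

theorem injector_vec {l m k : ℤ} (hk : 0 ≤ k ∧ k ≤ 2 * (l + m)) :
    injector l m (vec (2 * (l + m)) k) =
      ∑ i : Fin 5, A (2 * l) m k i • (vec (2 * l) (k + 2 - m - (i : ℕ)) ⊗ₜ[ℂ] X i) := by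
  rw [injector, sum_smulRight_vec hk]

theorem eval_vec {n k : ℤ} (hk : 0 ≤ k ∧ k ≤ n) {a : Fin 2 → ℂ} :
    MvPolynomial.eval a (vec n k).1 = a 0 ^ k * a 1 ^ (n - k) := by
  rw [vec_coe hk, map_mul, map_pow, map_pow, MvPolynomial.eval_X, MvPolynomial.eval_X,
    ← zpow_natCast, ← zpow_natCast, Int.toNat_of_nonneg hk.1, Int.toNat_of_nonneg (by omega)]

theorem evalPair_injector {l m : ℤ} (hm : -2 ≤ m ∧ m ≤ 2) (hlm : 0 ≤ l + m) {a : Fin 2 → ℂ}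
    (ha0 : a 0 ≠ 0) (ha1 : a 1 ≠ 0) (b : Fin 2 → ℂ) (f : V (2 * (l + m))) :
    evalPair (2 * l) a b (injector l m f) =
      ((2 + m).toNat.factorial : ℂ) / dCoef (2 * l) m *
        (a 0 * b 1 - a 1 * b 0) ^ (2 - m).toNat * polar a b (2 + m).toNat f.1 := by
  have key : evalPair (2 * l) a b ∘ₗ injector l m =
      (((2 + m).toNat.factorial : ℂ) / dCoef (2 * l) m *
        (a 0 * b 1 - a 1 * b 0) ^ (2 - m).toNat) • (polar a b (2 + m).toNat ∘ₗ
          (V (2 * (l + m))).subtype) := by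
    refine linearMap_ext_vec (by omega) fun k hk => ?_
    have hk' := Finset.mem_Icc.mp hk
    rw [LinearMap.comp_apply, injector_vec hk', map_sum, LinearMap.smul_apply,
      LinearMap.comp_apply, Submodule.subtype_apply, smul_eq_mul]
    have e : 2 * l + 2 * m = 2 * (l + m) := by ring
    rw [← e] at hk' ⊢
    rw [← clebschGordan_identity hm hk' ha0 ha1]
    refine Finset.sum_congr rfl fun i _ => ?_
    rw [map_smul, evalPair_tmul, quartic_X, smul_eq_mul]
    by_cases h : 0 ≤ k + 2 - m - (i : ℕ) ∧ k + 2 - m - (i : ℕ) ≤ 2 * l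
    · rw [eval_vec h]
    · rw [A_eq_zero hm h, zero_mul, zero_mul]
  exact LinearMap.congr_fun key f

/-- The adjoint action of `K` on `𝔭_ℂ`. -/
noncomputable def adK (k : K) : pC →ₗ[ℂ] pC where
  toFun Y := ⟨⟨(mat (k : G)).map (algebraMap ℝ ℂ) * Y.1.1 * ((mat (k : G)).map (algebraMap ℝ ℂ))ᵀ, by
      have h : ((mat (k : G)).map (algebraMap ℝ ℂ) * Y.1.1 *
          ((mat (k : G)).map (algebraMap ℝ ℂ))ᵀ).trace = 0 := by
        have hk : (mat (k : G))ᵀ * mat (k : G) = 1 := k.2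
        have hY : Y.1.1.trace = 0 := Y.1.2
        rw [Matrix.trace_mul_comm, ← Matrix.mul_assoc, ← Matrix.transpose_map, ← Matrix.map_mul, hk]
        simpa using hY
      exact h⟩, by
    have hY : Y.1.1ᵀ = Y.1.1 := Y.2
    change (_ * _ * _)ᵀ = _ * _ * _
    rw [Matrix.transpose_mul, Matrix.transpose_mul, hY, Matrix.transpose_transpose,
      Matrix.mul_assoc]⟩
  map_add' Y Y' := by
    apply Subtype.ext; apply Subtype.ext
    change _ * (Y.1.1 + Y'.1.1) * _ = _ + _
    rw [Matrix.mul_add, Matrix.add_mul]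
  map_smul' c Y := by
    apply Subtype.ext; apply Subtype.ext
    change _ * (c • Y.1.1) * _ = c • _
    rw [Matrix.mul_smul, Matrix.smul_mul]

theorem adK_coe (k : K) (Y : pC) : (adK k Y).1.1 =
    (mat (k : G)).map (algebraMap ℝ ℂ) * Y.1.1 * ((mat (k : G)).map (algebraMap ℝ ℂ))ᵀ := rfl

/-- The conjugation `Y ↦ k Y ᵗk` is moved onto the isotropic vector, where it becomes the spinor
action by `quadVal_inv`. -/
theorem quartic_adK (x : SU2) (b : Fin 2 → ℂ) (Y : pC) :
    quartic b (adK (spinCover x) Y) = quartic ((x⁻¹ : SU2).1 *ᵥ b) Y := by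
  simp only [quartic_apply, quadVal_inv, adK_coe]
  generalize mat (spinCover x : G) = M
  generalize Y.1.1 = N
  simp only [Matrix.mul_apply, Fin.sum_univ_three, Matrix.map_apply, Matrix.transpose_apply,
    Complex.coe_algebraMap]
  ring

theorem evalPair_map (x : SU2) (l : ℤ) (a b : Fin 2 → ℂ) (t : V (2 * l) ⊗[ℂ] pC) :
    evalPair (2 * l) a b (TensorProduct.map (tau l (spinCover x)) (adK (spinCover x)) t) =
      evalPair (2 * l) ((x⁻¹ : SU2).1 *ᵥ a) ((x⁻¹ : SU2).1 *ᵥ b) t := by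
  induction t with
  | zero => simp
  | tmul v Y =>
    rw [TensorProduct.map_tmul, evalPair_tmul, evalPair_tmul, quartic_adK, tau_spinCover_apply,
      substV_coe, eval_subst]
  | add t t' h h' => rw [map_add, map_add, map_add, h, h']

theorem subst_X_ne_zero (x : SU2) (i : Fin 2) : subst x.1 (MvPolynomial.X i) ≠ 0 := by
  intro h
  have e : subst (x⁻¹ : SU2).1 (subst x.1 (MvPolynomial.X i)) = MvPolynomial.X i := by
    rw [← AlgHom.comp_apply, ← subst_mul]
    have : x.1 * (x⁻¹ : SU2).1 = 1 := congrArg Subtype.val (mul_inv_cancel x)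
    rw [this, subst_one]
    rfl
  rw [h, map_zero] at e
  exact MvPolynomial.X_ne_zero i e.symm

/-- In the polynomial model polarization commutes with linear substitutions, and `a₀b₁ - a₁b₀` is
multiplied by the determinant, which is one. -/
theorem injector_tau {l m : ℤ} (hm : -2 ≤ m ∧ m ≤ 2) (hlm : 0 ≤ l + m) (k : K)
    (f : V (2 * (l + m))) : injector l m (tau (l + m) k f) =
      TensorProduct.map (tau l k) (adK k) (injector l m f) := by
  obtain ⟨x, rfl⟩ := spinCover_surjective k
  -- Nonvanishing of this product says that the coordinates of both `a` and `x⁻¹a` are nonzero, as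
  -- the transvectant formula is applied at both points.
  have hp : (MvPolynomial.X 0 * MvPolynomial.X 1 * (subst (x⁻¹ : SU2).1 (MvPolynomial.X 0) *
      subst (x⁻¹ : SU2).1 (MvPolynomial.X 1)) : MvPolynomial (Fin 2) ℂ) ≠ 0 :=
    mul_ne_zero (mul_ne_zero (MvPolynomial.X_ne_zero 0) (MvPolynomial.X_ne_zero 1))
      (mul_ne_zero (subst_X_ne_zero _ 0) (subst_X_ne_zero _ 1))
  refine eq_of_evalPair hp fun a b ha => ?_
  simp only [map_mul, eval_subst, MvPolynomial.eval_X, mul_ne_zero_iff] at ha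
  obtain ⟨⟨ha0, ha1⟩, hb0, hb1⟩ := ha
  rw [evalPair_map, evalPair_injector hm hlm ha0 ha1, evalPair_injector hm hlm hb0 hb1,
    tau_spinCover_apply, substV_coe, polar_subst]
  congr 3
  have hdet : (x⁻¹ : SU2).1.det = 1 := (x⁻¹ : SU2).2.2
  rw [Matrix.det_fin_two] at hdet
  simp only [Matrix.mulVec, dotProduct, Fin.sum_univ_two]
  linear_combination (-(a 0 * b 1 - a 1 * b 0)) * hdet

/-- Since `k` is a real matrix, conjugation by it respects real and imaginary parts, and the claim
reduces to `rightReg_lieDeriv`. -/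
theorem piLie_adK (ν : a0 →ₗ[ℝ] ℂ) (σ : Fin 2 × Fin 2) (k : K) (Y : pC) (f : HK ν σ) :
    piLie ν σ (adK k Y : pC) (piK ν σ k f) = piK ν σ k (piLie ν σ (Y : _) f) := by
  have hinv : mat (k : G)⁻¹ = (mat (k : G))ᵀ := by
    rw [mat_inv]
    exact Matrix.inv_eq_left_inv k.2
  have hre : reSL (adK k Y).1 = Ad (k : G) (reSL Y.1) := by
    apply Subtype.ext
    ext i j
    simp [reSL, Ad, adK_coe, hinv, Matrix.mul_apply, Fin.sum_univ_three]
  have him : imSL (adK k Y).1 = Ad (k : G) (imSL Y.1) := by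
    apply Subtype.ext
    ext i j
    simp [imSL, Ad, adK_coe, hinv, Matrix.mul_apply, Fin.sum_univ_three]
  apply Subtype.ext
  change lieDeriv (reSL (adK k Y).1) (rightReg (k : G) f.1) +
      Complex.I • lieDeriv (imSL (adK k Y).1) (rightReg (k : G) f.1) =
    rightReg (k : G) (lieDeriv (reSL Y.1) f.1 + Complex.I • lieDeriv (imSL Y.1) f.1)
  rw [hre, him, map_add, map_smul, rightReg_lieDeriv, rightReg_lieDeriv]

theorem etaTilde_map {ν : a0 →ₗ[ℝ] ℂ} {σ : Fin 2 × Fin 2} {l : ℤ}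
    (η : (tau l).IntertwiningMap (piK ν σ)) (k : K) (t : V (2 * l) ⊗[ℂ] pC) :
    etaTilde ν σ l η.toLinearMap (TensorProduct.map (tau l k) (adK k) t) =
      piK ν σ k (etaTilde ν σ l η.toLinearMap t) := by
  induction t with
  | zero => simp
  | tmul v Y =>
    have h : η.toLinearMap (tau l k v) = piK ν σ k (η.toLinearMap v) :=
      Representation.IntertwiningMap.isIntertwining _ _ η k v
    change piLie ν σ (adK k Y : pC) (η.toLinearMap (tau l k v)) =
      piK ν σ k (piLie ν σ (Y : _) (η.toLinearMap v))
    rw [h, piLie_adK]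
  | add t t' h h' => rw [map_add, map_add, map_add, map_add, h, h']

theorem GammaFun_vec (ν : a0 →ₗ[ℝ] ℂ) (σ : Fin 2 × Fin 2) {l m r : ℤ}
    (hr : 0 ≤ r ∧ r ≤ 2 * (l + m)) (η : V (2 * l) →ₗ[ℂ] HK ν σ) :
    GammaFun ν σ l m η (vec (2 * (l + m)) r) =
      ∑ i : Fin 5, A (2 * l) m r i • piLie ν σ (X i : pC) (η (vec (2 * l) (r + 2 - m - (i : ℕ)))) := by
  rw [GammaFun, LinearMap.comp_apply, injector_vec hr, map_sum]
  refine Finset.sum_congr rfl fun i _ => ?_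
  rw [map_smul]
  rfl

/-- The map `Γ_{l,m}` between the spaces of `K`-homomorphisms. -/
noncomputable def gammaMap (ν : a0 →ₗ[ℝ] ℂ) (σ : Fin 2 × Fin 2) {l m : ℤ} (hm : -2 ≤ m ∧ m ≤ 2)
    (hlm : 0 ≤ l + m) : (tau l).IntertwiningMap (piK ν σ) →ₗ[ℂ]
      (tau (l + m)).IntertwiningMap (piK ν σ) where
  toFun η := LinearMap.intertwiningMap_of_isIntertwiningMap _ _ (GammaFun ν σ l m η.toLinearMap)
    fun k f => by
      change etaTilde ν σ l η.toLinearMap (injector l m (tau (l + m) k f)) = _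
      rw [injector_tau hm hlm, etaTilde_map]
      rfl
  map_add' η η' := by
    apply Representation.IntertwiningMap.ext
    change GammaFun ν σ l m (η.toLinearMap + η'.toLinearMap) = GammaFun ν σ l m η.toLinearMap +
      GammaFun ν σ l m η'.toLinearMap
    refine linearMap_ext_vec (by omega) fun r hr => ?_
    simp only [LinearMap.add_apply, GammaFun_vec ν σ (Finset.mem_Icc.mp hr), map_add, smul_add,
      Finset.sum_add_distrib]
  map_smul' c η := by
    apply Representation.IntertwiningMap.ext
    change GammaFun ν σ l m (c • η.toLinearMap) = c • GammaFun ν σ l m η.toLinearMap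
    refine linearMap_ext_vec (by omega) fun r hr => ?_
    simp only [LinearMap.smul_apply, GammaFun_vec ν σ (Finset.mem_Icc.mp hr), map_smul,
      Finset.smul_sum, smul_comm c]

theorem gammaMap_toLinearMap (ν : a0 →ₗ[ℝ] ℂ) (σ : Fin 2 × Fin 2) {l m : ℤ}
    (hm : -2 ≤ m ∧ m ≤ 2) (hlm : 0 ≤ l + m) (η : (tau l).IntertwiningMap (piK ν σ)) :
    (gammaMap ν σ hm hlm η).toLinearMap = GammaFun ν σ l m η.toLinearMap := rfl

end SL3

namespace SL3
open Matrix

/-! ### The action of `Γ_{l,m}` on the induced basis -/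

/-- This is the symmetry exchanging `x` and `y`; the sign is that of `(a₀b₁ - a₁b₀)^{2-m}` under the
exchange. -/
theorem A_reflect {L m k : ℤ} (hm : -2 ≤ m ∧ m ≤ 2) (i : Fin 5) :
    A L m (L + 2 * m - k) i.rev = (-1) ^ m * A L m k i := by
  unfold A
  by_cases hk : 0 ≤ k ∧ k ≤ L + 2 * m
  · rw [if_pos hk, if_pos (by omega)]
    have : (aCoef L m (L + 2 * m - k) i.rev : ℂ) = (-1) ^ m * aCoef L m k i := by
      obtain ⟨hm1, hm2⟩ := hm
      clear hk
      interval_cases m <;> fin_cases i <;> simp [aCoef, Fin.rev, zpow_ofNat] <;>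
        first | ring1 | exact Or.inl (by ring)
    rw [this]
    ring
  · rw [if_neg hk, if_neg (by omega), mul_zero]

/-- This is the source of the shift `lm - 3 + m(m+1)/2` in `γ_0`. With `c(j) = j(j+1)` it equals
`(c(l+m) - c(l) - c(2))/2`, the value of the Casimir cross term on `V_{2(l+m)}` inside `V_{2l} ⊗
V_4`. -/
theorem A_middle {l m r : ℤ} (hm : -2 ≤ m ∧ m ≤ 2) :
    (1 / 2) * (r + 1 - m) * A (2 * l) m r 1 + (1 / 2) * (2 * l - (r - 1 - m)) * A (2 * l) m r 3 =
      (1 / 3) * (l * m - 3 + m * (m + 1) / 2) * A (2 * l) m r 2 := by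
  unfold A
  split_ifs with hk
  · have h : (1 / 2) * (r + 1 - m) * (aCoef (2 * l) m r 1 : ℂ) +
        (1 / 2) * (2 * l - (r - 1 - m)) * (aCoef (2 * l) m r 3 : ℂ) =
        (1 / 3) * (l * m - 3 + m * (m + 1) / 2) * (aCoef (2 * l) m r 2 : ℂ) := by
      obtain ⟨hm1, hm2⟩ := hm
      clear hk
      interval_cases m <;> simp [aCoef] <;> ring
    linear_combination (1 / (dCoef (2 * l) m : ℂ)) * h
  · simp

theorem A_mul_piLie_X_one {ν : a0 →ₗ[ℝ] ℂ} {σ : Fin 2 × Fin 2} {l m r : ℤ} (hl : 0 ≤ l)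
    (hm : -2 ≤ m ∧ m ≤ 2) (η : (tau l).IntertwiningMap (piK ν σ)) (i : Fin 5) :
    A (2 * l) m r i * (piLie ν σ (X i : pC)
      (η.toLinearMap (vec (2 * l) (r + 2 - m - (i : ℕ))))).1 1 = A (2 * l) m r i *
      ![(ν H₂ + rho0 H₂ + l - (r + 2 - m - (i : ℕ) : ℤ)) *
          evalOne ν σ l η (vec (2 * l) (r + 2 - m - (i : ℕ))),
        -(1 / 2) * ((r + 2 - m - (i : ℕ) : ℤ) *
          evalOne ν σ l η (vec (2 * l) (r + 2 - m - (i : ℕ) - 1))),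
        -(1 / 3) * ((2 * (ν H₁ + rho0 H₁) - (ν H₂ + rho0 H₂)) *
          evalOne ν σ l η (vec (2 * l) (r + 2 - m - (i : ℕ)))),
        -(1 / 2) * ((2 * l - (r + 2 - m - (i : ℕ) : ℤ)) *
          evalOne ν σ l η (vec (2 * l) (r + 2 - m - (i : ℕ) + 1))),
        (ν H₂ + rho0 H₂ - l + (r + 2 - m - (i : ℕ) : ℤ)) *
          evalOne ν σ l η (vec (2 * l) (r + 2 - m - (i : ℕ)))] i := by
  by_cases h : 0 ≤ r + 2 - m - (i : ℕ) ∧ r + 2 - m - (i : ℕ) ≤ 2 * l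
  · rw [piLie_X_one hl η h]
  · rw [A_eq_zero hm h, zero_mul, zero_mul]

/-- Because `X_1` lowers and `X_3` raises the index, the terms `i = 1, 2, 3` all sit at `v_{r-m}`
and combine by `A_middle`. -/
theorem evalOne_gammaMap {ν : a0 →ₗ[ℝ] ℂ} {σ : Fin 2 × Fin 2} {l m r : ℤ} (hl : 0 ≤ l)
    (hm : -2 ≤ m ∧ m ≤ 2) (hlm : 0 ≤ l + m) (η : (tau l).IntertwiningMap (piK ν σ))
    (hr : 0 ≤ r ∧ r ≤ 2 * (l + m)) :
    evalOne ν σ (l + m) (gammaMap ν σ hm hlm η) (vec (2 * (l + m)) r) =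
      (ν H₂ + rho0 H₂ + l - (r + 2 - m)) *
        (A (2 * l) m r 0 * evalOne ν σ l η (vec (2 * l) (r + 2 - m))) -
      (1 / 3) * (2 * ν H₁ - ν H₂ + 2 * rho0 H₁ - rho0 H₂ + l * m - 3 + m * (m + 1) / 2) *
        (A (2 * l) m r 2 * evalOne ν σ l η (vec (2 * l) (r - m))) +
      (ν H₂ + rho0 H₂ - l + (r - 2 - m)) *
        (A (2 * l) m r 4 * evalOne ν σ l η (vec (2 * l) (r - 2 - m))) := by
  rw [evalOne_apply, gammaMap_toLinearMap, GammaFun_vec ν σ hr]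
  have e : (∑ i : Fin 5, A (2 * l) m r i • piLie ν σ (X i : pC)
      (η.toLinearMap (vec (2 * l) (r + 2 - m - (i : ℕ))))).1 1 =
      ∑ i : Fin 5, A (2 * l) m r i * (piLie ν σ (X i : pC)
        (η.toLinearMap (vec (2 * l) (r + 2 - m - (i : ℕ))))).1 1 := by
    rw [Submodule.coe_sum, Finset.sum_apply]
    rfl
  rw [e, Finset.sum_congr rfl fun i _ => A_mul_piLie_X_one hl hm η i, Fin.sum_univ_five]
  have i1 : r + 2 - m - 1 - 1 = r - m := by ring
  have i2 : r + 2 - m - 2 = r - m := by ring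
  have i3 : r + 2 - m - 3 + 1 = r - m := by ring
  have i4 : r + 2 - m - 4 = r - 2 - m := by ring
  simp [i1, i2, i3, i4]
  linear_combination (-evalOne ν σ l η (vec (2 * l) (r - m))) * A_middle (l := l) (r := r) hm

theorem neg_one_pow_eps_add (σ : Fin 2 × Fin 2) (l m : ℤ) :
    (-1 : ℂ) ^ eps σ (l + m) = (-1) ^ eps σ l * (-1) ^ m := by
  have h1 := eps_eq σ l
  have h2 := eps_eq σ (l + m)
  rw [← zpow_natCast (-1 : ℂ) (eps σ l), ← zpow_add₀ (by norm_num)]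
  exact (neg_one_zpow_eq_pow (by omega)).symm

theorem A_mul_symDual {σ : Fin 2 × Fin 2} {l m r p q : ℤ} (hm : -2 ≤ m ∧ m ≤ 2) (i : Fin 5)
    (hq : r + 2 - m - (i : ℕ) = q) :
    A (2 * l) m r i * symDual σ l p (vec (2 * l) q) =
      A (2 * l) m r i * ((if p = 2 * l - q then 1 else 0) +
        (-1) ^ eps σ l * (if p = q then 1 else 0)) := by
  subst hq
  by_cases h : 0 ≤ r + 2 - m - (i : ℕ) ∧ r + 2 - m - (i : ℕ) ≤ 2 * l
  · rw [symDual_vec σ l p h]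
  · rw [A_eq_zero hm h, zero_mul, zero_mul]

/-- The summand `v^*_{2l-p}` yields the three coefficients directly. The summand `v^*_p` yields the
same ones through `A_reflect`, whose sign `(-1)^m` is the change from `(-1)^{ε(l)}` to
`(-1)^{ε(l+m)}`. -/
theorem evalOne_gammaMap_symDual {ν : a0 →ₗ[ℝ] ℂ} {σ : Fin 2 × Fin 2} {l m p : ℤ} (hl : 0 ≤ l)
    (hm : -2 ≤ m ∧ m ≤ 2) (hlm : 0 ≤ l + m) {η : (tau l).IntertwiningMap (piK ν σ)}
    (hη : evalOne ν σ l η = symDual σ l p) :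
    evalOne ν σ (l + m) (gammaMap ν σ hm hlm η) =
      gammaNeg ν l m p • symDual σ (l + m) (p + m - 2) +
      gammaZero ν l m p • symDual σ (l + m) (p + m) +
      gammaPos ν l m p • symDual σ (l + m) (p + m + 2) := by
  refine linearMap_ext_vec (by omega) fun r hr => ?_
  have hr' := Finset.mem_Icc.mp hr
  rw [evalOne_gammaMap hl hm hlm η hr', hη, A_mul_symDual hm 0 (by simp),
    A_mul_symDual hm 2 (by simp; ring), A_mul_symDual hm 4 (by simp; ring)]
  simp only [LinearMap.add_apply, LinearMap.smul_apply, smul_eq_mul, symDual_vec _ _ _ hr']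
  rw [neg_one_pow_eps_add]
  have r0 := A_reflect (L := 2 * l) (k := r) hm 0
  have r2 := A_reflect (L := 2 * l) (k := r) hm 2
  have r4 := A_reflect (L := 2 * l) (k := r) hm 4
  have hsq : ((-1 : ℂ)) ^ m * (-1) ^ m = 1 := by
    rw [← mul_zpow]; norm_num
  simp only [show Fin.rev (0 : Fin 5) = 4 from rfl, show Fin.rev (2 : Fin 5) = 2 from rfl,
    show Fin.rev (4 : Fin 5) = 0 from rfl] at r0 r2 r4
  have t1 : gammaPos ν l m p * (if p + m + 2 = 2 * (l + m) - r then 1 else 0) =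
      (ν H₂ + rho0 H₂ + l - (r + 2 - m)) * (A (2 * l) m r 0 *
        (if p = 2 * l - (r + 2 - m) then 1 else 0)) := by
    by_cases h : p = 2 * l - (r + 2 - m)
    · rw [if_pos h, if_pos (by omega), gammaPos, show 2 * l - p + m - 2 = r by omega, h]
      push_cast; ring
    · rw [if_neg h, if_neg (by omega), mul_zero, mul_zero, mul_zero]
  have t2 : gammaZero ν l m p * (if p + m = 2 * (l + m) - r then 1 else 0) =
      -(1 / 3) * (2 * ν H₁ - ν H₂ + 2 * rho0 H₁ - rho0 H₂ + l * m - 3 + m * (m + 1) / 2) *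
        (A (2 * l) m r 2 * (if p = 2 * l - (r - m) then 1 else 0)) := by
    by_cases h : p = 2 * l - (r - m)
    · rw [if_pos h, if_pos (by omega), gammaZero, show 2 * l - p + m = r by omega]
      ring
    · rw [if_neg h, if_neg (by omega), mul_zero, mul_zero, mul_zero]
  have t3 : gammaNeg ν l m p * (if p + m - 2 = 2 * (l + m) - r then 1 else 0) =
      (ν H₂ + rho0 H₂ - l + (r - 2 - m)) * (A (2 * l) m r 4 *
        (if p = 2 * l - (r - 2 - m) then 1 else 0)) := by
    by_cases h : p = 2 * l - (r - 2 - m)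
    · rw [if_pos h, if_pos (by omega), gammaNeg, show 2 * l - p + m + 2 = r by omega, h]
      push_cast; ring
    · rw [if_neg h, if_neg (by omega), mul_zero, mul_zero, mul_zero]
  have t4 : gammaPos ν l m p * (-1) ^ m * (if p + m + 2 = r then 1 else 0) =
      (ν H₂ + rho0 H₂ - l + (r - 2 - m)) * (A (2 * l) m r 4 *
        (if p = r - 2 - m then 1 else 0)) := by
    by_cases h : p = r - 2 - m
    · rw [if_pos h, if_pos (by omega), gammaPos,
        show 2 * l - p + m - 2 = 2 * l + 2 * m - r by omega, r4, h]
      push_cast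
      linear_combination ((ν H₂ + rho0 H₂ - l + (r - 2 - m)) * A (2 * l) m r 4) * hsq
    · rw [if_neg h, if_neg (by omega), mul_zero, mul_zero, mul_zero]
  have t5 : gammaZero ν l m p * (-1) ^ m * (if p + m = r then 1 else 0) =
      -(1 / 3) * (2 * ν H₁ - ν H₂ + 2 * rho0 H₁ - rho0 H₂ + l * m - 3 + m * (m + 1) / 2) *
        (A (2 * l) m r 2 * (if p = r - m then 1 else 0)) := by
    by_cases h : p = r - m
    · rw [if_pos h, if_pos (by omega), gammaZero,
        show 2 * l - p + m = 2 * l + 2 * m - r by omega, r2]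
      linear_combination (-(1 / 3) * (2 * ν H₁ - ν H₂ + 2 * rho0 H₁ - rho0 H₂ + l * m - 3 +
        m * (m + 1) / 2) * A (2 * l) m r 2) * hsq
    · rw [if_neg h, if_neg (by omega), mul_zero, mul_zero, mul_zero]
  have t6 : gammaNeg ν l m p * (-1) ^ m * (if p + m - 2 = r then 1 else 0) =
      (ν H₂ + rho0 H₂ + l - (r + 2 - m)) * (A (2 * l) m r 0 *
        (if p = r + 2 - m then 1 else 0)) := by
    by_cases h : p = r + 2 - m
    · rw [if_pos h, if_pos (by omega), gammaNeg,
        show 2 * l - p + m + 2 = 2 * l + 2 * m - r by omega, r0, h]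
      push_cast
      linear_combination ((ν H₂ + rho0 H₂ + l - (r + 2 - m)) * A (2 * l) m r 0) * hsq
    · rw [if_neg h, if_neg (by omega), mul_zero, mul_zero, mul_zero]
  linear_combination -t1 - t2 - t3 - (-1) ^ eps σ l * (t4 + t5 + t6)

end SL3

namespace SL3
open Matrix

/-! ### The matrix of `Γ_{l,m}` -/

/-- The number `2d + δ` is the first index beyond the basis. The last basis index is `l` here, and
`l - 2` and `l - 1` in the two companion lemmas (when the basis is nonempty). -/
theorem two_mul_d_even {σ : Fin 2 × Fin 2} {l : ℤ} (hl : 0 ≤ l) (hσ : σ.2 = 0)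
    (h : Even ((σ.1 : ℕ) + l)) : 2 * (d σ l : ℤ) + delta σ l = l + 2 := by
  have h1 := eps_eq σ l
  have h2 := d_eq σ l
  have h3 : ((σ.2 : ℕ) : ℤ) = 0 := by rw [hσ]; rfl
  rw [Int.even_iff] at h
  rw [if_pos (by omega)] at h2
  unfold delta at *
  omega

theorem two_mul_d_odd {σ : Fin 2 × Fin 2} {l : ℤ} (hl : 0 ≤ l) (hσ : σ.2 = 0)
    (h : ¬Even ((σ.1 : ℕ) + l)) : 2 * (d σ l : ℤ) + delta σ l = l := by
  have h1 := eps_eq σ l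
  have h2 := d_eq σ l
  have h3 : ((σ.2 : ℕ) : ℤ) = 0 := by rw [hσ]; rfl
  rw [Int.even_iff] at h
  rw [if_neg (by omega)] at h2
  unfold delta at *
  omega

theorem two_mul_d_one {σ : Fin 2 × Fin 2} {l : ℤ} (hl : 0 ≤ l) (hσ : σ.2 ≠ 0) :
    2 * (d σ l : ℤ) + delta σ l = l + 1 := by
  have h2 := d_eq σ l
  have h3 : ((σ.2 : ℕ) : ℤ) = 1 := by
    have : (σ.2 : ℕ) ≠ 0 := fun e => hσ (Fin.ext e)
    omega
  unfold delta at *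
  split_ifs at h2 <;> omega

/-- With `n` zero rows on top, row `j` carries the index `2j + δ(l) + m - 2`. So the targets `p + m
- 2`, `p + m`, `p + m + 2` of column `k` lie in rows `k`, `k + 1`, `k + 2`. -/
theorem nRows_spec (σ : Fin 2 × Fin 2) (l m : ℤ) :
    delta σ (l + m) = delta σ l + m - 2 + 2 * nRows σ l m := by
  unfold nRows delta
  simp only [Int.even_iff]
  split_ifs <;> omega

theorem nRows_add_d {σ : Fin 2 × Fin 2} {l m : ℤ} (hl : 0 ≤ l) (hlm : 0 ≤ l + m) :
    nRows σ l m + d σ (l + m) = stackedRows σ l m := by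
  have hn := nRows_spec σ l m
  unfold stackedRows
  by_cases hσ : σ.2 = 0
  · by_cases hm : Even m
    · rw [if_neg (by simp [hm])]
      by_cases he : Even ((σ.1 : ℕ) + l)
      · have h1 := two_mul_d_even hl hσ he
        have h2 := two_mul_d_even hlm hσ (by rw [← add_assoc]; exact he.add hm)
        omega
      · have h1 := two_mul_d_odd hl hσ he
        have h2 := two_mul_d_odd hlm hσ (by
          rw [← add_assoc]; intro h; exact he ((Int.even_add.mp h).mpr hm))
        omega
    · rw [if_pos ⟨hσ, hm⟩]
      by_cases he : Even ((σ.1 : ℕ) + l)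
      · have h1 := two_mul_d_even hl hσ he
        have h2 := two_mul_d_odd hlm hσ (by
          rw [← add_assoc]; intro h; exact hm ((Int.even_add.mp h).mp he))
        rw [if_pos he]
        omega
      · have h1 := two_mul_d_odd hl hσ he
        have h2 := two_mul_d_even hlm hσ (by
          rw [← add_assoc, Int.even_add]; exact iff_of_false he hm)
        rw [if_neg he]
        omega
  · rw [if_neg (fun h => hσ h.1)]
    have h1 := two_mul_d_one hl hσ
    have h2 := two_mul_d_one hlm hσ
    omega

/-- A negative target index pushes the Clebsch-Gordan index above its upper bound `2(l + m)`; the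
next two lemmas are the same for the other targets. -/
theorem gammaNeg_eq_zero (ν : a0 →ₗ[ℝ] ℂ) {l m p : ℤ} (h : p + m - 2 < 0) :
    gammaNeg ν l m p = 0 := by
  rw [gammaNeg, A, if_neg (by omega), mul_zero]

theorem gammaZero_eq_zero (ν : a0 →ₗ[ℝ] ℂ) {l m p : ℤ} (h : p + m < 0) :
    gammaZero ν l m p = 0 := by
  rw [gammaZero, A, if_neg (by omega), mul_zero]

theorem gammaPos_eq_zero (ν : a0 →ₗ[ℝ] ℂ) {l m p : ℤ} (h : p + m + 2 < 0) :
    gammaPos ν l m p = 0 := by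
  rw [gammaPos, A, if_neg (by omega), mul_zero]

theorem gammaPos_eq_zero_of_lt (ν : a0 →ₗ[ℝ] ℂ) {l m p : ℤ} (h : 2 * l - p + m - 2 < 0) :
    gammaPos ν l m p = 0 := by
  rw [gammaPos, A, if_neg (by omega), mul_zero]

theorem diagBlock_eq_zero {r c j k : ℤ} {f : ℤ → ℂ} (h : j = k + r → f k = 0) :
    diagBlock r c f j k = 0 := by
  unfold diagBlock
  split_ifs with h1
  · exact h h1.1
  · rfl

theorem unitEntry_eq_zero {j₀ k₀ j k : ℤ} {x : ℂ} (h : j = j₀ → x = 0) :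
    unitEntry j₀ k₀ x j k = 0 := by
  unfold unitEntry
  split_ifs with h1
  · exact h h1.1
  · rfl

/-- The padding rows carry negative target indices. A corner entry lands there only if its unfolded
target exceeds `2(l + m)`, and then its coefficient vanishes. -/
theorem stacked_eq_zero (ν : a0 →ₗ[ℝ] ℂ) {σ : Fin 2 × Fin 2} {l m j k : ℤ} (hl : 0 ≤ l)
    (hj : j < nRows σ l m) : stacked ν σ l m j k = 0 := by
  have hn := nRows_spec σ l m
  have hδ : delta σ (l + m) = (l + m - (σ.2 : ℕ)) % 2 := rfl
  have h0 : ∀ c, diagBlock 0 c (fun k => gammaNeg ν l m (2 * k + delta σ l)) j k = 0 := fun c =>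
    diagBlock_eq_zero fun e => gammaNeg_eq_zero ν (by omega)
  have h1 : ∀ c, diagBlock 1 c (fun k => gammaZero ν l m (2 * k + delta σ l)) j k = 0 := fun c =>
    diagBlock_eq_zero fun e => gammaZero_eq_zero ν (by omega)
  have h2 : ∀ c, diagBlock 2 c (fun k => gammaPos ν l m (2 * k + delta σ l)) j k = 0 := fun c =>
    diagBlock_eq_zero fun e => gammaPos_eq_zero ν (by omega)
  simp only [stacked, h0, h1, h2, zero_add]
  by_cases hσ : σ.2 = 0
  · rw [if_pos hσ]
    by_cases he : Even ((σ.1 : ℕ) + l)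
    · have hd := two_mul_d_even hl hσ he
      rw [if_pos he, if_pos he, unitEntry_eq_zero fun e => gammaPos_eq_zero_of_lt ν (by omega),
        unitEntry_eq_zero fun e => by rw [gammaPos_eq_zero_of_lt ν (by omega), neg_zero], ite_self]
    · simp only [he, if_false, ite_self]
  · have hd := two_mul_d_one hl hσ
    rw [if_neg hσ]
    exact unitEntry_eq_zero fun e => by rw [gammaPos_eq_zero_of_lt ν (by omega), mul_zero]

/-- Since `χ` vanishes at negative indices, removing the `n` top rows loses nothing; `hD` keeps the
target from falling below the last row. -/
theorem sum_diagBlock {M : Type*} [AddCommGroup M] [Module ℂ M] {D : ℕ} {χ : ℤ → M}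
    (hχ : ∀ j < 0, χ j = 0) {n r c k : ℤ} (f : ℤ → ℂ) (hk : 0 ≤ k)
    (hD : k ≤ c → k + r - n < D) :
    ∑ j : Fin D, diagBlock r c f (n + ((j : ℕ) : ℤ)) k • χ (j : ℕ) =
      if k ≤ c then f k • χ (k + r - n) else 0 := by
  unfold diagBlock
  split_ifs with hc
  · rcases lt_or_ge (k + r - n) 0 with h | h
    · rw [hχ _ h, smul_zero]
      refine Finset.sum_eq_zero fun j _ => ?_
      rw [if_neg (by omega), zero_smul]
    · have := hD hc
      rw [Finset.sum_eq_single ⟨(k + r - n).toNat, by omega⟩]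
      · have e : (((k + r - n).toNat : ℕ) : ℤ) = k + r - n := by omega
        simp only [e]
        rw [if_pos (by omega)]
      · intro j _ hj
        have : (j : ℕ) ≠ (k + r - n).toNat := fun e => hj (Fin.ext e)
        rw [if_neg (by omega), zero_smul]
      · simp
  · refine Finset.sum_eq_zero fun j _ => ?_
    rw [if_neg (by omega), zero_smul]

theorem sum_unitEntry {M : Type*} [AddCommGroup M] [Module ℂ M] {D : ℕ} {χ : ℤ → M}
    (hχ : ∀ j < 0, χ j = 0) {n j₀ k₀ k : ℤ} (x : ℂ) (hD : j₀ - n < D) :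
    ∑ j : Fin D, unitEntry j₀ k₀ x (n + ((j : ℕ) : ℤ)) k • χ (j : ℕ) =
      if k = k₀ then x • χ (j₀ - n) else 0 := by
  unfold unitEntry
  split_ifs with hc
  · rcases lt_or_ge (j₀ - n) 0 with h | h
    · rw [hχ _ h, smul_zero]
      refine Finset.sum_eq_zero fun j _ => ?_
      rw [if_neg (by omega), zero_smul]
    · rw [Finset.sum_eq_single ⟨(j₀ - n).toNat, by omega⟩]
      · have e : (((j₀ - n).toNat : ℕ) : ℤ) = j₀ - n := by omega
        simp only [e]
        rw [if_pos (by omega)]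
      · intro j _ hj
        have : (j : ℕ) ≠ (j₀ - n).toNat := fun e => hj (Fin.ext e)
        rw [if_neg (by omega), zero_smul]
      · simp
  · refine Finset.sum_eq_zero fun j _ => ?_
    rw [if_neg (by omega), zero_smul]

theorem symDual_center (σ : Fin 2 × Fin 2) {l : ℤ} (h : eps σ l = 1) : symDual σ l l = 0 := by
  rw [symDual, h, show 2 * l - l = l by ring]
  simp

/-- The five shapes of the matrix differ only in how the targets of the last columns relate to the
centre `l + m`: short of it, at it, or beyond it. -/
theorem sum_RGamma (ν : a0 →ₗ[ℝ] ℂ) {σ : Fin 2 × Fin 2} {l m : ℤ} (hl : 0 ≤ l)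
    (hlm : 0 ≤ l + m) (k : Fin (d σ l)) :
    ∑ j, RGamma ν σ l m j k • symDual σ (l + m) (2 * ((j : ℕ) : ℤ) + delta σ (l + m)) =
      gammaNeg ν l m (2 * ((k : ℕ) : ℤ) + delta σ l) •
          symDual σ (l + m) (2 * ((k : ℕ) : ℤ) + delta σ l + m - 2) +
        gammaZero ν l m (2 * ((k : ℕ) : ℤ) + delta σ l) •
          symDual σ (l + m) (2 * ((k : ℕ) : ℤ) + delta σ l + m) +
        gammaPos ν l m (2 * ((k : ℕ) : ℤ) + delta σ l) •
          symDual σ (l + m) (2 * ((k : ℕ) : ℤ) + delta σ l + m + 2) := by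
  have hn := nRows_spec σ l m
  have hT := nRows_add_d (σ := σ) hl hlm
  have hδ' : delta σ (l + m) = (l + m - (σ.2 : ℕ)) % 2 := rfl
  have hε := eps_eq σ (l + m)
  have hk : ((k : ℕ) : ℤ) < d σ l := by exact_mod_cast k.2
  have hk0 : (0 : ℤ) ≤ ((k : ℕ) : ℤ) := by omega
  simp only [RGamma, Matrix.of_apply]
  generalize ((k : ℕ) : ℤ) = κ at *
  obtain ⟨χ, hχ⟩ : ∃ χ : ℤ → Module.Dual ℂ (V (2 * (l + m))),
      ∀ j, χ j = symDual σ (l + m) (2 * j + delta σ (l + m)) := ⟨_, fun _ => rfl⟩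
  have hneg : ∀ j < 0, χ j = 0 := fun j hj => by
    rw [hχ]; exact symDual_eq_zero σ (by omega)
  have c0 : symDual σ (l + m) (2 * κ + delta σ l + m - 2) = χ (κ + 0 - nRows σ l m) := by
    rw [hχ]; congr 1; omega
  have c1 : symDual σ (l + m) (2 * κ + delta σ l + m) = χ (κ + 1 - nRows σ l m) := by
    rw [hχ]; congr 1; omega
  have c2 : symDual σ (l + m) (2 * κ + delta σ l + m + 2) = χ (κ + 2 - nRows σ l m) := by
    rw [hχ]; congr 1; omega
  rw [c0, c1, c2]
  have hrefl : ∀ i j, i + j + delta σ (l + m) = l + m →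
      χ i = (-1 : ℂ) ^ eps σ (l + m) • χ j := by
    intro i j h
    rw [hχ, hχ, symDual_reflect]
    congr 2
    omega
  have hcenter : ∀ i, eps σ (l + m) = 1 → 2 * i + delta σ (l + m) = l + m → χ i = 0 := by
    intro i h h'
    rw [hχ, h', symDual_center σ h]
  simp only [← hχ]
  unfold stackedRows at hT
  by_cases hσ : σ.2 = 0
  · have h3 : ((σ.2 : ℕ) : ℤ) = 0 := by rw [hσ]; rfl
    by_cases hm : Even m
    · rw [if_neg (by simp [hm])] at hT
      by_cases he : Even ((σ.1 : ℕ) + l)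
      · have hd := two_mul_d_even hl hσ he
        have hε0 : eps σ (l + m) = 0 := by rw [Int.even_iff] at hm he; omega
        simp only [stacked, if_pos hσ, if_pos hm, if_pos he, add_smul, Finset.sum_add_distrib]
        rw [sum_diagBlock hneg _ hk0 (by omega), sum_diagBlock hneg _ hk0 (by omega),
          sum_diagBlock hneg _ hk0 (by omega), sum_unitEntry hneg _ (by omega), if_pos (by omega),
          if_pos (by omega)]
        -- In the last column `p = l`, and the target `l + m + 2` folds to `l + m - 2` with sign
        -- `+1`.
        by_cases hκ : κ = d σ l - 1
        · rw [if_neg (by omega), if_pos hκ, add_zero,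
            hrefl (κ + 2 - nRows σ l m) (d σ l - 1 - nRows σ l m) (by omega), hε0, pow_zero,
            one_smul, show 2 * κ + delta σ l = l by omega]
        · rw [if_pos (by omega), if_neg hκ, add_zero]
      · have hd := two_mul_d_odd hl hσ he
        have hε1 : eps σ (l + m) = 1 := by rw [Int.even_iff] at hm he; omega
        simp only [stacked, if_pos hσ, if_pos hm, if_neg he, add_smul, Finset.sum_add_distrib]
        rw [sum_diagBlock hneg _ hk0 (by omega), sum_diagBlock hneg _ hk0 (by omega),
          sum_diagBlock hneg _ hk0 (by omega), if_pos (by omega), if_pos (by omega)]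
        -- In the last column `p = l - 2`, and the target of `γ_1` is the centre, where the
        -- functional is zero.
        by_cases hκ : κ = d σ l - 1
        · rw [if_neg (by omega), hcenter (κ + 2 - nRows σ l m) hε1 (by omega), smul_zero]
        · rw [if_pos (by omega)]
    · rw [if_pos ⟨hσ, hm⟩] at hT
      by_cases he : Even ((σ.1 : ℕ) + l)
      · have hd := two_mul_d_even hl hσ he
        have hε1 : eps σ (l + m) = 1 := by rw [Int.even_iff] at hm he; omega
        rw [if_pos he] at hT
        simp only [stacked, if_pos hσ, if_neg hm, if_pos he, add_smul, Finset.sum_add_distrib]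
        rw [sum_diagBlock hneg _ hk0 (by omega), sum_diagBlock hneg _ hk0 (by omega),
          sum_diagBlock hneg _ hk0 (by omega), sum_unitEntry hneg _ (by omega), if_pos (by omega)]
        -- In the last column `p = l`: the target of `γ_0` is the vanishing centre, and that of
        -- `γ_1` folds to `l + m - 2` with sign `-1`.
        by_cases hκ : κ = d σ l - 1
        · rw [if_neg (by omega), if_neg (by omega), if_pos hκ, add_zero, add_zero,
            hcenter (κ + 1 - nRows σ l m) hε1 (by omega),
            hrefl (κ + 2 - nRows σ l m) (d σ l - 1 - nRows σ l m) (by omega), hε1, pow_one,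
            show 2 * κ + delta σ l = l by omega, smul_zero, add_zero, neg_smul, neg_smul, one_smul,
            smul_neg, add_zero]
        · rw [if_pos (by omega), if_neg hκ, add_zero]
          -- In the column before it `p = l - 2`, and the target of `γ_1` is the vanishing centre.
          by_cases hκ2 : κ = d σ l - 2
          · rw [if_neg (by omega), hcenter (κ + 2 - nRows σ l m) hε1 (by omega), smul_zero]
          · rw [if_pos (by omega)]
      -- Here `p ≤ l - 2` and the centre belongs to the target basis, so no target needs folding.
      · rw [if_neg he] at hT
        simp only [stacked, if_pos hσ, if_neg hm, if_neg he, add_smul, Finset.sum_add_distrib]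
        rw [sum_diagBlock hneg _ hk0 (by omega), sum_diagBlock hneg _ hk0 (by omega),
          sum_diagBlock hneg _ hk0 (by omega), if_pos (by omega), if_pos (by omega),
          if_pos (by omega)]
  · have hd := two_mul_d_one hl hσ
    rw [if_neg (fun h => hσ h.1)] at hT
    simp only [stacked, if_neg hσ, add_smul, Finset.sum_add_distrib]
    rw [sum_diagBlock hneg _ hk0 (by omega), sum_diagBlock hneg _ hk0 (by omega),
      sum_diagBlock hneg _ hk0 (by omega), sum_unitEntry hneg _ (by omega), if_pos (by omega),
      if_pos (by omega)]
    -- In the last column `p = l - 1`, and the target `l + m + 1` folds across the centre to `l + m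
    -- - 1`.
    by_cases hκ : κ = d σ l - 1
    · rw [if_neg (by omega), if_pos hκ, add_zero,
        hrefl (κ + 2 - nRows σ l m) (d σ l - nRows σ l m) (by omega), smul_smul,
        show 2 * κ + delta σ l = l - 1 by omega,
        mul_comm (gammaPos ν l m (l - 1))]
    · rw [if_pos (by omega), if_neg hκ, add_zero]

theorem gammaMap_inducedBasis (ν : a0 →ₗ[ℝ] ℂ) (σ : Fin 2 × Fin 2) {l m : ℤ} (hl : 0 ≤ l)
    (hm : -2 ≤ m ∧ m ≤ 2) (hlm : 0 ≤ l + m) (k : Fin (d σ l)) :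
    gammaMap ν σ hm hlm (inducedBasis ν σ hl k) =
      ∑ j, RGamma ν σ l m j k • inducedBasis ν σ hlm j := by
  apply evalOne_injective
  rw [map_sum]
  simp only [map_smul, inducedBasis_apply ν σ hlm, evalOne_frob]
  rw [sum_RGamma ν hl hlm k]
  exact evalOne_gammaMap_symDual hl hm hlm (by rw [inducedBasis_apply, evalOne_frob])

theorem pMatMul_block (ν : a0 →ₗ[ℝ] ℂ) (σ : Fin 2 × Fin 2) {l m r : ℤ} (hl : 0 ≤ l)
    (hm : -2 ≤ m ∧ m ≤ 2) (hr : 0 ≤ r ∧ r ≤ 2 * (l + m)) (k : Fin (d σ l)) :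
    pMatMul ν σ l m (fun q => block ν σ l q (k : ℕ)) r =
      GammaFun ν σ l m (inducedBasis ν σ hl k).toLinearMap (vec (2 * (l + m)) r) := by
  rw [GammaFun_vec ν σ hr, pMatMul]
  refine Finset.sum_congr rfl fun i _ => ?_
  simp only [iotaMat, block, s_eq_frob ν hl (index_mem_Z σ l k), inducedBasis_apply]
  by_cases h : 0 ≤ r + 2 - m - (i : ℕ) ∧ r + 2 - m - (i : ℕ) ≤ 2 * l
  · rw [Finset.sum_eq_single (r + 2 - m - (i : ℕ)), if_pos rfl]
    · intro q _ hq
      rw [if_neg hq, zero_smul]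
    · intro hn
      exact absurd (Finset.mem_Icc.mpr h) hn
  -- When the only admissible `q` lies outside the range of summation, its coefficient is zero as
  -- well.
  · rw [A_eq_zero hm h, zero_smul, Finset.sum_eq_zero]
    intro q _
    rw [ite_self, zero_smul]

theorem nonneg_of_d_pos {σ : Fin 2 × Fin 2} {l : ℤ} (h : 0 < d σ l) : 0 ≤ l := by
  obtain ⟨p, hp⟩ := Finset.card_pos.mp h
  have := mem_Z.mp hp
  omega

end SL3

/-! ### Assembly of the theorem -/

theorem mainTheorem1 (ν : a0 →ₗ[ℝ] ℂ) (σ : Fin 2 × Fin 2) (l m : ℤ) (hl : 0 ≤ l)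
    (hm : -2 ≤ m ∧ m ≤ 2) (hd : 0 < d σ l) (hd' : 0 < d σ (l + m)) :
    -- the elementary functions restrict to the given matrix coefficients on `K`
    (∀ p ∈ Z σ l, ∀ q ∈ Finset.Icc 0 (2 * l),
      restrictK ν σ (s ν σ l p q) = matCoeff σ l p q) ∧
    (∀ p ∈ Z σ (l + m), ∀ q ∈ Finset.Icc 0 (2 * (l + m)),
      restrictK ν σ (s ν σ (l + m) p q) = matCoeff σ (l + m) p q) ∧
    -- `R(Γ)` with `n(σ₀; l, m)` zero rows on top of it is the matrix `stacked`
    nRows σ l m + d σ (l + m) = stackedRows σ l m ∧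
    (∀ j k : ℤ, 0 ≤ j → j < nRows σ l m → 0 ≤ k → k < d σ l → stacked ν σ l m j k = 0) ∧
    -- the contiguous relation `ℭ_{l,m} 𝐒(σ₀; l) = 𝐒(σ₀; l+m) R(Γ_{l,m})`
    (∀ r ∈ Finset.Icc 0 (2 * (l + m)), ∀ k : Fin (d σ l),
      pMatMul ν σ l m (fun q => block ν σ l q (k : ℕ)) r =
        ∑ j : Fin (d σ (l + m)), RGamma ν σ l m j k • block ν σ (l + m) r (j : ℕ)) ∧
    -- `Γ_{l,m}` is a linear map between the spaces of `K`-homomorphisms, and `R(Γ_{l,m})` is its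
    -- matrix with respect to the induced bases
    ∃ (Γ : (tau l).IntertwiningMap (piK ν σ) →ₗ[ℂ] (tau (l + m)).IntertwiningMap (piK ν σ))
      (b : Module.Basis (Fin (d σ l)) ℂ ((tau l).IntertwiningMap (piK ν σ)))
      (b' : Module.Basis (Fin (d σ (l + m))) ℂ ((tau (l + m)).IntertwiningMap (piK ν σ))),
      (∀ η, (Γ η).toLinearMap = GammaFun ν σ l m η.toLinearMap) ∧
      (∀ k, (b k).toLinearMap = S ν σ l (2 * (k : ℕ) + delta σ l)) ∧
      (∀ j, (b' j).toLinearMap = S ν σ (l + m) (2 * (j : ℕ) + delta σ (l + m))) ∧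
      LinearMap.toMatrix b b' Γ = RGamma ν σ l m := by
  have hlm : 0 ≤ l + m := nonneg_of_d_pos hd'
  refine ⟨fun p hp q _ => restrictK_s ν hl hp q, fun p hp q _ => restrictK_s ν hlm hp q,
    nRows_add_d hl hlm, fun j k _ hj _ _ => stacked_eq_zero ν hl hj, fun r hr k => ?_,
    gammaMap ν σ hm hlm, inducedBasis ν σ hl, inducedBasis ν σ hlm,
    gammaMap_toLinearMap ν σ hm hlm, fun k => ?_, fun j => ?_, ?_⟩
  · rw [pMatMul_block ν σ hl hm (Finset.mem_Icc.mp hr), ← gammaMap_toLinearMap ν σ hm hlm,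
      gammaMap_inducedBasis, Representation.IntertwiningMap.toLinearMap_sum, LinearMap.sum_apply]
    refine Finset.sum_congr rfl fun j _ => ?_
    rw [block, s_eq_frob ν hlm (index_mem_Z σ (l + m) j), inducedBasis_apply]
    rfl
  · rw [inducedBasis_apply, S_eq_frob ν hl (index_mem_Z σ l k)]
  · rw [inducedBasis_apply, S_eq_frob ν hlm (index_mem_Z σ (l + m) j)]
  · ext j k
    rw [LinearMap.toMatrix_apply, gammaMap_inducedBasis, Module.Basis.repr_sum_self]
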